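/- **Setting.** Let $F=(A,R)$ be an argumentation framework: $A$ is a finite non-empty set of arguments and $R\subseteq A\times A$ the attack relation. A set $S\subseteq A$ is conflict-free if $(S\times S)\cap R=\emptyset$; it defends $s$ if every attacker of $s$ is attacked by some element of $S$; it is *admissible* if it is conflict-free and defends all its elements. Write $S^+=S\cup\{a\mid \exists b\in S,\ (b,a)\in R\}$. An admissible $S$ is *complete* if it contains every argument that it defends, *preferred* if no proper superset is admissible, *semi-stable* if there is no admissible $S'$ with $S^+\subsetneq S'^+$, *stable* if $S$ attacks every $s\in A\setminus S$. A conflict-free $S$ is *stage* if there is no conflict-free $S'$ with $S^+\subsetneq S'^+$. For one of these six semantics $\mathcal S$, an argument $c\in A$ and a set $P\subseteq A$, the projected credulous count is $\#\mathrm{PCred}_{\mathcal S}(F,c,P)=|\{S\cap P\mid S \text{ an } \mathcal S\text{-extension of } F,\ c\in S\}|$. A tree decomposition of the underlying undirected graph of $F$, with rooted tree $T$, root $n$ and bags $\chi(t)$, is *nice* if $\chi(n)=\emptyset$ and every node $t$ is a leaf with $\chi(t)=\emptyset$; or has one child $t'$ and *introduces* $a$ ($\chi(t)=\chi(t')\uplus\{a\}$)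 or *removes* $a$ ($\chi(t')=\chi(t)\uplus\{a\}$); or is a *join* with two children that have the same non-empty bag $\chi(t)$. Let $R_t=R\cap(\chi(t)\times\chi(t))$, $S\rightarrowtail S'=\{s\in S\mid \exists s'\in S': (s,s')\in R_t\}$ and $S\leftarrowtail S'=\{s\in S\mid \exists s'\in S': (s',s)\in R_t\}$. **Local algorithms.** A table is a set of rows; each row $u$ has an extension part $E(u)$, always called $I$ below. At a leaf the table is the single row all of whose components are $\emptyset$. At the other nodes the table consists of the rows obtained from the rows of the child table(s) as follows. When $a$ is introduced, $J\in\{I,I\cup\{a\}\}$ is the new extension part, $J\rightarrowtail J=\emptyset$ is required, and only rows with $J\cap\{c\}=\chi(t)\cap\{c\}$ are put into the table. When $a$ is removed, it is deleted from all components. * ADM, rows $\langle I,O,D\rangle$. Introduce: $\langle J,\ O\cup(\chi(t)\rightarrowtail J),\ D\cup(\chi(t)\leftarrowtail J)\rangle$. Remove: requires $a\notin O\setminus D$. Join of rows with equal $I$: $\langle I,O_1\cup O_2,D_1\cup D_2\rangle$. * STAB, rows $\langle I,D\rangle$: as ADM without $O$; removing $a$ requires $a\in I\cup D$. * COMP,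 rows $\langle I,\mathcal D,\mathcal{DC},\mathcal O,\mathcal{OC}\rangle$. Introduce: $\langle J,\ \mathcal D\cup(D\leftarrowtail J),\ D,\ \mathcal O\cup(O\leftarrowtail O),\ O\rangle$ for $D\in\{\mathcal{DC},\mathcal{DC}\cup\{a\}\}$ and $O\in\{\mathcal{OC},\mathcal{OC}\cup\{a\}\}$ with $J,D,O$ pairwise disjoint and $J\rightarrowtail O=O\rightarrowtail J=\emptyset$. Remove: requires $a\in I\cup\mathcal D\cup\mathcal O$. Join of rows with equal $I,\mathcal{DC},\mathcal{OC}$: unite the $\mathcal D$'s and the $\mathcal O$'s. * STAG, PREF, SEMI, rows $\langle w,\mathcal C\rangle$: a witness $w$ and a set $\mathcal C$ of counter-witnesses, which are pairs of a witness-type tuple and a flag in $\{\bot,\top\}$. At a leaf, $\mathcal C=\emptyset$. - Witnesses of STAG are tuples $\langle I,\mathcal A,\mathcal{AC}\rangle$. Introduce: $\langle J,\ \mathcal A\cup(\chi(t)\leftarrowtail J),\ AC\rangle$ for $AC\in\{\mathcal{AC},\mathcal{AC}\cup\{a\}\}$ with $J\cap AC=\emptyset$ and $\chi(t)\leftarrowtail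 J\subseteq AC$. Remove: requires $a\notin\mathcal{AC}\setminus\mathcal A$. Join of tuples with equal $I,\mathcal{AC}$: unite the $\mathcal A$'s. The key is $K(w)=I\cup\mathcal{AC}$. - Witnesses of PREF are the rows of ADM, treated as in ADM; $K(w)=I$. - Witnesses of SEMI are tuples $\langle I,O,D,\mathcal{AC}\rangle$, where $I,O,D$ are treated as in ADM and $\mathcal{AC}$ as in STAG with $D$ in place of $\mathcal A$ (removal requires both conditions, and joins require equal $I$ and $\mathcal{AC}$); $K(w)=I\cup\mathcal{AC}$. - When the witness $w$ becomes $w'$ at an introduce node, the new set of counter-witnesses is the set of all $\langle v',\ \sigma\vee(K(w')\subsetneq K(v'))\rangle$ where $\langle v,\sigma\rangle\in\mathcal C\cup\{\langle w,\bot\rangle\}$, $v'$ arises from $v$ by the introduction (without the condition on $c$), and $K(w')\subseteq K(v')$. At a remove node, counter-witnesses are treated like witnesses, keep their flag, and are dropped if the removal condition fails. At a join, the new set is $(\mathcal C_1\bowtie\mathcal C_2)\cup(\mathcal C_1\bowtie\{\langle w_2,\bot\rangle\})\cup(\{\langle w_1,\bot\rangle\}\bowtie\mathcal C_2)$, where $\bowtie$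 joins the tuples and takes the disjunction of the flags. **The three passes of $\mathrm{MDPA}_{\mathbb S}$.** (1) Bottom-up, compute the tables $\tau(t)$ by the local algorithm $\mathbb S$. The *origins* of a row $u\in\tau(t)$ are the rows (at a join: the pairs of rows) of the child table(s) from which $\mathbb S$ produces $u$; the origins of a set of rows are the union of the origins of its elements. (2) Top-down, compute the pruned tables $\nu(t)$: $\nu(n)$ consists of the rows of $\tau(n)$ that have no counter-witness flagged $\top$ (all rows for ADM, COMP, STAB), and the table $\nu(t')$ of a child $t'$ of $t$ consists of the rows of $\tau(t')$ that occur in an origin of a row of $\nu(t)$. (3) Bottom-up, compute $\pi(t)=\{\langle\sigma,\mathrm{ipc}(t,\sigma)\rangle\mid\emptyset\ne\sigma\subseteq B \text{ for some bucket } B\}$, where the buckets are the classes of the rows $u\in\nu(t)$ with equal $E(u)\cap P$. Here $\mathrm{ipc}(t,\sigma)=1$ at leaves, and at other nodes $$\mathrm{ipc}(t,\sigma)=\Big|\mathrm{pc}(t,\sigma)+\sum_{\emptyset\subsetneq\varphi\subsetneq\sigma}(-1)^{|\varphi|}\,\mathrm{ipc}(t,\varphi)\Big|,\qquad \mathrm{pc}(t,\sigma)=\sum_{\emptyset\subsetneq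 O\subseteq \mathrm{origins}(t,\sigma)}(-1)^{|O|-1}\,\mathrm{sipc}(O).$$ In this formula, for a node with one child $t'$, $\mathrm{sipc}(O)=\mathrm{sipc}(\pi(t'),O)$ is the count stored for $O$ in $\pi(t')$ ($0$ if there is none); for a join, $\mathrm{sipc}(O)=\mathrm{sipc}(\pi(t_1),O_{(1)})\cdot\mathrm{sipc}(\pi(t_2),O_{(2)})$ with $O_{(i)}$ the set of $i$-th components of $O$. **Theorem.** For every framework $F=(A,R)$, all $c\in A$ and $P\subseteq A$, every nice tree decomposition of the underlying graph of $F$, and each local algorithm $\mathbb S\in\{\mathrm{ADM},\mathrm{COMP},\mathrm{PREF},\mathrm{STAG},\mathrm{SEMI},\mathrm{STAB}\}$ with corresponding semantics $\mathcal S$ (admissible, complete, preferred, stage, semi-stable, stable), algorithm $\mathrm{MDPA}_{\mathbb S}$ is correct: the value $\mathrm{sipc}(\pi(n),\nu(n))$ that it returns at the root $n$ equals $\#\mathrm{PCred}_{\mathcal S}(F,c,P)$. -/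

import Mathlib

universe u

/-! ### Abstract argumentation -/

/-- An argumentation framework whose set of arguments is the (finite) type `V`; the pair
`(a, b) ∈ R` means that `a` attacks `b`. -/
structure AF (V : Type u) where
  R : Finset (V × V)

/-- `S ↣_R S'`: the elements of `S` that attack some element of `S'`. -/
def attackersIn {V : Type u} [DecidableEq V] (R : Finset (V × V)) (S S' : Finset V) : Finset V :=
  S.filter fun s => ∃ s' ∈ S', (s, s') ∈ R

/-- `S ↢_R S'`: the elements of `S` that are attacked by some element of `S'`. -/
def attackedIn {V : Type u} [DecidableEq V] (R : Finset (V × V)) (S S' : Finset V) : Finset V :=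
  S.filter fun s => ∃ s' ∈ S', (s', s) ∈ R

/-- The six semantics. -/
inductive Semantics where
  | admissible
  | complete
  | preferred
  | stage
  | semistable
  | stable

namespace AF

variable {V : Type u}

/-- `s` is defended by `S`. -/
def Defends (F : AF V) (S : Finset V) (s : V) : Prop :=
  ∀ s', (s', s) ∈ F.R → ∃ s'' ∈ S, (s'', s') ∈ F.R

def ConflictFree (F : AF V) (S : Finset V) : Prop :=
  ∀ s ∈ S, ∀ s' ∈ S, (s, s') ∉ F.R

def Admissible (F : AF V) (S : Finset V) : Prop :=
  F.ConflictFree S ∧ ∀ s ∈ S, F.Defends S s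

/-- The range `S⁺` of `S`: `S` together with all arguments attacked by `S`. -/
def range (F : AF V) (S : Finset V) : Set V :=
  {a | a ∈ S ∨ ∃ b ∈ S, (b, a) ∈ F.R}

/-- `S` is an extension of `F` under the given semantics. -/
def IsExtension (F : AF V) : Semantics → Finset V → Prop
  | .admissible, S => F.Admissible S
  | .complete, S => F.Admissible S ∧ ∀ s, s ∈ S ↔ F.Defends S s
  | .preferred, S => F.Admissible S ∧ ¬ ∃ S', S ⊂ S' ∧ F.Admissible S'
  | .stage, S => F.ConflictFree S ∧ ¬ ∃ S', F.ConflictFree S' ∧ F.range S ⊂ F.range S'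
  | .semistable, S => F.Admissible S ∧ ¬ ∃ S', F.Admissible S' ∧ F.range S ⊂ F.range S'
  | .stable, S => F.Admissible S ∧ ∀ s, s ∉ S → ∃ s' ∈ S, (s', s) ∈ F.R

/-- The projected credulous count: the number of sets `S ∩ P`, where `S` ranges over the
extensions that contain the argument `c`. -/
noncomputable def projectedCredulousCount [DecidableEq V] (F : AF V) (sem : Semantics) (c : V)
    (P : Finset V) : ℕ :=
  Set.ncard {X : Finset V | ∃ S, F.IsExtension sem S ∧ c ∈ S ∧ X = S ∩ P}

/-- The underlying undirected graph of `F`. (Self-attacks give no edge; they are irrelevant for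
tree decompositions.) -/
def underlyingGraph (F : AF V) : SimpleGraph V :=
  SimpleGraph.fromRel fun a b => (a, b) ∈ F.R

/-- The attacks of the bag-framework of a bag `X`. -/
def bagAttacks [DecidableEq V] (F : AF V) (X : Finset V) : Finset (V × V) :=
  F.R ∩ X ×ˢ X

end AF

/-! ### Rooted trees and nice tree decompositions -/

/-- Rooted ordered trees in which each node carries a label and has at most two children. -/
inductive RTree (α : Type u) where
  | leaf (x : α)
  | one (x : α) (t : RTree α)
  | two (x : α) (t₁ t₂ : RTree α)

namespace RTree

/-- The label of the root. -/
def root {α : Type u} : RTree α → α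
  | leaf x => x
  | one x _ => x
  | two x _ _ => x

/-- Nodes are addressed by the path that leads to them from the root (`false` is the only or
the first child, `true` is the second child); `t.get? p` is the label of the node `p`, and `none`
if there is no such node. -/
def get? {α : Type u} : RTree α → List Bool → Option α
  | leaf x, [] => some x
  | one x _, [] => some x
  | two x _ _, [] => some x
  | one _ t, false :: p => t.get? p
  | two _ t₁ _, false :: p => t₁.get? p
  | two _ _ t₂, true :: p => t₂.get? p
  | _, _ => none

/-- The node `s` lies on the path between the nodes `r` and `t`: it is an ancestor of (or equal
to) one of them, and a descendant of (or equal to) all their common ancestors. -/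
def OnPath (r s t : List Bool) : Prop :=
  (s <+: r ∨ s <+: t) ∧ ∀ p, p <+: r → p <+: t → p <+: s

/-- The tree `T` of bags is a tree decomposition of the graph `G`. -/
structure IsTreeDecomposition {V : Type u} [DecidableEq V] (G : SimpleGraph V)
    (T : RTree (Finset V)) : Prop where
  vertex_mem : ∀ v, ∃ t X, T.get? t = some X ∧ v ∈ X
  edge_mem : ∀ v w, G.Adj v w → ∃ t X, T.get? t = some X ∧ v ∈ X ∧ w ∈ X
  connected : ∀ r s t X Y Z, T.get? r = some X → T.get? s = some Y → T.get? t = some Z →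
    OnPath r s t → X ∩ Z ⊆ Y

/-- Every node is a leaf with empty bag, an introduce node, a remove node, or a join node. -/
def NiceNodes {V : Type u} : RTree (Finset V) → Prop
  | leaf X => X = ∅
  | one X t =>
      ((t.root ⊆ X ∧ X.card = t.root.card + 1) ∨ (X ⊆ t.root ∧ t.root.card = X.card + 1)) ∧
        t.NiceNodes
  | two X t₁ t₂ => X = t₁.root ∧ X = t₂.root ∧ X ≠ ∅ ∧ t₁.NiceNodes ∧ t₂.NiceNodes

/-- `T` is nice: all nodes are of one of the four types, and the root bag is empty. -/
def IsNice {V : Type u} (T : RTree (Finset V)) : Prop :=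
  T.NiceNodes ∧ T.root = ∅

end RTree

/-! ### Local algorithms -/

/-- A local (table) algorithm, given by what it does with the rows of the child tables.
`ext` is the extension part of a row; `accept` tells which rows of the root table stand for
solutions. -/
structure LocalAlg (V : Type u) where
  Row : Type u
  dec : DecidableEq Row
  ext : Row → Finset V
  /-- the row of a leaf -/
  leafRow : Row
  /-- the rows obtained from a row by introducing the argument `a`, giving the bag `X` -/
  introduce (X : Finset V) (a : V) : Row → Finset Row
  /-- the rows obtained from a row by removing the argument `a` -/
  remove (a : V) : Row → Finset Row
  /-- the rows obtained by joining two rows -/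
  join : Row → Row → Finset Row
  accept : Row → Bool

attribute [instance] LocalAlg.dec

namespace LocalAlg

variable {V : Type u} [DecidableEq V]

/-- The table at a node with bag `X` whose only child has bag `X'` and table `τ`: if `X' ⊆ X`, the
node introduces the element `a` of `X \ X'`, otherwise it removes the element `a` of `X' \ X`. -/
def unaryTable (L : LocalAlg V) (X X' : Finset V) (τ : Finset L.Row) : Finset L.Row :=
  if X' ⊆ X then (X \ X').biUnion fun a => τ.biUnion (L.introduce X a)
  else (X' \ X).biUnion fun a => τ.biUnion (L.remove a)

/-- The table at a join node whose children have the tables `τ₁` and `τ₂`. -/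
def joinTable (L : LocalAlg V) (τ₁ τ₂ : Finset L.Row) : Finset L.Row :=
  τ₁.biUnion fun u₁ => τ₂.biUnion fun u₂ => L.join u₁ u₂

/-- Only rows that contain the credulous argument `c` as soon as `c` is in the bag are kept. -/
def credulous (L : LocalAlg V) (c : V) : LocalAlg V :=
  { L with
    introduce := fun X a u => (L.introduce X a u).filter fun v => L.ext v ∩ {c} = X ∩ {c} }

/-- Joining sets of counter-witnesses, `𝒞₁ ⋈ 𝒞₂`. -/
def joinCounter (L : LocalAlg V) (C₁ C₂ : Finset (L.Row × Bool)) : Finset (L.Row × Bool) :=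
  C₁.biUnion fun x => C₂.biUnion fun y => (L.join x.1 y.1).image fun w => (w, x.2 || y.2)

/-- The counter-witnesses after introducing `a`, where `u` is the witness before and `u'` the
witness after the introduction. They extend the earlier counter-witnesses and the witness `u`
itself. Only those are kept whose `key` contains that of the witness, and the flag records
whether the inclusion has ever been strict. -/
def introduceCounter (L : LocalAlg V) (key : L.Row → Finset V) (X : Finset V) (a : V)
    (u u' : L.Row) (C : Finset (L.Row × Bool)) : Finset (L.Row × Bool) :=
  (insert (u, false) C).biUnion fun x =>
    ((L.introduce X a x.1).filter fun v => key u' ⊆ key v).image fun v =>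
      (v, x.2 || decide (key u' ⊂ key v))

/-- The local algorithm that subset-maximizes `key` over the solutions of `L`. A row `(u, C)`
consists of a witness `u` (a row of `L`) and the set `C` of its counter-witnesses, which are rows
of `L` with a flag. A row is accepted at the root if no counter-witness is flagged. -/
def maximize (L : LocalAlg V) (key : L.Row → Finset V) : LocalAlg V where
  Row := L.Row × Finset (L.Row × Bool)
  dec := inferInstance
  ext u := L.ext u.1
  leafRow := (L.leafRow, ∅)
  introduce X a u :=
    (L.introduce X a u.1).image fun u' => (u', L.introduceCounter key X a u.1 u' u.2)
  remove a u :=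
    (L.remove a u.1).image fun u' =>
      (u', u.2.biUnion fun x => (L.remove a x.1).image fun v => (v, x.2))
  join u₁ u₂ :=
    (L.join u₁.1 u₂.1).image fun w =>
      (w, L.joinCounter u₁.2 u₂.2 ∪ L.joinCounter u₁.2 {(u₂.1, false)} ∪
        L.joinCounter {(u₁.1, false)} u₂.2)
  accept u := L.accept u.1 && decide (∀ x ∈ u.2, x.2 = false)

end LocalAlg

/-! ### The local algorithms for the six semantics -/

/-- `I`: extension part, `O`: arguments attacking the extension, `D`: arguments defeated by the
extension. -/
@[ext] structure AdmRow (V : Type u) where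
  (I O D : Finset V)
  deriving DecidableEq

/-- `I`: extension part, `D`: arguments defeated by the extension. -/
@[ext] structure StabRow (V : Type u) where
  (I D : Finset V)
  deriving DecidableEq

/-- `I`: extension part, `DC`: arguments guessed to be defeated, `D`: those already defeated,
`OC`: arguments guessed to be unrelated, `O`: those already proven to be unrelated. -/
@[ext] structure CompRow (V : Type u) where
  (I D DC O OC : Finset V)
  deriving DecidableEq

/-- `I`: extension part, `A`: arguments attacked by the extension, `AC`: arguments guessed to be
attacked by the extension. -/
@[ext] structure StagRow (V : Type u) where
  (I A AC : Finset V)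
  deriving DecidableEq

/-- The components `I`, `O`, `D` of `AdmRow` and the component `AC` of `StagRow`. -/
@[ext] structure SemiRow (V : Type u) where
  (I O D AC : Finset V)
  deriving DecidableEq

namespace AF

variable {V : Type u} [DecidableEq V]

/-- Admissible sets, before the choice of a credulous argument. -/
def admBase (F : AF V) : LocalAlg V where
  Row := AdmRow V
  dec := inferInstance
  ext u := u.I
  leafRow := ⟨∅, ∅, ∅⟩
  introduce X a u :=
    (({u.I, insert a u.I} : Finset (Finset V)).filter fun J =>
        attackersIn (F.bagAttacks X) J J = ∅).image fun J =>
      ⟨J, u.O ∪ attackersIn (F.bagAttacks X) X J, u.D ∪ attackedIn (F.bagAttacks X) X J⟩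
  remove a u := if a ∉ u.O \ u.D then {⟨u.I.erase a, u.O.erase a, u.D.erase a⟩} else ∅
  join u₁ u₂ := if u₁.I = u₂.I then {⟨u₁.I, u₁.O ∪ u₂.O, u₁.D ∪ u₂.D⟩} else ∅
  accept _ := true

/-- Stable extensions, before the choice of a credulous argument. -/
def stabBase (F : AF V) : LocalAlg V where
  Row := StabRow V
  dec := inferInstance
  ext u := u.I
  leafRow := ⟨∅, ∅⟩
  introduce X a u :=
    (({u.I, insert a u.I} : Finset (Finset V)).filter fun J =>
        attackersIn (F.bagAttacks X) J J = ∅).image fun J =>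
      ⟨J, u.D ∪ attackedIn (F.bagAttacks X) X J⟩
  remove a u := if a ∈ u.I ∪ u.D then {⟨u.I.erase a, u.D.erase a⟩} else ∅
  join u₁ u₂ := if u₁.I = u₂.I then {⟨u₁.I, u₁.D ∪ u₂.D⟩} else ∅
  accept _ := true

/-- Complete extensions, before the choice of a credulous argument. -/
def compBase (F : AF V) : LocalAlg V where
  Row := CompRow V
  dec := inferInstance
  ext u := u.I
  leafRow := ⟨∅, ∅, ∅, ∅, ∅⟩
  introduce X a u :=
    ((({u.I, insert a u.I} : Finset (Finset V)) ×ˢ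
        (({u.DC, insert a u.DC} : Finset (Finset V)) ×ˢ
          ({u.OC, insert a u.OC} : Finset (Finset V)))).filter fun (J, D, O) =>
        J ∩ D = ∅ ∧ J ∩ O = ∅ ∧ D ∩ O = ∅ ∧
        attackersIn (F.bagAttacks X) J J = ∅ ∧ attackersIn (F.bagAttacks X) J O = ∅ ∧
        attackersIn (F.bagAttacks X) O J = ∅).image fun (J, D, O) =>
      ⟨J, u.D ∪ attackedIn (F.bagAttacks X) D J, D, u.O ∪ attackedIn (F.bagAttacks X) O O, O⟩
  remove a u :=
    if a ∈ u.I ∪ u.D ∪ u.O then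
      {⟨u.I.erase a, u.D.erase a, u.DC.erase a, u.O.erase a, u.OC.erase a⟩}
    else ∅
  join u₁ u₂ :=
    if u₁.I = u₂.I ∧ u₁.DC = u₂.DC ∧ u₁.OC = u₂.OC then
      {⟨u₁.I, u₁.D ∪ u₂.D, u₁.DC, u₁.O ∪ u₂.O, u₁.OC⟩}
    else ∅
  accept _ := true

/-- The pairs `(J, AC')` that may extend `(I, AC)` when `a` is introduced, giving the bag `X`. -/
def guess (F : AF V) (X : Finset V) (a : V) (I AC : Finset V) : Finset (Finset V × Finset V) :=
  (({I, insert a I} : Finset (Finset V)) ×ˢ ({AC, insert a AC} : Finset (Finset V))).filter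
    fun (J, AC') => J ∩ AC' = ∅ ∧ attackersIn (F.bagAttacks X) J J = ∅ ∧
      attackedIn (F.bagAttacks X) X J ⊆ AC'

/-- Conflict-free sets together with the set of arguments that they attack. -/
def stagBase (F : AF V) : LocalAlg V where
  Row := StagRow V
  dec := inferInstance
  ext u := u.I
  leafRow := ⟨∅, ∅, ∅⟩
  introduce X a u := (F.guess X a u.I u.AC).image fun (J, AC) =>
    ⟨J, u.A ∪ attackedIn (F.bagAttacks X) X J, AC⟩
  remove a u := if a ∉ u.AC \ u.A then {⟨u.I.erase a, u.A.erase a, u.AC.erase a⟩} else ∅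
  join u₁ u₂ :=
    if u₁.I = u₂.I ∧ u₁.AC = u₂.AC then {⟨u₁.I, u₁.A ∪ u₂.A, u₁.AC⟩} else ∅
  accept _ := true

/-- Admissible sets together with the set of arguments that they attack. -/
def semiBase (F : AF V) : LocalAlg V where
  Row := SemiRow V
  dec := inferInstance
  ext u := u.I
  leafRow := ⟨∅, ∅, ∅, ∅⟩
  introduce X a u := (F.guess X a u.I u.AC).image fun (J, AC) =>
    ⟨J, u.O ∪ attackersIn (F.bagAttacks X) X J, u.D ∪ attackedIn (F.bagAttacks X) X J, AC⟩
  remove a u :=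
    if a ∉ u.O \ u.D ∧ a ∉ u.AC \ u.D then
      {⟨u.I.erase a, u.O.erase a, u.D.erase a, u.AC.erase a⟩}
    else ∅
  join u₁ u₂ :=
    if u₁.I = u₂.I ∧ u₁.AC = u₂.AC then {⟨u₁.I, u₁.O ∪ u₂.O, u₁.D ∪ u₂.D, u₁.AC⟩} else ∅
  accept _ := true

/-- The local algorithms ADM, COMP, PREF, STAG, SEMI and STAB with credulous argument `c`. The
three that involve maximization maximize the extension (PREF) or its range (STAG, SEMI). -/
def localAlg (F : AF V) (c : V) : Semantics → LocalAlg V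
  | .admissible => F.admBase.credulous c
  | .complete => F.compBase.credulous c
  | .preferred => (F.admBase.maximize fun u : AdmRow V => u.I).credulous c
  | .stage => (F.stagBase.maximize fun u : StagRow V => u.I ∪ u.AC).credulous c
  | .semistable => (F.semiBase.maximize fun u : SemiRow V => u.I ∪ u.AC).credulous c
  | .stable => F.stabBase.credulous c

end AF

/-! ### The three passes -/

namespace LocalAlg

variable {V : Type u} [DecidableEq V]

/-- First pass: the tree decomposition with the table `τ(t)` added at each node, bottom up. -/
def credPass (L : LocalAlg V) : RTree (Finset V) → RTree (Finset V × Finset L.Row)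
  | .leaf X => .leaf (X, {L.leafRow})
  | .one X t =>
      let T := L.credPass t
      .one (X, L.unaryTable X T.root.1 T.root.2) T
  | .two X t₁ t₂ =>
      let T₁ := L.credPass t₁
      let T₂ := L.credPass t₂
      .two (X, L.joinTable T₁.root.2 T₂.root.2) T₁ T₂

/-- The origins of a set `σ` of rows at a node with bag `X` whose only child has bag `X'` and
table `τ`. -/
def origins₁ (L : LocalAlg V) (X X' : Finset V) (τ σ : Finset L.Row) : Finset L.Row :=
  σ.biUnion fun u => τ.filter fun s => u ∈ L.unaryTable X X' {s}

/-- The origins of a set `σ` of rows at a join node whose children have the tables `τ₁`, `τ₂`. -/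
def origins₂ (L : LocalAlg V) (τ₁ τ₂ σ : Finset L.Row) : Finset (L.Row × L.Row) :=
  σ.biUnion fun u => (τ₁ ×ˢ τ₂).filter fun s => u ∈ L.joinTable {s.1} {s.2}

/-- Labels after the second pass: the bag `χ(t)` and the tables `τ(t)` and `ν(t)`. -/
structure PrunedLabel (L : LocalAlg V) where
  bag : Finset V
  τ : Finset L.Row
  ν : Finset L.Row

/-- Second pass, top down, started with the table `ν` for the root: at a child those rows are
kept that are part of an origin of a kept row of the parent. -/
def pruneFrom (L : LocalAlg V) :
    RTree (Finset V × Finset L.Row) → Finset L.Row → RTree L.PrunedLabel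
  | .leaf x, ν => .leaf ⟨x.1, x.2, ν⟩
  | .one x t, ν => .one ⟨x.1, x.2, ν⟩ (L.pruneFrom t (L.origins₁ x.1 t.root.1 t.root.2 ν))
  | .two x t₁ t₂, ν =>
      .two ⟨x.1, x.2, ν⟩
        (L.pruneFrom t₁ ((L.origins₂ t₁.root.2 t₂.root.2 ν).image Prod.fst))
        (L.pruneFrom t₂ ((L.origins₂ t₁.root.2 t₂.root.2 ν).image Prod.snd))

/-- Second pass: the accepted rows are kept at the root, and the others are pruned accordingly. -/
def prunePass (L : LocalAlg V) (T : RTree (Finset V × Finset L.Row)) : RTree L.PrunedLabel :=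
  L.pruneFrom T (T.root.2.filter fun u => L.accept u)

/-- The equivalence classes of the rows of `ν` that agree on the projection of their extension
part to `P`. -/
def buckets (L : LocalAlg V) (P : Finset V) (ν : Finset L.Row) : Finset (Finset L.Row) :=
  ν.image fun u => ν.filter fun v => L.ext v ∩ P = L.ext u ∩ P

/-- The nonempty subsets of the buckets. -/
def subBuckets (L : LocalAlg V) (P : Finset V) (ν : Finset L.Row) : Finset (Finset L.Row) :=
  (L.buckets P ν).biUnion fun B => B.powerset.erase ∅

/-- The stored intersection projected count of `σ` in the table `π`. -/
def sipc (L : LocalAlg V) (π : Finset (Finset L.Row × ℕ)) (σ : Finset L.Row) : ℕ :=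
  ∑ x ∈ π.filter fun x => x.1 = σ, x.2

/-- The projected count of a set of rows with the set `Os` of origins, where `stored O` is the
stored intersection projected count of `O ⊆ Os`. -/
def pc {α : Type u} [DecidableEq α] (Os : Finset α) (stored : Finset α → ℕ) : ℤ :=
  ∑ O ∈ Os.powerset.erase ∅, (-1) ^ (O.card - 1) * (stored O : ℤ)

/-- The intersection projected count at an inner node, where `pcs` gives the projected counts at
this node:
`ipc σ = |pcs σ + ∑_{∅ ⊊ φ ⊊ σ} (-1) ^ |φ| * ipc φ|`. -/
def ipc {α : Type u} [DecidableEq α] (pcs : Finset α → ℤ) (σ : Finset α) : ℕ :=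
  (pcs σ + ∑ φ ∈ (σ.ssubsets.erase ∅).attach, (-1) ^ φ.1.card * (ipc pcs φ.1 : ℤ)).natAbs
termination_by σ.card
decreasing_by
  exact Finset.card_lt_card (Finset.mem_ssubsets.1 (Finset.mem_of_mem_erase φ.2))

/-- Third pass, bottom up: at each node the table `π(t)` of the pairs `(σ, ipc σ)` for all
nonempty subsets `σ` of the buckets of `ν(t)`. -/
def projPass (L : LocalAlg V) (P : Finset V) :
    RTree L.PrunedLabel → RTree (Finset V × Finset (Finset L.Row × ℕ))
  | .leaf x => .leaf (x.bag, (L.subBuckets P x.ν).image fun σ => (σ, 1))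
  | .one x t =>
      let T := L.projPass P t
      let pcs : Finset L.Row → ℤ := fun σ =>
        pc (L.origins₁ x.bag t.root.bag t.root.τ σ) fun O => L.sipc T.root.2 O
      .one (x.bag, (L.subBuckets P x.ν).image fun σ => (σ, ipc pcs σ)) T
  | .two x t₁ t₂ =>
      let T₁ := L.projPass P t₁
      let T₂ := L.projPass P t₂
      let pcs : Finset L.Row → ℤ := fun σ =>
        pc (L.origins₂ t₁.root.τ t₂.root.τ σ) fun O =>
          L.sipc T₁.root.2 (O.image Prod.fst) * L.sipc T₂.root.2 (O.image Prod.snd)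
      .two (x.bag, (L.subBuckets P x.ν).image fun σ => (σ, ipc pcs σ)) T₁ T₂

/-- The three passes one after the other; the result is the count stored at the root for the
pruned root table. -/
def mdpa (L : LocalAlg V) (P : Finset V) (T : RTree (Finset V)) : ℕ :=
  let Tpruned := L.prunePass (L.credPass T)
  L.sipc (L.projPass P Tpruned).root.2 Tpruned.root.ν

end LocalAlg

/-! A derivation picks one row at each node, each arising from the rows picked at the children; the
extension parts of its rows add up to a set `S` (`Derives`). The theorem rests on three facts about
derivations.

Colourings. Apart from maximization, each semantics asks for a family of vertex sets subject to
local constraints: on single vertices, on single attacks, and a goal for each vertex that depends on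
which sets attack it and which it attacks. When a vertex is removed from the bag, all attacks at it
lie in the part of the tree already processed, so the removal test can decide its goal for good.
Hence the derivations of a base algorithm correspond to the valid families
(`Implements.derives_iff`). Over the whole graph these describe exactly the sets required by the
base semantics, together with their attacked sets where ranges are compared.

Maximization. Above the leaves, the counter-witnesses of a witness with accumulated key `K` are
exactly the rows derivable with a key `K' ⊇ K`, flagged when the inclusion is strict (`CounterSet`).
This survives each step because two parts of the decomposition overlap only in a bag on which the
pieces of one key agree, so that inclusion and strictness can be decided piece by piece
(`union_subset_union_iff`, `union_ssubset_union_iff`). At the root, absence of flags means that `K`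
is maximal.

Counting. Let `projSets` of a row be the set of all `S ∩ P` derived with it. The number stored for a
set `σ` of rows is the size of the intersection of their `projSets` (`sipc_projPass`), and `pc` is
the size of the union. The projected sets below the origins of `σ` are in bijection with those of
`σ`, since the part below can be recovered by intersecting with the vertices of the subtree.
Inclusion-exclusion is used twice: it turns the intersections stored at the children into the size
of a union, and then isolates the intersection over all of `σ`. Rows from different buckets have no
projected set in common, so reading 0 for a missing entry is correct.

The root bag is empty, so all accepted rows coincide, and the count stored for that single row is
the number of sets `S ∩ P`. -/

section

open LocalAlg

/-! ### Nice tree decompositions in inductive form. -/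

namespace RTree

variable {V : Type u} [DecidableEq V]

/-- The union of all bags. -/
def verts : RTree (Finset V) → Finset V
  | leaf X => X
  | one X t => X ∪ t.verts
  | two X t₁ t₂ => X ∪ (t₁.verts ∪ t₂.verts)

theorem root_one {α : Type u} (x : α) (t : RTree α) : (one x t).root = x := rfl

theorem root_two {α : Type u} (x : α) (t₁ t₂ : RTree α) : (two x t₁ t₂).root = x := rfl

/-- The pairs in `R` that lie inside some bag. -/
def edges (R : Finset (V × V)) : RTree (Finset V) → Finset (V × V)
  | leaf X => R ∩ X ×ˢ X
  | one X t => R ∩ X ×ˢ X ∪ t.edges R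
  | two X t₁ t₂ => R ∩ X ×ˢ X ∪ (t₁.edges R ∪ t₂.edges R)

theorem mem_verts_iff (T : RTree (Finset V)) (v : V) :
    v ∈ T.verts ↔ ∃ p X, T.get? p = some X ∧ v ∈ X := by
  induction T with
  | leaf X =>
    constructor
    · intro h; exact ⟨[], X, rfl, h⟩
    · rintro ⟨p, Y, h, hv⟩
      cases p <;> simp_all [get?, verts]
  | one X t ih =>
    simp only [verts, Finset.mem_union, ih]
    constructor
    · rintro (h | ⟨p, Y, h, hv⟩)
      · exact ⟨[], X, rfl, h⟩
      · exact ⟨false :: p, Y, h, hv⟩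
    · rintro ⟨p, Y, h, hv⟩
      rcases p with _ | ⟨_ | _, p⟩
      · simp_all [get?]
      · exact Or.inr ⟨p, Y, h, hv⟩
      · simp [get?] at h
  | two X t₁ t₂ ih₁ ih₂ =>
    simp only [verts, Finset.mem_union, ih₁, ih₂]
    constructor
    · rintro (h | ⟨p, Y, h, hv⟩ | ⟨p, Y, h, hv⟩)
      · exact ⟨[], X, rfl, h⟩
      · exact ⟨false :: p, Y, h, hv⟩
      · exact ⟨true :: p, Y, h, hv⟩
    · rintro ⟨p, Y, h, hv⟩
      rcases p with _ | ⟨_ | _, p⟩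
      · simp_all [get?]
      · exact Or.inr (Or.inl ⟨p, Y, h, hv⟩)
      · exact Or.inr (Or.inr ⟨p, Y, h, hv⟩)

theorem mem_edges_of_get? {R : Finset (V × V)} {e : V × V} (he : e ∈ R) (T : RTree (Finset V)) :
    ∀ p X, T.get? p = some X → e.1 ∈ X → e.2 ∈ X → e ∈ T.edges R := by
  induction T with
  | leaf X =>
    intro p Y h h1 h2
    cases p <;> simp_all [get?, edges, Finset.mem_product]
  | one X t ih =>
    intro p Y h h1 h2
    rcases p with _ | ⟨_ | _, p⟩
    · simp_all [get?, edges, Finset.mem_product]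
    · exact Finset.mem_union_right _ (ih p Y h h1 h2)
    · simp [get?] at h
  | two X t₁ t₂ ih₁ ih₂ =>
    intro p Y h h1 h2
    rcases p with _ | ⟨_ | _, p⟩
    · simp_all [get?, edges, Finset.mem_product]
    · exact Finset.mem_union_right _ (Finset.mem_union_left _ (ih₁ p Y h h1 h2))
    · exact Finset.mem_union_right _ (Finset.mem_union_right _ (ih₂ p Y h h1 h2))

theorem get?_nil {α : Type u} (T : RTree α) : T.get? [] = some T.root := by
  cases T <;> rfl

theorem root_subset_verts (T : RTree (Finset V)) : T.root ⊆ T.verts := by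
  cases T <;> simp [root, verts]

theorem edges_subset (R : Finset (V × V)) (T : RTree (Finset V)) : T.edges R ⊆ R := by
  induction T with
  | leaf X => exact Finset.inter_subset_left
  | one X t ih => exact Finset.union_subset Finset.inter_subset_left ih
  | two X t₁ t₂ ih₁ ih₂ =>
    exact Finset.union_subset Finset.inter_subset_left (Finset.union_subset ih₁ ih₂)

theorem mem_verts_of_mem_edges {R : Finset (V × V)} {T : RTree (Finset V)} {x y : V}
    (h : (x, y) ∈ T.edges R) : x ∈ T.verts ∧ y ∈ T.verts := by
  induction T with
  | leaf X => simp_all [edges, verts, Finset.mem_product]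
  | one X t ih => simp only [edges, verts, Finset.mem_union, Finset.mem_inter,
      Finset.mem_product] at *; tauto
  | two X t₁ t₂ ih₁ ih₂ => simp only [edges, verts, Finset.mem_union, Finset.mem_inter,
      Finset.mem_product] at *; tauto

theorem mem_edges_of_mem_root {R : Finset (V × V)} {T : RTree (Finset V)} {x y : V}
    (h : (x, y) ∈ R) (hx : x ∈ T.root) (hy : y ∈ T.root) : (x, y) ∈ T.edges R :=
  mem_edges_of_get? h T [] _ T.get?_nil hx hy

/-- The connectedness condition of tree decompositions. -/
def Connected (T : RTree (Finset V)) : Prop :=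
  ∀ r s t X Y Z, T.get? r = some X → T.get? s = some Y → T.get? t = some Z →
    OnPath r s t → X ∩ Z ⊆ Y

theorem OnPath.cons {r s t : List Bool} (b : Bool) (h : OnPath r s t) :
    OnPath (b :: r) (b :: s) (b :: t) := by
  refine ⟨by simpa using h.1, fun p hr ht => ?_⟩
  cases p with
  | nil => exact List.nil_prefix
  | cons c p =>
    rw [List.cons_prefix_cons] at hr ht ⊢
    exact ⟨hr.1, h.2 p hr.2 ht.2⟩

/-- Applied to a path from the root down, connectedness forbids a vertex of the subtree to skip the
root of that subtree and reappear above it. -/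
theorem Connected.of_one {X : Finset V} {t : RTree (Finset V)} (h : (one X t).Connected) :
    t.Connected ∧ X ∩ t.verts ⊆ t.root := by
  refine ⟨fun r s q A B C hr hs hq ho =>
    h (false :: r) (false :: s) (false :: q) A B C hr hs hq (ho.cons false), fun v hv => ?_⟩
  obtain ⟨hX, hv⟩ := Finset.mem_inter.1 hv
  obtain ⟨p, Y, hp, hY⟩ := (mem_verts_iff _ _).1 hv
  -- Every path from the root to a node of the subtree passes through the child `[false]`.
  refine h [] [false] (false :: p) X t.root Y rfl (get?_nil t) hp ⟨?_, ?_⟩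
    (Finset.mem_inter.2 ⟨hX, hY⟩)
  · exact Or.inr (by simp)
  · intro q hq _
    rw [List.prefix_nil] at hq
    subst hq
    exact List.nil_prefix

theorem Connected.of_two {X : Finset V} {t₁ t₂ : RTree (Finset V)}
    (h : (two X t₁ t₂).Connected) :
    t₁.Connected ∧ t₂.Connected ∧ t₁.verts ∩ t₂.verts ⊆ X := by
  refine ⟨fun r s q A B C hr hs hq ho =>
    h (false :: r) (false :: s) (false :: q) A B C hr hs hq (ho.cons false),
    fun r s q A B C hr hs hq ho =>
      h (true :: r) (true :: s) (true :: q) A B C hr hs hq (ho.cons true), fun v hv => ?_⟩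
  obtain ⟨h1, h2⟩ := Finset.mem_inter.1 hv
  obtain ⟨p, Y, hp, hY⟩ := (mem_verts_iff _ _).1 h1
  obtain ⟨q, Z, hq, hZ⟩ := (mem_verts_iff _ _).1 h2
  -- Addresses that start with different booleans have only the root as a common ancestor, so the
  -- root lies on the path between them.
  refine h (false :: p) [] (true :: q) Y X Z hp rfl hq ⟨Or.inl List.nil_prefix, ?_⟩
    (Finset.mem_inter.2 ⟨hY, hZ⟩)
  intro s hs1 hs2
  cases s with
  | nil => exact List.nil_prefix
  | cons b s =>
    rw [List.cons_prefix_cons] at hs1 hs2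
    exact absurd (hs1.1.symm.trans hs2.1) (by decide)

/-- Nice tree decompositions of parts of the graph with edge set `R`, in inductive form. -/
inductive NiceDecomp (R : Finset (V × V)) : RTree (Finset V) → Prop
  | leaf : NiceDecomp R (leaf ∅)
  | introduce {t : RTree (Finset V)} {a : V} : NiceDecomp R t → a ∉ t.verts →
      NiceDecomp R (one (insert a t.root) t)
  | remove {t : RTree (Finset V)} {a : V} : NiceDecomp R t → a ∈ t.root →
      (∀ x y, (x, y) ∈ R → x = a ∨ y = a → (x, y) ∈ t.edges R) →
      NiceDecomp R (one (t.root.erase a) t)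
  | join {t₁ t₂ : RTree (Finset V)} : NiceDecomp R t₁ → NiceDecomp R t₂ → t₂.root = t₁.root →
      t₁.root ≠ ∅ → t₁.verts ∩ t₂.verts ⊆ t₁.root → NiceDecomp R (two t₁.root t₁ t₂)

/-- The induction carries the condition that all attacks at a vertex which has left the bag are
covered by the tree. It passes to the children: a vertex forgotten in a child occurs neither in the
bag above nor in the other branch, so the bag covering such an attack must lie in that child. For a
removed vertex it yields the edge condition of `NiceDecomp.remove`. -/
theorem NiceNodes.niceDecomp {R : Finset (V × V)} {T : RTree (Finset V)} (hn : T.NiceNodes)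
    (hc : T.Connected) (he : ∀ x y, (x, y) ∈ R →
      (x ∈ T.verts ∧ x ∉ T.root) ∨ (y ∈ T.verts ∧ y ∉ T.root) → (x, y) ∈ T.edges R) :
    NiceDecomp R T := by
  induction T with
  | leaf X =>
    have h : X = ∅ := hn
    subst h
    exact .leaf
  | one X t ih =>
    obtain ⟨hX, hn⟩ := hn
    obtain ⟨hc, hi⟩ := hc.of_one
    have hi' : ∀ x ∈ t.verts, x ∉ t.root → x ∉ X := fun x h1 h2 h3 =>
      h2 (hi (Finset.mem_inter.2 ⟨h3, h1⟩))
    have hedge : ∀ x y, (x, y) ∈ R → (x ∈ t.verts ∧ x ∉ X) ∨ (y ∈ t.verts ∧ y ∉ X) →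
        (x, y) ∈ t.edges R := by
      intro x y hxy h
      have := he x y hxy (by simp only [verts, root, Finset.mem_union]; tauto)
      simp only [edges, Finset.mem_union, Finset.mem_inter, Finset.mem_product] at this
      tauto
    have ih := ih hn hc fun x y hxy h => hedge x y hxy (by
      rcases h with h | h
      · exact Or.inl ⟨h.1, hi' x h.1 h.2⟩
      · exact Or.inr ⟨h.1, hi' y h.1 h.2⟩)
    rcases hX with ⟨hs, hcard⟩ | ⟨hs, hcard⟩
    · obtain ⟨a, ha, rfl⟩ : ∃ a, a ∉ t.root ∧ insert a t.root = X := by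
        obtain ⟨a, ha, h⟩ := (Finset.covBy_iff_card_sdiff_eq_one.2 ⟨hs, by
          rw [Finset.card_sdiff_of_subset hs]; omega⟩ : t.root ⋖ X).exists_finset_insert
        exact ⟨a, ha, h⟩
      exact .introduce ih fun h => ha (hi (Finset.mem_inter.2 ⟨Finset.mem_insert_self _ _, h⟩))
    · obtain ⟨a, ha, h⟩ := (Finset.covBy_iff_card_sdiff_eq_one.2 ⟨hs, by
          rw [Finset.card_sdiff_of_subset hs]; omega⟩ : X ⋖ t.root).exists_finset_insert
      have hX : X = t.root.erase a := by rw [← h, Finset.erase_insert ha]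
      have hat : a ∈ t.root := h ▸ Finset.mem_insert_self _ _
      rw [hX]
      refine .remove ih hat fun x y hxy hxa => hedge x y hxy ?_
      rcases hxa with rfl | rfl
      · exact Or.inl ⟨root_subset_verts _ hat, ha⟩
      · exact Or.inr ⟨root_subset_verts _ hat, ha⟩
  | two X t₁ t₂ ih₁ ih₂ =>
    obtain ⟨h1, h2, hX, hn1, hn2⟩ := hn
    obtain ⟨hc1, hc2, hi⟩ := hc.of_two
    have hi' : ∀ x, x ∈ t₁.verts → x ∈ t₂.verts → x ∈ X := fun x h1 h2 =>
      hi (Finset.mem_inter.2 ⟨h1, h2⟩)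
    have hsplit : ∀ x y, (x, y) ∈ (two X t₁ t₂).edges R →
        (x ∈ X ∧ y ∈ X) ∨ ((x, y) ∈ t₁.edges R ∧ x ∈ t₁.verts ∧ y ∈ t₁.verts) ∨
          ((x, y) ∈ t₂.edges R ∧ x ∈ t₂.verts ∧ y ∈ t₂.verts) := by
      intro x y h
      simp only [edges, Finset.mem_union, Finset.mem_inter, Finset.mem_product] at h
      rcases h with h | h | h
      · exact Or.inl h.2
      · exact Or.inr (Or.inl ⟨h, mem_verts_of_mem_edges h⟩)
      · exact Or.inr (Or.inr ⟨h, mem_verts_of_mem_edges h⟩)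
    have he' := fun x y hxy h => hsplit x y (he x y hxy h)
    simp only [verts, root, Finset.mem_union] at he'
    have ih₁ := ih₁ hn1 hc1 fun x y hxy h => by
      have := he' x y hxy (by rw [← h1] at h; tauto)
      rw [← h1] at h
      have := hi' x
      have := hi' y
      tauto
    have ih₂ := ih₂ hn2 hc2 fun x y hxy h => by
      have := he' x y hxy (by rw [← h2] at h; tauto)
      rw [← h2] at h
      have := hi' x
      have := hi' y
      tauto
    subst h1
    exact .join ih₁ ih₂ h2.symm hX hi

theorem IsTreeDecomposition.verts_eq [Fintype V] {G : SimpleGraph V} {T : RTree (Finset V)}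
    (h : T.IsTreeDecomposition G) : T.verts = Finset.univ :=
  Finset.eq_univ_of_forall fun v => (mem_verts_iff _ _).2 (h.vertex_mem v)

theorem IsTreeDecomposition.edges_eq {F : AF V} {T : RTree (Finset V)}
    (h : T.IsTreeDecomposition F.underlyingGraph) : T.edges F.R = F.R := by
  refine (edges_subset _ _).antisymm fun e he => ?_
  obtain ⟨x, y⟩ := e
  -- A self-attack is no edge of the underlying graph; any bag containing the vertex covers it.
  by_cases hxy : x = y
  · obtain ⟨p, X, hp, hx⟩ := h.vertex_mem x
    exact mem_edges_of_get? he T p X hp hx (hxy ▸ hx)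
  · obtain ⟨p, X, hp, hx, hy⟩ := h.edge_mem x y
      ((SimpleGraph.fromRel_adj _ _ _).2 ⟨hxy, Or.inl he⟩)
    exact mem_edges_of_get? he T p X hp hx hy

theorem IsTreeDecomposition.niceDecomp {F : AF V} {T : RTree (Finset V)}
    (h : T.IsTreeDecomposition F.underlyingGraph) (hn : T.NiceNodes) : NiceDecomp F.R T :=
  hn.niceDecomp h.connected fun x y hxy _ => by rwa [h.edges_eq]

end RTree

/-! ### Inclusion-exclusion for unions and intersections of finite sets. -/

namespace LocalAlg

section Counting

variable {α β : Type u} [DecidableEq α] [DecidableEq β] [Fintype β]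

/-- The intersection of the sets `f u` for `u ∈ σ`. -/
def interOf (f : α → Finset β) (σ : Finset α) : Finset β :=
  Finset.univ.filter fun x => ∀ u ∈ σ, x ∈ f u

theorem card_biUnion_eq_sum (f : α → Finset β) (s : Finset α) :
    ((s.biUnion f).card : ℤ) =
      ∑ t ∈ s.powerset.erase ∅, (-1) ^ (t.card - 1) * ((interOf f t).card : ℤ) := by
  rw [Finset.inclusion_exclusion_card_biUnion]
  have hs : s.powerset.erase ∅ = s.powerset.filter (·.Nonempty) := by
    ext t
    simp [Finset.nonempty_iff_ne_empty, and_comm]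
  rw [hs, ← Finset.sum_coe_sort (s.powerset.filter (·.Nonempty))]
  refine Finset.sum_congr rfl fun t _ => ?_
  have ht := (Finset.mem_filter.1 t.2).2
  -- The two exponents `card + 1` and `card - 1` differ by 2, so the signs agree; the truncated
  -- subtraction is harmless because `t` is nonempty.
  have hc : t.1.card + 1 = t.1.card - 1 + 2 := by
    have := ht.card_pos
    omega
  have hi : t.1.inf' ht f = interOf f t.1 := by
    ext x
    simp [interOf, Finset.mem_inf']
  rw [hc, pow_add, hi]
  norm_num

/-- By induction the recursive calls are sizes of intersections over proper subsets.
Inclusion-exclusion writes the union as the term of `σ` plus the terms of its proper subsets, and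
the latter carry the sign opposite to that in the recursion. They cancel, leaving the size of the
intersection over `σ` up to sign, which the absolute value removes. -/
theorem ipc_eq_card_interOf (f : α → Finset β) (pcs : Finset α → ℤ) (σ : Finset α)
    (hσ : σ ≠ ∅) (h : ∀ φ ⊆ σ, φ ≠ ∅ → pcs φ = ((φ.biUnion f).card : ℤ)) :
    ipc pcs σ = (interOf f σ).card := by
  induction σ using Finset.strongInduction with
  | H σ ih =>
    have hsub : ∀ φ ∈ σ.ssubsets.erase ∅,
        (-1) ^ φ.card * (ipc pcs φ : ℤ) = (-1) ^ φ.card * ((interOf f φ).card : ℤ) := by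
      intro φ hφ
      obtain ⟨h0, hφ⟩ := Finset.mem_erase.1 hφ
      have hφ := Finset.mem_ssubsets.1 hφ
      rw [ih φ hφ h0 fun ψ hψ => h ψ (hψ.trans hφ.subset)]
    rw [ipc, Finset.sum_attach (σ.ssubsets.erase ∅)
      (fun φ => (-1) ^ φ.card * (ipc pcs φ : ℤ)), Finset.sum_congr rfl hsub,
      h σ subset_rfl hσ, card_biUnion_eq_sum]
    have hsplit : σ.powerset.erase ∅ = insert σ (σ.ssubsets.erase ∅) := by
      ext t
      simp only [Finset.mem_erase, Finset.mem_powerset, Finset.mem_insert, Finset.mem_ssubsets]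
      constructor
      · rintro ⟨h0, ht⟩
        rcases ht.eq_or_ssubset with rfl | ht
        · exact Or.inl rfl
        · exact Or.inr ⟨h0, ht⟩
      · rintro (rfl | ⟨h0, ht⟩)
        · exact ⟨hσ, subset_rfl⟩
        · exact ⟨h0, ht.subset⟩
    rw [hsplit, Finset.sum_insert (by simp)]
    have hcancel : ∑ t ∈ σ.ssubsets.erase ∅, (-1) ^ (t.card - 1) * ((interOf f t).card : ℤ) =
        -∑ t ∈ σ.ssubsets.erase ∅, (-1) ^ t.card * ((interOf f t).card : ℤ) := by
      rw [← Finset.sum_neg_distrib]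
      refine Finset.sum_congr rfl fun t ht => ?_
      have := (Finset.nonempty_iff_ne_empty.2 (Finset.mem_erase.1 ht).1).card_pos
      obtain ⟨n, hn⟩ : ∃ n, t.card = n + 1 := ⟨t.card - 1, by omega⟩
      rw [hn, Nat.add_sub_cancel, pow_succ]
      ring
    rw [hcancel, neg_add_cancel_right, Int.natAbs_mul, Int.natAbs_pow]
    simp

theorem pc_eq_card_biUnion (f : α → Finset β) (s : Finset α) (stored : Finset α → ℕ)
    (h : ∀ O ⊆ s, O ≠ ∅ → stored O = (interOf f O).card) :
    pc s stored = ((s.biUnion f).card : ℤ) := by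
  rw [card_biUnion_eq_sum, pc]
  refine Finset.sum_congr rfl fun O hO => ?_
  obtain ⟨h0, hO⟩ := Finset.mem_erase.1 hO
  rw [h O (Finset.mem_powerset.1 hO) h0]

end Counting

/-! ### Stored tables and derivations of rows. -/

variable {V : Type u} [DecidableEq V]

theorem sipc_image (L : LocalAlg V) (s : Finset (Finset L.Row)) (g : Finset L.Row → ℕ)
    (σ : Finset L.Row) :
    L.sipc (s.image fun σ => (σ, g σ)) σ = if σ ∈ s then g σ else 0 := by
  have h : ((s.image fun σ => (σ, g σ)).filter fun x => x.1 = σ) =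
      if σ ∈ s then {(σ, g σ)} else ∅ := by
    ext ⟨τ, n⟩
    split_ifs with hs <;> simp only [Finset.mem_filter, Finset.mem_image, Prod.mk.injEq,
      Finset.mem_singleton, Finset.notMem_empty, iff_false]
    · constructor
      · rintro ⟨⟨ρ, _, rfl, rfl⟩, rfl⟩; exact ⟨rfl, rfl⟩
      · rintro ⟨rfl, rfl⟩; exact ⟨⟨_, hs, rfl, rfl⟩, rfl⟩
    · rintro ⟨⟨ρ, hρ, rfl, rfl⟩, rfl⟩
      exact hs hρ
  rw [sipc, h]
  split_ifs <;> simp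

theorem mem_subBuckets (L : LocalAlg V) (P : Finset V) (ν σ : Finset L.Row) :
    σ ∈ L.subBuckets P ν ↔ σ ≠ ∅ ∧ σ ⊆ ν ∧ ∀ u ∈ σ, ∀ v ∈ σ, L.ext u ∩ P = L.ext v ∩ P := by
  simp only [subBuckets, buckets, Finset.mem_biUnion, Finset.mem_image, Finset.mem_erase,
    Finset.mem_powerset]
  constructor
  · rintro ⟨_, ⟨w, hw, rfl⟩, h0, hσ⟩
    refine ⟨h0, hσ.trans (Finset.filter_subset _ _), fun u hu v hv => ?_⟩
    exact (Finset.mem_filter.1 (hσ hu)).2.trans (Finset.mem_filter.1 (hσ hv)).2.symm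
  · rintro ⟨h0, hσ, h⟩
    obtain ⟨w, hw⟩ := Finset.nonempty_iff_ne_empty.2 h0
    exact ⟨_, ⟨w, hσ hw, rfl⟩, h0, fun u hu => Finset.mem_filter.2 ⟨hσ hu, h u hu w hw⟩⟩

/-- `L.Derives f T u b`: the algorithm can produce the row `u` at the root of `T`, and `b` is the
join of the values of `f` at the rows from which `u` is produced in this way. -/
def Derives {β : Type u} [Max β] (L : LocalAlg V) (f : L.Row → β) :
    RTree (Finset V) → L.Row → β → Prop
  | .leaf _, u, b => u = L.leafRow ∧ b = f L.leafRow
  | .one X t, u, b => ∃ s b', L.Derives f t s b' ∧ u ∈ L.unaryTable X t.root {s} ∧ b = b' ⊔ f u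
  | .two _ t₁ t₂, u, b => ∃ s₁ s₂ b₁ b₂, L.Derives f t₁ s₁ b₁ ∧ L.Derives f t₂ s₂ b₂ ∧
      u ∈ L.join s₁ s₂ ∧ b = b₁ ⊔ b₂

theorem Derives.map {β γ : Type u} [Max β] [Max γ] {L : LocalAlg V} {f : L.Row → β}
    (g : β → γ) (hg : ∀ b c, g (b ⊔ c) = g b ⊔ g c) {T : RTree (Finset V)} {u : L.Row} {b : β}
    (h : L.Derives f T u b) : L.Derives (fun v => g (f v)) T u (g b) := by
  induction T generalizing u b with
  | leaf X => exact ⟨h.1, by rw [h.2]⟩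
  | one X t ih =>
    obtain ⟨s, b', hs, hu, rfl⟩ := h
    exact ⟨s, g b', ih hs, hu, hg _ _⟩
  | two X t₁ t₂ ih₁ ih₂ =>
    obtain ⟨s₁, s₂, b₁, b₂, h₁, h₂, hu, rfl⟩ := h
    exact ⟨s₁, s₂, g b₁, g b₂, ih₁ h₁, ih₂ h₂, hu, hg _ _⟩

/-- Which rows may be picked does not depend on what is recorded. A derivation that records only `g
∘ f` can therefore be replayed recording `f`, which allows passing between whole families, single
components and keys. -/
theorem Derives.of_map {β γ : Type u} [Max β] [Max γ] {L : LocalAlg V} {f : L.Row → β}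
    (g : β → γ) (hg : ∀ b c, g (b ⊔ c) = g b ⊔ g c) {T : RTree (Finset V)} {u : L.Row} {c : γ}
    (h : L.Derives (fun v => g (f v)) T u c) : ∃ b, L.Derives f T u b ∧ g b = c := by
  induction T generalizing u c with
  | leaf X => exact ⟨_, ⟨h.1, rfl⟩, h.2.symm⟩
  | one X t ih =>
    obtain ⟨s, c', hs, hu, rfl⟩ := h
    obtain ⟨b', hb, rfl⟩ := ih hs
    exact ⟨_, ⟨s, b', hb, hu, rfl⟩, hg _ _⟩
  | two X t₁ t₂ ih₁ ih₂ =>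
    obtain ⟨s₁, s₂, c₁, c₂, h₁, h₂, hu, rfl⟩ := h
    obtain ⟨b₁, hb₁, rfl⟩ := ih₁ h₁
    obtain ⟨b₂, hb₂, rfl⟩ := ih₂ h₂
    exact ⟨_, ⟨s₁, s₂, b₁, b₂, hb₁, hb₂, hu, rfl⟩, hg _ _⟩

theorem unaryTable_insert (L : LocalAlg V) {X : Finset V} {a : V} (ha : a ∉ X)
    (τ : Finset L.Row) :
    L.unaryTable (insert a X) X τ = τ.biUnion (L.introduce (insert a X) a) := by
  have h : insert a X \ X = {a} := by
    ext x
    simp only [Finset.mem_sdiff, Finset.mem_insert, Finset.mem_singleton]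
    constructor
    · tauto
    · rintro rfl; tauto
  rw [unaryTable, if_pos (Finset.subset_insert _ _), h, Finset.singleton_biUnion]

theorem unaryTable_erase (L : LocalAlg V) {X : Finset V} {a : V} (ha : a ∈ X)
    (τ : Finset L.Row) : L.unaryTable (X.erase a) X τ = τ.biUnion (L.remove a) := by
  have h : X \ X.erase a = {a} := by
    ext x
    simp only [Finset.mem_sdiff, Finset.mem_erase, Finset.mem_singleton]
    constructor
    · tauto
    · rintro rfl; tauto
  rw [unaryTable, if_neg fun hs => absurd (hs ha) (Finset.notMem_erase _ _), h,
    Finset.singleton_biUnion]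

theorem mem_unaryTable (L : LocalAlg V) (X X' : Finset V) (τ : Finset L.Row) (u : L.Row) :
    u ∈ L.unaryTable X X' τ ↔ ∃ s ∈ τ, u ∈ L.unaryTable X X' {s} := by
  unfold unaryTable
  split_ifs
  all_goals
    simp only [Finset.mem_biUnion, Finset.mem_singleton, exists_eq_left]
    constructor
    · rintro ⟨a, ha, s, hs, hu⟩; exact ⟨s, hs, a, ha, hu⟩
    · rintro ⟨s, hs, a, ha, hu⟩; exact ⟨a, ha, s, hs, hu⟩

theorem mem_joinTable (L : LocalAlg V) (τ₁ τ₂ : Finset L.Row) (u : L.Row) :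
    u ∈ L.joinTable τ₁ τ₂ ↔ ∃ s₁ ∈ τ₁, ∃ s₂ ∈ τ₂, u ∈ L.join s₁ s₂ := by
  simp [joinTable]

theorem derives_introduce {β : Type u} [Max β] {L : LocalAlg V} {f : L.Row → β}
    {t : RTree (Finset V)} {a : V} (ha : a ∉ t.root) {u : L.Row} {b : β} :
    L.Derives f (.one (insert a t.root) t) u b ↔
      ∃ s b', L.Derives f t s b' ∧ u ∈ L.introduce (insert a t.root) a s ∧ b = b' ⊔ f u := by
  simp only [Derives, L.unaryTable_insert ha, Finset.singleton_biUnion]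

theorem derives_remove {β : Type u} [Max β] {L : LocalAlg V} {f : L.Row → β}
    {t : RTree (Finset V)} {a : V} (ha : a ∈ t.root) {u : L.Row} {b : β} :
    L.Derives f (.one (t.root.erase a) t) u b ↔
      ∃ s b', L.Derives f t s b' ∧ u ∈ L.remove a s ∧ b = b' ⊔ f u := by
  simp only [Derives, L.unaryTable_erase ha, Finset.singleton_biUnion]

theorem credPass_root_fst (L : LocalAlg V) (T : RTree (Finset V)) :
    (L.credPass T).root.1 = T.root := by
  cases T <;> rfl

theorem mem_credPass_root {β : Type u} [Max β] (L : LocalAlg V) (f : L.Row → β)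
    (T : RTree (Finset V)) (u : L.Row) :
    u ∈ (L.credPass T).root.2 ↔ ∃ b, L.Derives f T u b := by
  induction T generalizing u with
  | leaf X => simp [credPass, RTree.root, Derives]
  | one X t ih =>
    change u ∈ L.unaryTable X (L.credPass t).root.1 (L.credPass t).root.2 ↔ _
    rw [mem_unaryTable, credPass_root_fst]
    constructor
    · rintro ⟨s, hs, hu⟩
      obtain ⟨b, hb⟩ := (ih s).1 hs
      exact ⟨_, s, b, hb, hu, rfl⟩
    · rintro ⟨_, s, b, hb, hu, rfl⟩
      exact ⟨s, (ih s).2 ⟨b, hb⟩, hu⟩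
  | two X t₁ t₂ ih₁ ih₂ =>
    change u ∈ L.joinTable (L.credPass t₁).root.2 (L.credPass t₂).root.2 ↔ _
    rw [mem_joinTable]
    constructor
    · rintro ⟨s₁, h₁, s₂, h₂, hu⟩
      obtain ⟨b₁, hb₁⟩ := (ih₁ s₁).1 h₁
      obtain ⟨b₂, hb₂⟩ := (ih₂ s₂).1 h₂
      exact ⟨_, s₁, s₂, b₁, b₂, hb₁, hb₂, hu, rfl⟩
    · rintro ⟨_, s₁, s₂, b₁, b₂, hb₁, hb₂, hu, rfl⟩
      exact ⟨s₁, (ih₁ s₁).2 ⟨b₁, hb₁⟩, s₂, (ih₂ s₂).2 ⟨b₂, hb₂⟩, hu⟩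

/-- The component `f` of the rows follows the bags like the extension part. -/
structure Tracks (L : LocalAlg V) (f : L.Row → Finset V) : Prop where
  leafRow : f L.leafRow = ∅
  introduce : ∀ X a u, ∀ v ∈ L.introduce X a u, f v = f u ∨ f v = insert a (f u)
  remove : ∀ a u, ∀ v ∈ L.remove a u, f v = (f u).erase a
  join : ∀ u₁ u₂, ∀ v ∈ L.join u₁ u₂, f v = f u₁ ∧ f v = f u₂

/-- An introduced vertex is new to the subtree, so the set collected below cannot contain it and the
new row alone decides about it. Removal adds nothing to the collected set. At a join the two
collected sets have the same trace on the common bag, which contains every vertex shared by the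
branches. -/
theorem Tracks.subset_and_inter {L : LocalAlg V} {f : L.Row → Finset V} (hf : L.Tracks f)
    {R : Finset (V × V)} {T : RTree (Finset V)} (hT : T.NiceDecomp R) {u : L.Row} {S : Finset V}
    (h : L.Derives f T u S) : S ⊆ T.verts ∧ f u = S ∩ T.root := by
  induction hT generalizing u S with
  | leaf =>
    obtain ⟨rfl, rfl⟩ := h
    simp [hf.leafRow]
  | @introduce t a ht ha ih =>
    obtain ⟨s, S, hs, hu, rfl⟩ :=
      (derives_introduce fun h => ha (t.root_subset_verts h)).1 h
    obtain ⟨h1, h2⟩ := ih hs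
    have h3 := t.root_subset_verts
    have h4 := hf.introduce _ _ _ _ hu
    simp only [RTree.verts, RTree.root_one]
    rcases h4 with h4 | h4 <;> rw [h4, h2, Finset.sup_eq_union] <;> constructor <;> grind
  | @remove t a ht ha _ ih =>
    obtain ⟨s, S, hs, hu, rfl⟩ := (derives_remove ha).1 h
    obtain ⟨h1, h2⟩ := ih hs
    have h3 := t.root_subset_verts
    simp only [RTree.verts, RTree.root_one]
    rw [hf.remove _ _ _ hu, h2, Finset.sup_eq_union]
    constructor <;> grind
  | @join t₁ t₂ _ _ hr _ hi ih₁ ih₂ =>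
    obtain ⟨s₁, s₂, S₁, S₂, h₁, h₂, hu, rfl⟩ := h
    obtain ⟨h11, h12⟩ := ih₁ h₁
    obtain ⟨h21, h22⟩ := ih₂ h₂
    obtain ⟨h4, h5⟩ := hf.join _ _ _ hu
    simp only [RTree.verts, RTree.root_two]
    rw [Finset.sup_eq_union]
    constructor <;> grind

end LocalAlg

/-! ### Correctness of the pruning and counting passes. -/

namespace LocalAlg

variable {V : Type u} [DecidableEq V]

theorem pruneFrom_root (L : LocalAlg V) (T : RTree (Finset V × Finset L.Row))
    (ν : Finset L.Row) : (L.pruneFrom T ν).root = ⟨T.root.1, T.root.2, ν⟩ := by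
  cases T <;> rfl

theorem mem_origins₁ (L : LocalAlg V) (X X' : Finset V) (τ σ : Finset L.Row) (s : L.Row) :
    s ∈ L.origins₁ X X' τ σ ↔ s ∈ τ ∧ ∃ u ∈ σ, u ∈ L.unaryTable X X' {s} := by
  simp only [origins₁, Finset.mem_biUnion, Finset.mem_filter]
  tauto

theorem mem_origins₂ (L : LocalAlg V) (τ₁ τ₂ σ : Finset L.Row) (s : L.Row × L.Row) :
    s ∈ L.origins₂ τ₁ τ₂ σ ↔ s.1 ∈ τ₁ ∧ s.2 ∈ τ₂ ∧ ∃ u ∈ σ, u ∈ L.join s.1 s.2 := by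
  simp only [origins₂, Finset.mem_biUnion, Finset.mem_filter, Finset.mem_product, joinTable,
    Finset.singleton_biUnion]
  tauto

/-- A vertex of `B` inside `VA` lies in the separator `X`, where it also belongs to `A`. Sets that
agree on a separator can thus be recovered from their union. -/
theorem union_inter_eq_left {A B VA VB X : Finset V} (hA : A ⊆ VA) (hB : B ⊆ VB)
    (hX : VA ∩ VB ⊆ X) (h : B ∩ X = A ∩ X) : (A ∪ B) ∩ VA = A := by
  ext x
  have h1 := @hA x
  have h2 := @hB x
  have h3 := @hX x
  have h4 := Finset.ext_iff.1 h x
  simp only [Finset.mem_inter, Finset.mem_union] at h3 h4 ⊢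
  tauto

variable [Fintype V]

open Classical in
/-- The projections to `P` of the sets that are derived together with the row `u`. -/
noncomputable def projSets (L : LocalAlg V) (P : Finset V) (T : RTree (Finset V)) (u : L.Row) :
    Finset (Finset V) :=
  Finset.univ.filter fun X => ∃ S, L.Derives L.ext T u S ∧ X = S ∩ P

theorem mem_projSets {L : LocalAlg V} {P : Finset V} {T : RTree (Finset V)} {u : L.Row}
    {X : Finset V} : X ∈ L.projSets P T u ↔ ∃ S, L.Derives L.ext T u S ∧ X = S ∩ P := by
  simp [projSets]

theorem projSets_inter {L : LocalAlg V} (hL : L.Tracks L.ext) {P : Finset V}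
    {R : Finset (V × V)} {T : RTree (Finset V)} (hT : T.NiceDecomp R) {u : L.Row}
    {X : Finset V} (h : X ∈ L.projSets P T u) :
    X ⊆ T.verts ∧ L.ext u ∩ P = X ∩ T.root := by
  obtain ⟨S, hS, rfl⟩ := mem_projSets.1 h
  obtain ⟨h1, h2⟩ := hL.subset_and_inter hT hS
  rw [h2]
  constructor <;> grind

/-- Every projected set of a row has the trace `L.ext u ∩ P` on the root bag. Rows from different
buckets therefore share no projected set, and the default value 0 for an unstored set of rows is the
size of an empty intersection. -/
theorem ite_subBuckets_eq {L : LocalAlg V} (hL : L.Tracks L.ext) {P : Finset V}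
    {R : Finset (V × V)} {T : RTree (Finset V)} (hT : T.NiceDecomp R) {ν σ : Finset L.Row}
    (hσ : σ ⊆ ν) (h0 : σ ≠ ∅) {n : ℕ}
    (h : (∀ u ∈ σ, ∀ v ∈ σ, L.ext u ∩ P = L.ext v ∩ P) →
      n = (interOf (L.projSets P T) σ).card) :
    (if σ ∈ L.subBuckets P ν then n else 0) = (interOf (L.projSets P T) σ).card := by
  split_ifs with hs
  · exact h ((mem_subBuckets L P ν σ).1 hs).2.2
  · rw [mem_subBuckets] at hs
    push Not at hs
    obtain ⟨u, hu, v, hv, huv⟩ := hs (Finset.nonempty_iff_ne_empty.2 h0) hσ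
    symm
    rw [Finset.card_eq_zero, Finset.eq_empty_iff_forall_notMem]
    intro X hX
    have hX := (Finset.mem_filter.1 hX).2
    exact huv ((projSets_inter hL hT (hX u hu)).2.trans (projSets_inter hL hT (hX v hv)).2.symm)

theorem mem_projSets_one {L : LocalAlg V} {P X : Finset V} {t : RTree (Finset V)} {u : L.Row}
    {Y : Finset V} : Y ∈ L.projSets P (.one X t) u ↔
      ∃ s, u ∈ L.unaryTable X t.root {s} ∧ ∃ Z ∈ L.projSets P t s, Y = Z ∪ L.ext u ∩ P := by
  simp only [mem_projSets, Derives]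
  constructor
  · rintro ⟨_, ⟨s, S, hS, hu, rfl⟩, rfl⟩
    exact ⟨s, hu, _, ⟨S, hS, rfl⟩, by simp [Finset.union_inter_distrib_right]⟩
  · rintro ⟨s, hu, _, ⟨S, hS, rfl⟩, rfl⟩
    exact ⟨_, ⟨s, S, hS, hu, rfl⟩, by simp [Finset.union_inter_distrib_right]⟩

theorem mem_projSets_two {L : LocalAlg V} {P X : Finset V} {t₁ t₂ : RTree (Finset V)}
    {u : L.Row} {Y : Finset V} : Y ∈ L.projSets P (.two X t₁ t₂) u ↔
      ∃ s₁ s₂, u ∈ L.join s₁ s₂ ∧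
        ∃ Z₁ ∈ L.projSets P t₁ s₁, ∃ Z₂ ∈ L.projSets P t₂ s₂, Y = Z₁ ∪ Z₂ := by
  simp only [mem_projSets, Derives]
  constructor
  · rintro ⟨_, ⟨s₁, s₂, S₁, S₂, h₁, h₂, hu, rfl⟩, rfl⟩
    exact ⟨s₁, s₂, hu, _, ⟨S₁, h₁, rfl⟩, _, ⟨S₂, h₂, rfl⟩,
      by simp [Finset.union_inter_distrib_right]⟩
  · rintro ⟨s₁, s₂, hu, _, ⟨S₁, h₁, rfl⟩, _, ⟨S₂, h₂, rfl⟩, rfl⟩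
    exact ⟨_, ⟨s₁, s₂, S₁, S₂, h₁, h₂, hu, rfl⟩, by simp [Finset.union_inter_distrib_right]⟩

theorem mem_credPass_of_mem_projSets {L : LocalAlg V} {P : Finset V} {T : RTree (Finset V)}
    {u : L.Row} {X : Finset V} (h : X ∈ L.projSets P T u) : u ∈ (L.credPass T).root.2 := by
  obtain ⟨S, hS, _⟩ := mem_projSets.1 h
  exact (L.mem_credPass_root L.ext T u).2 ⟨S, hS⟩

/-- All rows of `φ` have the same projected extension `E`, so moving from the child to this node is
the single map `Z ↦ Z ∪ E`. It is injective because `E` adds nothing inside the subtree: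
intersecting with `t.verts` gives `Z` back. This is why counting is organised by buckets. -/
theorem card_biUnion_origins₁ {L : LocalAlg V} {P X : Finset V} {t : RTree (Finset V)}
    {φ : Finset L.Row} (E : Finset V) (hE : ∀ u ∈ φ, L.ext u ∩ P = E)
    (hV : ∀ u ∈ φ, ∀ s, u ∈ L.unaryTable X t.root {s} → ∀ Z ∈ L.projSets P t s,
      Z ⊆ t.verts ∧ E ∩ t.verts ⊆ Z) :
    ((L.origins₁ X t.root (L.credPass t).root.2 φ).biUnion (L.projSets P t)).card =
      (φ.biUnion (L.projSets P (.one X t))).card := by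
  have himage : φ.biUnion (L.projSets P (.one X t)) =
      ((L.origins₁ X t.root (L.credPass t).root.2 φ).biUnion (L.projSets P t)).image
        (· ∪ E) := by
    ext Y
    simp only [Finset.mem_biUnion, Finset.mem_image, mem_projSets_one, mem_origins₁]
    constructor
    · rintro ⟨u, hu, s, hs, Z, hZ, rfl⟩
      exact ⟨Z, ⟨s, ⟨mem_credPass_of_mem_projSets hZ, u, hu, hs⟩, hZ⟩, by rw [hE u hu]⟩
    · rintro ⟨Z, ⟨s, ⟨_, u, hu, hs⟩, hZ⟩, rfl⟩
      exact ⟨u, hu, s, hs, Z, hZ, by rw [hE u hu]⟩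
  rw [himage, Finset.card_image_of_injOn]
  have hinv : ∀ Z ∈ (L.origins₁ X t.root (L.credPass t).root.2 φ).biUnion (L.projSets P t),
      (Z ∪ E) ∩ t.verts = Z := by
    intro Z hZ
    obtain ⟨s, hs, hZ⟩ := Finset.mem_biUnion.1 hZ
    obtain ⟨_, u, hu, hs⟩ := (mem_origins₁ _ _ _ _ _ _).1 hs
    obtain ⟨h1, h2⟩ := hV u hu s hs Z hZ
    grind
  intro Z hZ Z' hZ' h
  rw [← hinv Z hZ, ← hinv Z' hZ']
  exact congrArg (· ∩ t.verts) h

/-- Taking unions maps pairs of projected sets of the children onto the projected sets of the join;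
intersecting with the vertices of each branch inverts this map. -/
theorem card_biUnion_origins₂ {L : LocalAlg V} {P X : Finset V} {t₁ t₂ : RTree (Finset V)}
    {φ : Finset L.Row}
    (hV : ∀ u s₁ s₂, u ∈ L.join s₁ s₂ →
      ∀ Z₁ ∈ L.projSets P t₁ s₁, ∀ Z₂ ∈ L.projSets P t₂ s₂,
        (Z₁ ∪ Z₂) ∩ t₁.verts = Z₁ ∧ (Z₁ ∪ Z₂) ∩ t₂.verts = Z₂) :
    ((L.origins₂ (L.credPass t₁).root.2 (L.credPass t₂).root.2 φ).biUnion fun s =>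
      L.projSets P t₁ s.1 ×ˢ L.projSets P t₂ s.2).card =
      (φ.biUnion (L.projSets P (.two X t₁ t₂))).card := by
  have himage : φ.biUnion (L.projSets P (.two X t₁ t₂)) =
      ((L.origins₂ (L.credPass t₁).root.2 (L.credPass t₂).root.2 φ).biUnion fun s =>
        L.projSets P t₁ s.1 ×ˢ L.projSets P t₂ s.2).image fun Z => Z.1 ∪ Z.2 := by
    ext Y
    simp only [Finset.mem_biUnion, Finset.mem_image, mem_projSets_two, mem_origins₂,
      Finset.mem_product]
    constructor
    · rintro ⟨u, hu, s₁, s₂, hs, Z₁, hZ₁, Z₂, hZ₂, rfl⟩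
      exact ⟨(Z₁, Z₂), ⟨(s₁, s₂), ⟨mem_credPass_of_mem_projSets hZ₁,
        mem_credPass_of_mem_projSets hZ₂, u, hu, hs⟩, hZ₁, hZ₂⟩, rfl⟩
    · rintro ⟨Z, ⟨s, ⟨_, _, u, hu, hs⟩, hZ₁, hZ₂⟩, rfl⟩
      exact ⟨u, hu, s.1, s.2, hs, Z.1, hZ₁, Z.2, hZ₂, rfl⟩
  rw [himage, Finset.card_image_of_injOn]
  have hinv : ∀ Z ∈ ((L.origins₂ (L.credPass t₁).root.2 (L.credPass t₂).root.2 φ).biUnion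
      fun s => L.projSets P t₁ s.1 ×ˢ L.projSets P t₂ s.2),
      (Z.1 ∪ Z.2) ∩ t₁.verts = Z.1 ∧ (Z.1 ∪ Z.2) ∩ t₂.verts = Z.2 := by
    intro Z hZ
    obtain ⟨s, hs, hZ⟩ := Finset.mem_biUnion.1 hZ
    obtain ⟨_, _, u, hu, hs⟩ := (mem_origins₂ _ _ _ _ _).1 hs
    obtain ⟨h1, h2⟩ := Finset.mem_product.1 hZ
    exact hV u s.1 s.2 hs Z.1 h1 Z.2 h2
  intro Z hZ Z' hZ' h
  have h : Z.1 ∪ Z.2 = Z'.1 ∪ Z'.2 := h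
  have h1 := hinv Z hZ
  have h2 := hinv Z' hZ'
  rw [h] at h1
  exact Prod.ext (h1.1.symm.trans h2.1) (h1.2.symm.trans h2.2)

/-- An intersection of rectangles is the rectangle of the intersections of the sides. This justifies
multiplying the counts of the two component sets at a join. -/
theorem card_interOf_product {α₁ α₂ β₁ β₂ : Type u} [DecidableEq α₁] [DecidableEq α₂]
    [DecidableEq β₁] [DecidableEq β₂] [Fintype β₁] [Fintype β₂]
    (f₁ : α₁ → Finset β₁) (f₂ : α₂ → Finset β₂) (O : Finset (α₁ × α₂)) :
    (interOf (fun s : α₁ × α₂ => f₁ s.1 ×ˢ f₂ s.2) O).card =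
      (interOf f₁ (O.image Prod.fst)).card * (interOf f₂ (O.image Prod.snd)).card := by
  rw [← Finset.card_product]
  congr 1
  ext ⟨x, y⟩
  simp only [interOf, Finset.mem_filter, Finset.mem_univ, true_and, Finset.mem_product,
    Finset.forall_mem_image]
  exact forall₂_and

theorem pc_origins₁ {L : LocalAlg V} (hL : L.Tracks L.ext) {P X : Finset V} {R : Finset (V × V)}
    {t : RTree (Finset V)} (hT : (RTree.one X t).NiceDecomp R) {φ : Finset L.Row} (h0 : φ ≠ ∅)
    (hφ : ∀ u ∈ φ, ∀ v ∈ φ, L.ext u ∩ P = L.ext v ∩ P) (stored : Finset L.Row → ℕ)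
    (h : ∀ O ⊆ L.origins₁ X t.root (L.credPass t).root.2 φ, O ≠ ∅ →
      stored O = (interOf (L.projSets P t) O).card) :
    pc (L.origins₁ X t.root (L.credPass t).root.2 φ) stored =
      ((φ.biUnion (L.projSets P (.one X t))).card : ℤ) := by
  rw [pc_eq_card_biUnion (L.projSets P t) _ _ h]
  obtain ⟨w, hw⟩ := Finset.nonempty_iff_ne_empty.2 h0
  rw [card_biUnion_origins₁ (L.ext w ∩ P) fun u hu => hφ u hu w hw]
  intro u hu s hs Z hZ
  rw [hφ w hw u hu]
  cases hT with
  | @introduce _ a ht ha =>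
    obtain ⟨h1, h2⟩ := projSets_inter hL ht hZ
    rw [L.unaryTable_insert fun h => ha (t.root_subset_verts h), Finset.singleton_biUnion] at hs
    refine ⟨h1, ?_⟩
    rcases hL.introduce _ _ _ _ hs with h3 | h3 <;> grind
  | @remove _ a ht ha =>
    obtain ⟨h1, h2⟩ := projSets_inter hL ht hZ
    rw [L.unaryTable_erase ha, Finset.singleton_biUnion] at hs
    refine ⟨h1, ?_⟩
    rw [hL.remove _ _ _ hs]
    intro x hx
    have hx2 := Finset.ext_iff.1 h2 x
    simp only [Finset.mem_inter, Finset.mem_erase] at hx hx2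
    tauto

theorem pc_origins₂ {L : LocalAlg V} (hL : L.Tracks L.ext) {P X : Finset V} {R : Finset (V × V)}
    {t₁ t₂ : RTree (Finset V)} (hT : (RTree.two X t₁ t₂).NiceDecomp R) {φ : Finset L.Row}
    (s₁ s₂ : Finset L.Row → ℕ)
    (h₁ : ∀ O ⊆ (L.origins₂ (L.credPass t₁).root.2 (L.credPass t₂).root.2 φ).image Prod.fst,
      O ≠ ∅ → s₁ O = (interOf (L.projSets P t₁) O).card)
    (h₂ : ∀ O ⊆ (L.origins₂ (L.credPass t₁).root.2 (L.credPass t₂).root.2 φ).image Prod.snd,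
      O ≠ ∅ → s₂ O = (interOf (L.projSets P t₂) O).card) :
    pc (L.origins₂ (L.credPass t₁).root.2 (L.credPass t₂).root.2 φ)
      (fun O => s₁ (O.image Prod.fst) * s₂ (O.image Prod.snd)) =
      ((φ.biUnion (L.projSets P (.two X t₁ t₂))).card : ℤ) := by
  rw [pc_eq_card_biUnion (fun s => L.projSets P t₁ s.1 ×ˢ L.projSets P t₂ s.2) _ _ ?_]
  · rw [card_biUnion_origins₂ (X := X)]
    intro u u₁ u₂ hu Z₁ hZ₁ Z₂ hZ₂
    cases hT with
    | join ht₁ ht₂ hr _ hi =>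
      obtain ⟨h11, h12⟩ := projSets_inter hL ht₁ hZ₁
      obtain ⟨h21, h22⟩ := projSets_inter hL ht₂ hZ₂
      obtain ⟨h3, h4⟩ := hL.join _ _ _ hu
      rw [h3.symm.trans h4, h22, hr] at h12
      refine ⟨union_inter_eq_left h11 h21 hi h12, ?_⟩
      rw [Finset.union_comm]
      exact union_inter_eq_left h21 h11 (by rwa [Finset.inter_comm]) h12.symm
  · intro O hO h0
    rw [card_interOf_product, h₁ _ (Finset.image_subset_image hO) (by simpa using h0),
      h₂ _ (Finset.image_subset_image hO) (by simpa using h0)]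

/-- The invariant of the third pass. It is stated for an arbitrary table `ν` so that the induction
applies to the pruned tables of the children. Origins of rows in `ν` are exactly what pruning keeps,
so each set `O` in the formula for `pc` consists of rows of the pruned child tables; if `O` is not
stored, it meets several buckets and its count is 0. -/
theorem sipc_projPass {L : LocalAlg V} (hL : L.Tracks L.ext) (P : Finset V)
    {R : Finset (V × V)} {T : RTree (Finset V)} (hT : T.NiceDecomp R) (ν : Finset L.Row)
    (hν : ν ⊆ (L.credPass T).root.2) (σ : Finset L.Row) (hσ : σ ⊆ ν) (h0 : σ ≠ ∅) :
    L.sipc (L.projPass P (L.pruneFrom (L.credPass T) ν)).root.2 σ =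
      (interOf (L.projSets P T) σ).card := by
  induction T generalizing ν σ with
  | leaf X =>
    change L.sipc ((L.subBuckets P ν).image fun σ => (σ, 1)) σ = _
    rw [sipc_image L _ fun _ => 1]
    refine ite_subBuckets_eq hL hT hσ h0 fun _ => ?_
    have hX : interOf (L.projSets P (.leaf X)) σ = {∅} := by
      ext Y
      obtain ⟨w, hw⟩ := Finset.nonempty_iff_ne_empty.2 h0
      have hone : ∀ u ∈ σ, u = L.leafRow := fun u hu => by
        have h := hν (hσ hu)
        simpa [credPass, RTree.root] using h
      simp only [interOf, Finset.mem_filter, Finset.mem_univ, true_and, mem_projSets, Derives,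
        Finset.mem_singleton]
      constructor
      · intro h
        obtain ⟨S, ⟨_, rfl⟩, rfl⟩ := h w hw
        rw [hL.leafRow, Finset.empty_inter]
      · rintro rfl u hu
        exact ⟨_, ⟨hone u hu, rfl⟩, by rw [hL.leafRow, Finset.empty_inter]⟩
    rw [hX, Finset.card_singleton]
  | one X t ih =>
    have ht : t.NiceDecomp R := by cases hT <;> assumption
    change L.sipc ((L.subBuckets P ν).image fun σ => (σ, ipc _ σ)) σ = _
    rw [sipc_image]
    refine ite_subBuckets_eq hL hT hσ h0 fun hb => ?_
    refine ipc_eq_card_interOf _ _ _ h0 fun φ hφ hφ0 => ?_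
    simp only [pruneFrom_root, credPass_root_fst]
    refine pc_origins₁ hL hT hφ0 (fun u hu v hv => hb u (hφ hu) v (hφ hv)) _ fun O hO hO0 => ?_
    refine ih ht _ ?_ O (hO.trans ?_) hO0
    · intro s hs
      exact ((mem_origins₁ _ _ _ _ _ _).1 hs).1
    · intro s hs
      rw [mem_origins₁] at hs ⊢
      obtain ⟨h1, u, hu, h2⟩ := hs
      exact ⟨h1, u, hσ (hφ hu), h2⟩
  | two X t₁ t₂ ih₁ ih₂ =>
    have ht : t₁.NiceDecomp R ∧ t₂.NiceDecomp R := by cases hT; constructor <;> assumption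
    change L.sipc ((L.subBuckets P ν).image fun σ => (σ, ipc _ σ)) σ = _
    rw [sipc_image]
    refine ite_subBuckets_eq hL hT hσ h0 fun hb => ?_
    refine ipc_eq_card_interOf _ _ _ h0 fun φ hφ hφ0 => ?_
    have hsub : L.origins₂ (L.credPass t₁).root.2 (L.credPass t₂).root.2 φ ⊆
        L.origins₂ (L.credPass t₁).root.2 (L.credPass t₂).root.2 ν := by
      intro s hs
      rw [mem_origins₂] at hs ⊢
      obtain ⟨h1, h2, u, hu, h3⟩ := hs
      exact ⟨h1, h2, u, hσ (hφ hu), h3⟩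
    simp only [pruneFrom_root]
    refine pc_origins₂ hL hT _ _ (fun O hO hO0 => ?_) (fun O hO hO0 => ?_)
    · refine ih₁ ht.1 _ ?_ O (hO.trans (Finset.image_subset_image hsub)) hO0
      intro s hs
      obtain ⟨p, hp, rfl⟩ := Finset.mem_image.1 hs
      exact ((mem_origins₂ _ _ _ _ _).1 hp).1
    · refine ih₂ ht.2 _ ?_ O (hO.trans (Finset.image_subset_image hsub)) hO0
      intro s hs
      obtain ⟨p, hp, rfl⟩ := Finset.mem_image.1 hs
      exact ((mem_origins₂ _ _ _ _ _).1 hp).2.1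

/-- By `hsub` the accepted root table has at most one row. If there is one, the intersection over
the table is the set of all projections derived with that row. -/
theorem mdpa_eq_ncard {L : LocalAlg V} (hL : L.Tracks L.ext) (P : Finset V)
    {R : Finset (V × V)} {T : RTree (Finset V)} (hT : T.NiceDecomp R)
    (hsub : ∀ u v S S', L.Derives L.ext T u S → L.Derives L.ext T v S' →
      L.accept u = true → L.accept v = true → u = v) :
    L.mdpa P T =
      Set.ncard {X | ∃ S, (∃ u, L.Derives L.ext T u S ∧ L.accept u = true) ∧ X = S ∩ P} := by
  set ν := (L.credPass T).root.2.filter fun u => L.accept u with hν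
  have hmdpa : L.mdpa P T = L.sipc (L.projPass P (L.pruneFrom (L.credPass T) ν)).root.2 ν := by
    change L.sipc _ (L.pruneFrom (L.credPass T) ν).root.ν = _
    rw [pruneFrom_root]
    rfl
  have hmem : ∀ u, u ∈ ν ↔ (∃ S, L.Derives L.ext T u S) ∧ L.accept u = true := fun u => by
    rw [hν, Finset.mem_filter, L.mem_credPass_root L.ext]
  rw [hmdpa]
  rcases Finset.eq_empty_or_nonempty ν with h0 | ⟨w, hw⟩
  · have : {X | ∃ S, (∃ u, L.Derives L.ext T u S ∧ L.accept u = true) ∧ X = S ∩ P} = ∅ := by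
      rw [Set.eq_empty_iff_forall_notMem]
      rintro X ⟨S, ⟨u, hu, hacc⟩, rfl⟩
      have := (hmem u).2 ⟨⟨S, hu⟩, hacc⟩
      simp [h0] at this
    rw [this, Set.ncard_empty]
    -- Without accepted rows the empty set of rows is looked up. It is never stored, so the result
    -- is 0, as it should be.
    have hnot : ∅ ∉ L.subBuckets P ν := fun h => ((mem_subBuckets _ _ _ _).1 h).1 rfl
    have : ∀ Tp : RTree L.PrunedLabel, ∅ ∉ L.subBuckets P Tp.root.ν →
        L.sipc (L.projPass P Tp).root.2 ∅ = 0 := by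
      intro Tp h
      cases Tp with
      | leaf x => exact (sipc_image L _ (fun _ => 1) ∅).trans (if_neg h)
      | one x t => exact (sipc_image L _ _ ∅).trans (if_neg h)
      | two x t₁ t₂ => exact (sipc_image L _ _ ∅).trans (if_neg h)
    rw [h0] at hnot ⊢
    exact this _ (by rwa [pruneFrom_root])
  · rw [sipc_projPass hL P hT ν (Finset.filter_subset _ _) ν subset_rfl
      (Finset.ne_empty_of_mem hw), ← Set.ncard_coe_finset]
    congr 1
    ext X
    simp only [interOf, Finset.coe_filter, Finset.mem_univ, true_and, Set.mem_ofPred_eq,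
      mem_projSets]
    obtain ⟨⟨S₀, hS₀⟩, hacc⟩ := (hmem w).1 hw
    constructor
    · intro h
      obtain ⟨S, hS, rfl⟩ := h w hw
      exact ⟨S, ⟨w, hS, hacc⟩, rfl⟩
    · rintro ⟨S, ⟨u, hu, hu'⟩, rfl⟩ v hv
      obtain ⟨⟨S', hS'⟩, hacc'⟩ := (hmem v).1 hv
      rw [hsub v u S' S hS' hu hacc' hu']
      exact ⟨S, hu, rfl⟩

end LocalAlg

/-! ### The credulous argument and counter-witnesses. -/

namespace LocalAlg

variable {V : Type u} [DecidableEq V]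

theorem Tracks.credulous {L : LocalAlg V} {f : L.Row → Finset V} (hf : L.Tracks f) (c : V) :
    (L.credulous c).Tracks f where
  leafRow := hf.leafRow
  introduce X a u v hv := hf.introduce X a u v (Finset.mem_filter.1 hv).1
  remove := hf.remove
  join := hf.join

theorem Tracks.maximize {L : LocalAlg V} (hL : L.Tracks L.ext) (key : L.Row → Finset V) :
    (L.maximize key).Tracks (L.maximize key).ext where
  leafRow := hL.leafRow
  introduce X a u v hv := by
    obtain ⟨w, hw, rfl⟩ := Finset.mem_image.1 hv
    exact hL.introduce X a u.1 w hw
  remove a u v hv := by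
    obtain ⟨w, hw, rfl⟩ := Finset.mem_image.1 hv
    exact hL.remove a u.1 w hw
  join u₁ u₂ v hv := by
    obtain ⟨w, hw, rfl⟩ := Finset.mem_image.1 hv
    exact hL.join u₁.1 u₂.1 w hw

/-- New vertices enter only at introduce nodes, and the extension part of a row is the trace of the
collected set on the bag. Testing the row there tests the set, and membership of `c` persists
upwards. At a join, a shared `c` lies in the common bag, where both sets agree. -/
theorem derives_credulous {L : LocalAlg V} (hL : L.Tracks L.ext) (c : V)
    {R : Finset (V × V)} {T : RTree (Finset V)} (hT : T.NiceDecomp R)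
    {u : (L.credulous c).Row} {S : Finset V} :
    (L.credulous c).Derives (L.credulous c).ext T u S ↔ L.Derives L.ext T u S ∧ (c ∈ T.verts → c ∈ S) := by
  induction hT generalizing u S with
  | leaf =>
    change _ ∧ _ ↔ (_ ∧ _) ∧ _
    simp [RTree.verts, credulous]
  | @introduce t a ht ha ih =>
    have har : a ∉ t.root := fun h => ha (t.root_subset_verts h)
    refine (derives_introduce (L := L.credulous c) har).trans
      (Iff.trans ?_ (and_congr_left' (derives_introduce (L := L) (u := u) har).symm))
    have key : ∀ s S', L.Derives L.ext t s S' → ∀ v ∈ L.introduce (insert a t.root) a s,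
        ((c ∈ t.verts → c ∈ S') ∧ L.ext v ∩ {c} = insert a t.root ∩ {c} ↔
          (c ∈ insert a t.root ∪ t.verts → c ∈ S' ∪ L.ext v)) := by
      intro s S' hs v hv
      obtain ⟨h1, h2⟩ := hL.subset_and_inter ht hs
      have h3 : L.ext v ∩ {c} = insert a t.root ∩ {c} ↔ (c ∈ L.ext v ↔ c ∈ insert a t.root) := by
        rw [Finset.ext_iff]
        constructor
        · intro h; simpa using h c
        · intro h x
          simp only [Finset.mem_inter, Finset.mem_singleton]
          constructor
          · rintro ⟨h4, rfl⟩; exact ⟨h.1 h4, rfl⟩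
          · rintro ⟨h4, rfl⟩; exact ⟨h.2 h4, rfl⟩
      have h4 := @h1 c
      have h5 := Finset.ext_iff.1 h2 c
      have h6 := @RTree.root_subset_verts V _ t c
      rw [h3]
      have h7 : c = a → c ∉ t.verts := fun h => h ▸ ha
      have h8 := hL.introduce _ _ _ _ hv
      clear h1 h2 h3 hs hv ih
      rcases h8 with h8 | h8 <;> rw [h8] <;>
        simp only [Finset.mem_insert, Finset.mem_union, Finset.mem_inter] at h5 ⊢ <;>
        clear h8 <;> grind
    constructor
    · rintro ⟨s, S', hs, hu, rfl⟩
      obtain ⟨hs, hc⟩ := ih.1 hs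
      obtain ⟨hu, hc'⟩ := Finset.mem_filter.1 hu
      exact ⟨⟨s, S', hs, hu, rfl⟩, (key s S' hs u hu).1 ⟨hc, hc'⟩⟩
    · rintro ⟨⟨s, S', hs, hu, rfl⟩, hc⟩
      obtain ⟨hc, hc'⟩ := (key s S' hs u hu).2 hc
      exact ⟨s, S', ih.2 ⟨hs, hc⟩, Finset.mem_filter.2 ⟨hu, hc'⟩, rfl⟩
  | @remove t a ht ha _ ih =>
    refine (derives_remove (L := L.credulous c) ha).trans
      (Iff.trans ?_ (and_congr_left' (derives_remove (L := L) (u := u) ha).symm))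
    have hv : t.root.erase a ∪ t.verts = t.verts :=
      Finset.union_eq_right.2 ((Finset.erase_subset _ _).trans t.root_subset_verts)
    have key : ∀ s S', L.Derives L.ext t s S' → ∀ v ∈ L.remove a s, S' ∪ L.ext v = S' := by
      intro s S' hs v hv
      rw [hL.remove _ _ _ hv, (hL.subset_and_inter ht hs).2]
      exact Finset.union_eq_left.2 ((Finset.erase_subset _ _).trans Finset.inter_subset_left)
    simp only [RTree.verts, hv]
    constructor
    · rintro ⟨s, S', hs, hu, rfl⟩
      obtain ⟨hs, hc⟩ := ih.1 hs
      refine ⟨⟨s, S', hs, hu, rfl⟩, ?_⟩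
      change _ → c ∈ S' ∪ L.ext u
      rwa [key s S' hs u hu]
    · rintro ⟨⟨s, S', hs, hu, rfl⟩, hc⟩
      change _ → c ∈ S' ∪ L.ext u at hc
      rw [key s S' hs u hu] at hc
      exact ⟨s, S', ih.2 ⟨hs, hc⟩, hu, rfl⟩
  | @join t₁ t₂ ht₁ ht₂ hr _ hi ih₁ ih₂ =>
    have key : ∀ s₁ s₂ S₁ S₂, L.Derives L.ext t₁ s₁ S₁ → L.Derives L.ext t₂ s₂ S₂ →
        ∀ v ∈ L.join s₁ s₂, ((c ∈ t₁.verts → c ∈ S₁) ∧ (c ∈ t₂.verts → c ∈ S₂) ↔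
          (c ∈ t₁.root ∪ (t₁.verts ∪ t₂.verts) → c ∈ S₁ ∪ S₂)) := by
      intro s₁ s₂ S₁ S₂ h₁ h₂ v hv
      obtain ⟨h11, h12⟩ := hL.subset_and_inter ht₁ h₁
      obtain ⟨h21, h22⟩ := hL.subset_and_inter ht₂ h₂
      obtain ⟨h3, h4⟩ := hL.join _ _ _ hv
      have h5 := @h11 c
      have h6 := @h21 c
      have h7 := @RTree.root_subset_verts V _ t₁ c
      have h8 := @hi c
      have h9 := Finset.ext_iff.1 (h12.symm.trans (h3.symm.trans (h4.trans h22))) c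
      rw [hr] at h9
      simp only [Finset.mem_union, Finset.mem_inter] at h8 h9 ⊢
      clear h3 h4 h12 h22 h11 h21 hv ih₁ ih₂
      grind
    constructor
    · rintro ⟨s₁, s₂, S₁, S₂, h₁, h₂, hu, rfl⟩
      obtain ⟨h₁, hc₁⟩ := ih₁.1 h₁
      obtain ⟨h₂, hc₂⟩ := ih₂.1 h₂
      exact ⟨⟨s₁, s₂, S₁, S₂, h₁, h₂, hu, rfl⟩, (key _ _ _ _ h₁ h₂ u hu).1 ⟨hc₁, hc₂⟩⟩
    · rintro ⟨⟨s₁, s₂, S₁, S₂, h₁, h₂, hu, rfl⟩, hc⟩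
      obtain ⟨hc₁, hc₂⟩ := (key _ _ _ _ h₁ h₂ u hu).2 hc
      exact ⟨s₁, s₂, S₁, S₂, ih₁.2 ⟨h₁, hc₁⟩, ih₂.2 ⟨h₂, hc₂⟩, hu, rfl⟩

/-- `C` consists of all rows that are derived with a key containing `K`, flagged if the inclusion
is strict. -/
def CounterSet (L : LocalAlg V) (key : L.Row → Finset V) (T : RTree (Finset V)) (K : Finset V)
    (C : Finset (L.Row × Bool)) : Prop :=
  ∀ x, x ∈ C ↔ ∃ K', L.Derives key T x.1 K' ∧ K ⊆ K' ∧ x.2 = decide (K ⊂ K')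

/-- Inclusion need not be strict, so each witness is its own unflagged counter-witness. -/
theorem CounterSet.insert_eq {L : LocalAlg V} {key : L.Row → Finset V} {T : RTree (Finset V)}
    {K : Finset V} {C : Finset (L.Row × Bool)} (h : L.CounterSet key T K C) {u : L.Row}
    (hu : L.Derives key T u K) : insert (u, false) C = C :=
  Finset.insert_eq_of_mem ((h _).2 ⟨K, hu, subset_rfl, by simp⟩)

/-- A vertex of `A` that is covered only by `B'` would lie in both `VA` and `VB`, hence in `X`,
where `A'` and `B'` agree; symmetrically for `B`. It is therefore safe to discard a counter-witness
as soon as one piece of its key fails to contain the corresponding piece of the witness. -/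
theorem union_subset_union_iff {A B A' B' VA VB X : Finset V} (hA : A ⊆ VA) (hB : B ⊆ VB)
    (hA' : A' ⊆ VA) (hB' : B' ⊆ VB) (hX : VA ∩ VB ⊆ X) (h : A ∩ X = B ∩ X)
    (h' : A' ∩ X = B' ∩ X) : A ∪ B ⊆ A' ∪ B' ↔ A ⊆ A' ∧ B ⊆ B' := by
  refine ⟨fun hs => ?_, fun hs => Finset.union_subset_union hs.1 hs.2⟩
  have key : ∀ x, (x ∈ A → x ∈ A') ∧ (x ∈ B → x ∈ B') := by
    intro x
    have h1 := @hA x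
    have h2 := @hB x
    have h3 := @hA' x
    have h4 := @hB' x
    have h5 := @hX x
    have h6 := Finset.ext_iff.1 h x
    have h7 := Finset.ext_iff.1 h' x
    have h8 := @hs x
    simp only [Finset.mem_inter, Finset.mem_union] at h5 h6 h7 h8
    clear hA hB hA' hB' hX h h' hs
    grind
  exact ⟨fun x => (key x).1, fun x => (key x).2⟩

/-- The reverse inclusion also splits into pieces, so it fails precisely when it fails on one of
them. This is the disjunction of flags. -/
theorem union_ssubset_union_iff {A B A' B' VA VB X : Finset V} (hA : A ⊆ VA) (hB : B ⊆ VB)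
    (hA' : A' ⊆ VA) (hB' : B' ⊆ VB) (hX : VA ∩ VB ⊆ X) (h : A ∩ X = B ∩ X)
    (h' : A' ∩ X = B' ∩ X) (hs : A ⊆ A') (ht : B ⊆ B') :
    A ∪ B ⊂ A' ∪ B' ↔ A ⊂ A' ∨ B ⊂ B' := by
  rw [Finset.ssubset_def, Finset.ssubset_def, Finset.ssubset_def,
    union_subset_union_iff hA hB hA' hB' hX h h', union_subset_union_iff hA' hB' hA hB hX h' h]
  tauto

/-- The hypothesis speaks of `insert (u, false) C` because at a leaf `C` is empty and only becomes
the full counter set when the witness is added. -/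
theorem counterSet_introduce {L : LocalAlg V} {key : L.Row → Finset V} (hk : L.Tracks key)
    {R : Finset (V × V)} {t : RTree (Finset V)} (ht : t.NiceDecomp R) {a : V}
    (ha : a ∉ t.verts) {u u' : L.Row} {K : Finset V} {C : Finset (L.Row × Bool)}
    (hu : L.Derives key t u K) (hC : L.CounterSet key t K (insert (u, false) C))
    (hu' : u' ∈ L.introduce (insert a t.root) a u) :
    L.CounterSet key (.one (insert a t.root) t) (K ∪ key u')
      (L.introduceCounter key (insert a t.root) a u u' C) := by
  have har : a ∉ t.root := fun h => ha (t.root_subset_verts h)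
  -- The key collected so far lives on `t.verts`, the key of the new row on the new bag. As `a` is
  -- new, the two overlap only in the old bag.
  have hX : t.verts ∩ insert a t.root ⊆ t.root := by
    intro x hx
    obtain ⟨h1, h2⟩ := Finset.mem_inter.1 hx
    rcases Finset.mem_insert.1 h2 with rfl | h2
    · exact absurd h1 ha
    · exact h2
  have hbasic : ∀ v K', L.Derives key t v K' → ∀ v' ∈ L.introduce (insert a t.root) a v,
      K' ⊆ t.verts ∧ key v' ⊆ insert a t.root ∧ K' ∩ t.root = key v' ∩ t.root := by
    intro v K' hv v' hv'
    obtain ⟨h1, h2⟩ := hk.subset_and_inter ht hv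
    refine ⟨h1, ?_⟩
    rcases hk.introduce _ _ _ _ hv' with h | h <;> rw [h, h2]
    · exact ⟨Finset.inter_subset_right.trans (Finset.subset_insert _ _), by simp⟩
    · refine ⟨Finset.insert_subset_insert _ Finset.inter_subset_right, ?_⟩
      rw [Finset.insert_inter_of_notMem har]
      simp
  obtain ⟨b1, b2, b3⟩ := hbasic u K hu u' hu'
  rintro ⟨v', σ⟩
  rw [introduceCounter]
  simp only [Finset.mem_biUnion, Finset.mem_image, Finset.mem_filter, hC _, derives_introduce har,
    Prod.mk.injEq]
  constructor
  · rintro ⟨⟨v, τ⟩, ⟨K', hv, hKK', hτ⟩, v', ⟨hv', hkk⟩, rfl, rfl⟩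
    obtain ⟨c1, c2, c3⟩ := hbasic v K' hv v' hv'
    refine ⟨_, ⟨v, K', hv, hv', rfl⟩, Finset.union_subset_union hKK' hkk, ?_⟩
    have := union_ssubset_union_iff b1 b2 c1 c2 hX b3 c3 hKK' hkk
    simp only at hτ
    rw [hτ, ← Bool.decide_or]
    exact decide_eq_decide.2 this.symm
  · rintro ⟨_, ⟨v, K', hv, hv', rfl⟩, hsub, hσ⟩
    obtain ⟨c1, c2, c3⟩ := hbasic v K' hv v' hv'
    obtain ⟨hKK', hkk⟩ := (union_subset_union_iff b1 b2 c1 c2 hX b3 c3).1 hsub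
    refine ⟨(v, decide (K ⊂ K')), ⟨K', hv, hKK', rfl⟩, v', ⟨hv', hkk⟩, rfl, ?_⟩
    have := union_ssubset_union_iff b1 b2 c1 c2 hX b3 c3 hKK' hkk
    rw [hσ, ← Bool.decide_or]
    exact decide_eq_decide.2 this.symm

/-- After a removal the key of the row is part of the key collected before, so accumulated keys,
inclusions and flags all stay the same. -/
theorem counterSet_remove {L : LocalAlg V} {key : L.Row → Finset V} (hk : L.Tracks key)
    {R : Finset (V × V)} {t : RTree (Finset V)} (ht : t.NiceDecomp R) {a : V}
    (ha : a ∈ t.root) {u u' : L.Row} {K : Finset V} {C : Finset (L.Row × Bool)}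
    (hu : L.Derives key t u K) (hC : L.CounterSet key t K C) (hu' : u' ∈ L.remove a u) :
    L.CounterSet key (.one (t.root.erase a) t) (K ∪ key u')
      (C.biUnion fun x => (L.remove a x.1).image fun v => (v, x.2)) := by
  have hbasic : ∀ v K', L.Derives key t v K' → ∀ v' ∈ L.remove a v, K' ∪ key v' = K' := by
    intro v K' hv v' hv'
    rw [hk.remove _ _ _ hv', (hk.subset_and_inter ht hv).2]
    exact Finset.union_eq_left.2 ((Finset.erase_subset _ _).trans Finset.inter_subset_left)
  rw [hbasic u K hu u' hu']
  rintro ⟨v', σ⟩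
  simp only [Finset.mem_biUnion, Finset.mem_image, hC _, derives_remove ha, Prod.mk.injEq]
  constructor
  · rintro ⟨⟨v, τ⟩, ⟨K', hv, hKK', hτ⟩, v', hv', rfl, rfl⟩
    exact ⟨K', ⟨v, K', hv, hv', (hbasic v K' hv v' hv').symm⟩, hKK', hτ⟩
  · rintro ⟨_, ⟨v, K', hv, hv', rfl⟩, hsub, hσ⟩
    rw [Finset.sup_eq_union, hbasic v K' hv v' hv'] at hsub hσ
    exact ⟨(v, σ), ⟨K', hv, hsub, hσ⟩, v', hv', rfl, rfl⟩

theorem mem_joinCounter {L : LocalAlg V} {C₁ C₂ : Finset (L.Row × Bool)} {x : L.Row × Bool} :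
    x ∈ L.joinCounter C₁ C₂ ↔
      ∃ x₁ ∈ C₁, ∃ x₂ ∈ C₂, x.1 ∈ L.join x₁.1 x₂.1 ∧ x.2 = (x₁.2 || x₂.2) := by
  obtain ⟨v, σ⟩ := x
  simp only [joinCounter, Finset.mem_biUnion, Finset.mem_image, Prod.mk.injEq]
  constructor
  · rintro ⟨x₁, h₁, x₂, h₂, w, hw, rfl, rfl⟩
    exact ⟨x₁, h₁, x₂, h₂, hw, rfl⟩
  · rintro ⟨x₁, h₁, x₂, h₂, hw, rfl⟩
    exact ⟨x₁, h₁, x₂, h₂, v, hw, rfl, rfl⟩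

theorem joinCounter_mono {L : LocalAlg V} {C₁ C₂ D₁ D₂ : Finset (L.Row × Bool)} (h₁ : C₁ ⊆ D₁)
    (h₂ : C₂ ⊆ D₂) : L.joinCounter C₁ C₂ ⊆ L.joinCounter D₁ D₂ := by
  intro x hx
  obtain ⟨x₁, hx₁, x₂, hx₂, h⟩ := mem_joinCounter.1 hx
  exact mem_joinCounter.2 ⟨x₁, h₁ hx₁, x₂, h₂ hx₂, h⟩

theorem counterSet_join {L : LocalAlg V} {key : L.Row → Finset V} (hk : L.Tracks key)
    {R : Finset (V × V)} {t₁ t₂ : RTree (Finset V)} (ht₁ : t₁.NiceDecomp R)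
    (ht₂ : t₂.NiceDecomp R) (hr : t₂.root = t₁.root) (hi : t₁.verts ∩ t₂.verts ⊆ t₁.root)
    {u₁ u₂ u : L.Row} {K₁ K₂ : Finset V} {C₁ C₂ : Finset (L.Row × Bool)}
    (hu₁ : L.Derives key t₁ u₁ K₁) (hu₂ : L.Derives key t₂ u₂ K₂)
    (hC₁ : L.CounterSet key t₁ K₁ C₁) (hC₂ : L.CounterSet key t₂ K₂ C₂)
    (hu : u ∈ L.join u₁ u₂) :
    L.CounterSet key (.two t₁.root t₁ t₂) (K₁ ∪ K₂)
      (L.joinCounter C₁ C₂ ∪ L.joinCounter C₁ {(u₂, false)} ∪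
        L.joinCounter {(u₁, false)} C₂) := by
  -- The two extra joins contribute nothing, since `C₁` and `C₂` already contain their own witnesses
  -- without flag.
  have hC : L.joinCounter C₁ C₂ ∪ L.joinCounter C₁ {(u₂, false)} ∪
      L.joinCounter {(u₁, false)} C₂ = L.joinCounter C₁ C₂ := by
    have h₁ : {(u₁, false)} ⊆ C₁ := by
      rw [Finset.singleton_subset_iff, ← hC₁.insert_eq hu₁]
      exact Finset.mem_insert_self _ _
    have h₂ : {(u₂, false)} ⊆ C₂ := by
      rw [Finset.singleton_subset_iff, ← hC₂.insert_eq hu₂]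
      exact Finset.mem_insert_self _ _
    rw [Finset.union_eq_left.2 (joinCounter_mono subset_rfl h₂),
      Finset.union_eq_left.2 (joinCounter_mono h₁ subset_rfl)]
  rw [hC]
  have hbasic : ∀ v₁ v₂ K₁ K₂, L.Derives key t₁ v₁ K₁ → L.Derives key t₂ v₂ K₂ →
      ∀ v ∈ L.join v₁ v₂, K₁ ⊆ t₁.verts ∧ K₂ ⊆ t₂.verts ∧ K₁ ∩ t₁.root = K₂ ∩ t₁.root := by
    intro v₁ v₂ K₁ K₂ h₁ h₂ v hv
    obtain ⟨h11, h12⟩ := hk.subset_and_inter ht₁ h₁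
    obtain ⟨h21, h22⟩ := hk.subset_and_inter ht₂ h₂
    obtain ⟨h3, h4⟩ := hk.join _ _ _ hv
    refine ⟨h11, h21, ?_⟩
    rw [← h12, ← h3, h4, h22, hr]
  obtain ⟨b1, b2, b3⟩ := hbasic _ _ _ _ hu₁ hu₂ u hu
  rintro ⟨v, σ⟩
  rw [mem_joinCounter]
  constructor
  · rintro ⟨⟨v₁, σ₁⟩, h₁, ⟨v₂, σ₂⟩, h₂, hv, rfl⟩
    obtain ⟨K₁', hd₁, hs₁, hσ₁⟩ := (hC₁ _).1 h₁
    obtain ⟨K₂', hd₂, hs₂, hσ₂⟩ := (hC₂ _).1 h₂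
    obtain ⟨c1, c2, c3⟩ := hbasic _ _ _ _ hd₁ hd₂ v hv
    refine ⟨_, ⟨v₁, v₂, K₁', K₂', hd₁, hd₂, hv, rfl⟩, Finset.union_subset_union hs₁ hs₂, ?_⟩
    have := union_ssubset_union_iff b1 b2 c1 c2 hi b3 c3 hs₁ hs₂
    simp only at hσ₁ hσ₂ ⊢
    rw [hσ₁, hσ₂, ← Bool.decide_or]
    exact decide_eq_decide.2 this.symm
  · rintro ⟨_, ⟨v₁, v₂, K₁', K₂', hd₁, hd₂, hv, rfl⟩, hsub, hσ⟩
    obtain ⟨c1, c2, c3⟩ := hbasic _ _ _ _ hd₁ hd₂ v hv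
    obtain ⟨hs₁, hs₂⟩ := (union_subset_union_iff b1 b2 c1 c2 hi b3 c3).1 hsub
    refine ⟨(v₁, decide (K₁ ⊂ K₁')), (hC₁ _).2 ⟨K₁', hd₁, hs₁, rfl⟩,
      (v₂, decide (K₂ ⊂ K₂')), (hC₂ _).2 ⟨K₂', hd₂, hs₂, rfl⟩, hv, ?_⟩
    have := union_ssubset_union_iff b1 b2 c1 c2 hi b3 c3 hs₁ hs₂
    simp only at hσ ⊢
    rw [hσ, ← Bool.decide_or]
    exact decide_eq_decide.2 this

/-- What is known about the counter-witnesses of a derived witness with key `K`. -/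
def IsCounter (L : LocalAlg V) (key : L.Row → Finset V) (T : RTree (Finset V)) (K : Finset V)
    (C : Finset (L.Row × Bool)) : Prop :=
  (T = .leaf ∅ ∧ C = ∅) ∨ L.CounterSet key T K C

/-- At a leaf the only derivable row is the witness itself, so adding it supplies the one missing
counter-witness; elsewhere it is present already. -/
theorem IsCounter.counterSet_insert {L : LocalAlg V} {key : L.Row → Finset V}
    {T : RTree (Finset V)} {K : Finset V} {C : Finset (L.Row × Bool)} (h : L.IsCounter key T K C)
    {u : L.Row} (hu : L.Derives key T u K) : L.CounterSet key T K (insert (u, false) C) := by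
  rcases h with ⟨rfl, rfl⟩ | h
  · rintro ⟨v, σ⟩
    obtain ⟨rfl, rfl⟩ := hu
    simp only [Derives, Finset.mem_insert, Prod.mk.injEq, Finset.notMem_empty, or_false]
    constructor
    · rintro ⟨rfl, rfl⟩; exact ⟨_, ⟨rfl, rfl⟩, subset_rfl, by simp⟩
    · rintro ⟨_, ⟨rfl, rfl⟩, _, rfl⟩; exact ⟨rfl, by simp⟩
  · rwa [h.insert_eq hu]

theorem IsCounter.counterSet {L : LocalAlg V} {key : L.Row → Finset V}
    {T : RTree (Finset V)} {K : Finset V} {C : Finset (L.Row × Bool)} (h : L.IsCounter key T K C)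
    {a : V} (ha : a ∈ T.verts) : L.CounterSet key T K C := by
  rcases h with ⟨rfl, rfl⟩ | h
  · simp [RTree.verts] at ha
  · exact h

theorem Derives.snd {L : LocalAlg V} {key : L.Row → Finset V} {T : RTree (Finset V)} {u : L.Row}
    {b : Finset V × Finset V} (h : L.Derives (fun u => (L.ext u, key u)) T u b) :
    L.Derives key T u b.2 :=
  h.map Prod.snd fun _ _ => rfl

/-- Extension and key are recorded as a pair, so that `S` and `K` stem from the same choice of rows;
the counter-witnesses depend on that choice only through `K`. The converse is
`exists_maximize_derives`. -/
theorem exists_derives_of_maximize {L : LocalAlg V} {key : L.Row → Finset V}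
    (hk : L.Tracks key) {R : Finset (V × V)} {T : RTree (Finset V)} (hT : T.NiceDecomp R)
    {u : (L.maximize key).Row} {S : Finset V}
    (h : (L.maximize key).Derives (L.maximize key).ext T u S) :
    ∃ K, L.Derives (fun u => (L.ext u, key u)) T u.1 (S, K) ∧ L.IsCounter key T K u.2 := by
  induction hT generalizing u S with
  | leaf =>
    obtain ⟨rfl, rfl⟩ := h
    exact ⟨key L.leafRow, ⟨rfl, rfl⟩, Or.inl ⟨rfl, rfl⟩⟩
  | @introduce t a ht ha ih =>
    have har : a ∉ t.root := fun h => ha (t.root_subset_verts h)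
    obtain ⟨s, S, hs, hu, rfl⟩ := (derives_introduce har).1 h
    obtain ⟨K, hK, hC⟩ := ih hs
    obtain ⟨w, hw, rfl⟩ := Finset.mem_image.1 hu
    exact ⟨K ∪ key w, (derives_introduce har).2 ⟨s.1, _, hK, hw, rfl⟩,
      Or.inr (counterSet_introduce hk ht ha hK.snd (hC.counterSet_insert hK.snd) hw)⟩
  | @remove t a ht ha _ ih =>
    obtain ⟨s, S, hs, hu, rfl⟩ := (derives_remove ha).1 h
    obtain ⟨K, hK, hC⟩ := ih hs
    obtain ⟨w, hw, rfl⟩ := Finset.mem_image.1 hu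
    exact ⟨K ∪ key w, (derives_remove ha).2 ⟨s.1, _, hK, hw, rfl⟩,
      Or.inr (counterSet_remove hk ht ha hK.snd
        (hC.counterSet (t.root_subset_verts ha)) hw)⟩
  | @join t₁ t₂ ht₁ ht₂ hr h0 hi ih₁ ih₂ =>
    obtain ⟨s₁, s₂, S₁, S₂, h₁, h₂, hu, rfl⟩ := h
    obtain ⟨K₁, hK₁, hC₁⟩ := ih₁ h₁
    obtain ⟨K₂, hK₂, hC₂⟩ := ih₂ h₂
    obtain ⟨w, hw, rfl⟩ := Finset.mem_image.1 hu
    -- The nonempty join bag rules out leaves as children. Their empty counter sets would lose the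
    -- pair of the two witnesses.
    obtain ⟨a, ha⟩ := Finset.nonempty_iff_ne_empty.2 h0
    exact ⟨K₁ ∪ K₂, ⟨s₁.1, s₂.1, _, _, hK₁, hK₂, hw, rfl⟩,
      Or.inr (counterSet_join hk ht₁ ht₂ hr hi hK₁.snd hK₂.snd
        (hC₁.counterSet (t₁.root_subset_verts ha))
        (hC₂.counterSet (t₂.root_subset_verts (hr ▸ ha))) hw)⟩

theorem exists_maximize_derives {L : LocalAlg V} {key : L.Row → Finset V}
    (hk : L.Tracks key) {R : Finset (V × V)} {T : RTree (Finset V)} (hT : T.NiceDecomp R)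
    {w : L.Row} {S K : Finset V} (h : L.Derives (fun u => (L.ext u, key u)) T w (S, K)) :
    ∃ C, (L.maximize key).Derives (L.maximize key).ext T (w, C) S ∧ L.IsCounter key T K C := by
  induction hT generalizing w S K with
  | leaf =>
    obtain ⟨rfl, h⟩ := h
    obtain ⟨rfl, rfl⟩ := Prod.mk.inj h
    exact ⟨∅, ⟨rfl, rfl⟩, Or.inl ⟨rfl, rfl⟩⟩
  | @introduce t a ht ha ih =>
    have har : a ∉ t.root := fun h => ha (t.root_subset_verts h)
    obtain ⟨s, ⟨S, K⟩, hs, hu, h⟩ := (derives_introduce har).1 h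
    obtain ⟨rfl, rfl⟩ := Prod.mk.inj h
    obtain ⟨C, hd, hC⟩ := ih hs
    exact ⟨_, (derives_introduce har).2
        ⟨(s, C), S, hd, Finset.mem_image.2 ⟨w, hu, rfl⟩, rfl⟩,
      Or.inr (counterSet_introduce hk ht ha hs.snd (hC.counterSet_insert hs.snd) hu)⟩
  | @remove t a ht ha _ ih =>
    obtain ⟨s, ⟨S, K⟩, hs, hu, h⟩ := (derives_remove ha).1 h
    obtain ⟨rfl, rfl⟩ := Prod.mk.inj h
    obtain ⟨C, hd, hC⟩ := ih hs
    exact ⟨_, (derives_remove ha).2 ⟨(s, C), S, hd, Finset.mem_image.2 ⟨w, hu, rfl⟩, rfl⟩,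
      Or.inr (counterSet_remove hk ht ha hs.snd (hC.counterSet (t.root_subset_verts ha)) hu)⟩
  | @join t₁ t₂ ht₁ ht₂ hr h0 hi ih₁ ih₂ =>
    obtain ⟨s₁, s₂, ⟨S₁, K₁⟩, ⟨S₂, K₂⟩, h₁, h₂, hu, h⟩ := h
    obtain ⟨rfl, rfl⟩ := Prod.mk.inj h
    obtain ⟨C₁, hd₁, hC₁⟩ := ih₁ h₁
    obtain ⟨C₂, hd₂, hC₂⟩ := ih₂ h₂
    obtain ⟨a, ha⟩ := Finset.nonempty_iff_ne_empty.2 h0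
    exact ⟨_, ⟨(s₁, C₁), (s₂, C₂), S₁, S₂, hd₁, hd₂,
        Finset.mem_image.2 ⟨w, hu, rfl⟩, rfl⟩,
      Or.inr (counterSet_join hk ht₁ ht₂ hr hi h₁.snd h₂.snd
        (hC₁.counterSet (t₁.root_subset_verts ha))
        (hC₂.counterSet (t₂.root_subset_verts (hr ▸ ha))) hu)⟩

variable [Fintype V]

theorem mdpa_credulous {L : LocalAlg V} (hL : L.Tracks L.ext) (c : V) (P : Finset V)
    {R : Finset (V × V)} {T : RTree (Finset V)} (hT : T.NiceDecomp R)
    (hverts : T.verts = Finset.univ)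
    (hsub : ∀ u v S S', L.Derives L.ext T u S → L.Derives L.ext T v S' →
      L.accept u = true → L.accept v = true → u = v) :
    (L.credulous c).mdpa P T = Set.ncard {X | ∃ S,
      (∃ u, L.Derives L.ext T u S ∧ L.accept u = true) ∧ c ∈ S ∧ X = S ∩ P} := by
  have hd : ∀ (u : L.Row) (S : Finset V), (L.credulous c).Derives (L.credulous c).ext T u S ↔
      L.Derives L.ext T u S ∧ c ∈ S := fun u S => by
    refine (derives_credulous hL c hT).trans ?_
    simp [hverts]
  rw [mdpa_eq_ncard (hL.credulous c) P hT]
  · congr 1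
    ext X
    constructor
    · rintro ⟨S, ⟨u, hu, hacc⟩, rfl⟩
      obtain ⟨h1, h2⟩ := (hd u S).1 hu
      exact ⟨S, ⟨u, h1, hacc⟩, h2, rfl⟩
    · rintro ⟨S, ⟨u, hu, hacc⟩, hc, rfl⟩
      exact ⟨S, ⟨u, (hd u S).2 ⟨hu, hc⟩, hacc⟩, rfl⟩
  · intro u v S S' hu hv
    exact hsub u v S S' ((hd u S).1 hu).1 ((hd v S').1 hv).1

/-- The credulous condition filters witnesses only: the competing derivations of `v` are those of
`L` itself and need not contain `c`. -/
theorem mdpa_maximize {L : LocalAlg V} (hL : L.Tracks L.ext) {key : L.Row → Finset V}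
    (hk : L.Tracks key) (c : V) (P : Finset V)
    {R : Finset (V × V)} {T : RTree (Finset V)} (hT : T.NiceDecomp R)
    (hverts : T.verts = Finset.univ) (hacc : ∀ u, L.accept u = true)
    (hsub : ∀ u v K K', L.Derives key T u K → L.Derives key T v K' → u = v) :
    ((L.maximize key).credulous c).mdpa P T = Set.ncard {X | ∃ S,
      (∃ u K, L.Derives (fun u => (L.ext u, key u)) T u (S, K) ∧
        ∀ v K', L.Derives key T v K' → ¬ K ⊂ K') ∧ c ∈ S ∧ X = S ∩ P} := by
  have hcT : c ∈ T.verts := hverts ▸ Finset.mem_univ c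
  have hA : ∀ u : L.Row × Finset (L.Row × Bool), (L.maximize key).accept u = true ↔
      ∀ x ∈ u.2, x.2 = false := fun u => by
    change (L.accept u.1 && decide _) = true ↔ _
    rw [hacc, Bool.true_and, decide_eq_true_iff]
  rw [mdpa_credulous (hL.maximize key) c P hT hverts]
  · congr 1
    ext X
    refine exists_congr fun S => and_congr_left fun _ => ?_
    constructor
    · rintro ⟨u, hu, ha⟩
      obtain ⟨K, hK, hC⟩ := exists_derives_of_maximize hk hT hu
      refine ⟨u.1, K, hK, fun v K' hv hKK' => ?_⟩
      have := (hA u).1 ha (v, true) ((hC.counterSet hcT _).2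
        ⟨K', hv, hKK'.subset, by simpa using hKK'⟩)
      simp at this
    · rintro ⟨u, K, hK, hmax⟩
      obtain ⟨C, hd, hC⟩ := exists_maximize_derives hk hT hK
      refine ⟨(u, C), hd, (hA _).2 ?_⟩
      rintro x hx
      obtain ⟨K', hK', _, h⟩ := (hC.counterSet hcT _).1 hx
      rw [h, decide_eq_false_iff_not]
      exact hmax _ _ hK'
  -- Root rows of the maximizing algorithm may differ in their counter sets. For an accepted row no
  -- flag occurs and `L` has only one root row, so the counter set consists of the witness alone;
  -- hence accepted rows coincide.
  · have hform : ∀ (u : L.Row × Finset (L.Row × Bool)) S,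
        (L.maximize key).Derives (L.maximize key).ext T u S →
        (L.maximize key).accept u = true → (∃ K, L.Derives key T u.1 K) ∧
          u.2 = {(u.1, false)} := by
      intro u S hu ha
      obtain ⟨K, hK, hC⟩ := exists_derives_of_maximize hk hT hu
      refine ⟨⟨K, hK.snd⟩, ?_⟩
      have hC := hC.counterSet hcT
      ext ⟨v, σ⟩
      rw [Finset.mem_singleton]
      constructor
      · intro hx
        obtain ⟨K', hK', _, _⟩ := (hC _).1 hx
        exact Prod.ext (hsub _ _ _ _ hK' hK.snd) ((hA u).1 ha _ hx)
      · intro hx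
        rw [hx, ← hC.insert_eq hK.snd]
        exact Finset.mem_insert_self _ _
    intro u v S S' hu hv hu' hv'
    obtain ⟨⟨K, hK⟩, h1⟩ := hform u S hu hu'
    obtain ⟨⟨K', hK'⟩, h2⟩ := hform v S' hv hv'
    have h3 := hsub _ _ _ _ hK hK'
    refine Prod.ext h3 ?_
    rw [h1, h2, h3]

end LocalAlg

/-! ### How attacks accumulate along the decomposition. -/

section AttackSets

variable {V : Type u} [DecidableEq V]

theorem mem_attackersIn {R : Finset (V × V)} {S S' : Finset V} {x : V} :
    x ∈ attackersIn R S S' ↔ x ∈ S ∧ ∃ y ∈ S', (x, y) ∈ R := Finset.mem_filter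

theorem mem_attackedIn {R : Finset (V × V)} {S S' : Finset V} {x : V} :
    x ∈ attackedIn R S S' ↔ x ∈ S ∧ ∃ y ∈ S', (y, x) ∈ R := Finset.mem_filter

theorem attackersIn_eq_empty {R : Finset (V × V)} {S S' : Finset V} :
    attackersIn R S S' = ∅ ↔ ∀ x ∈ S, ∀ y ∈ S', (x, y) ∉ R := by
  simp only [Finset.eq_empty_iff_forall_notMem, mem_attackersIn]
  push Not
  exact forall₂_congr fun _ _ => Iff.rfl

theorem attackersIn_erase (R : Finset (V × V)) (S S' : Finset V) (a : V) :
    attackersIn R (S.erase a) S' = (attackersIn R S S').erase a := by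
  ext x; simp only [mem_attackersIn, Finset.mem_erase]; tauto

theorem attackedIn_erase (R : Finset (V × V)) (S S' : Finset V) (a : V) :
    attackedIn R (S.erase a) S' = (attackedIn R S S').erase a := by
  ext x; simp only [mem_attackedIn, Finset.mem_erase]; tauto

namespace RTree

variable {R : Finset (V × V)}

theorem mem_edges_one {X : Finset V} {t : RTree (Finset V)} {x y : V} :
    (x, y) ∈ (one X t).edges R ↔ ((x, y) ∈ R ∧ x ∈ X ∧ y ∈ X) ∨ (x, y) ∈ t.edges R := by
  simp [edges, Finset.mem_product]

theorem edges_remove (R : Finset (V × V)) (t : RTree (Finset V)) (a : V) :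
    (one (t.root.erase a) t).edges R = t.edges R := by
  ext ⟨x, y⟩
  rw [mem_edges_one]
  refine ⟨?_, Or.inr⟩
  rintro (⟨h, hx, hy⟩ | h)
  · exact mem_edges_of_mem_root h (Finset.mem_of_mem_erase hx) (Finset.mem_of_mem_erase hy)
  · exact h

theorem edges_join (R : Finset (V × V)) (t₁ t₂ : RTree (Finset V)) :
    (two t₁.root t₁ t₂).edges R = t₁.edges R ∪ t₂.edges R := by
  rw [edges]
  refine Finset.union_eq_right.2 (Finset.Subset.trans ?_ Finset.subset_union_left)
  rintro ⟨x, y⟩ h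
  simp only [Finset.mem_inter, Finset.mem_product] at h
  exact mem_edges_of_mem_root h.1 h.2.1 h.2.2

/-- Each covered attack lies in the new bag or in the old subtree. The separate set `A'`
accommodates both whole bags, as in ADM, and bags cut down to one guessed colour, as in COMP. -/
theorem attackedIn_introduce {t : RTree (Finset V)} {X A A' B : Finset V}
    (hA : ∀ x ∈ t.verts, x ∈ A → x ∈ A') (hA' : A' ⊆ A) :
    attackedIn ((one X t).edges R) A B =
      attackedIn (t.edges R) A' (B ∩ t.verts) ∪ attackedIn (R ∩ X ×ˢ X) A (B ∩ X) := by
  ext x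
  simp only [mem_attackedIn, mem_edges_one, Finset.mem_union, Finset.mem_inter,
    Finset.mem_product]
  constructor
  · rintro ⟨h1, y, hy, ⟨h, h3, h4⟩ | h⟩
    · exact Or.inr ⟨h1, y, ⟨hy, h3⟩, h, h3, h4⟩
    · obtain ⟨h3, h4⟩ := mem_verts_of_mem_edges h
      exact Or.inl ⟨hA x h4 h1, y, ⟨hy, h3⟩, h⟩
  · rintro (⟨h1, y, ⟨hy, _⟩, h⟩ | ⟨h1, y, ⟨hy, _⟩, h⟩)
    · exact ⟨hA' h1, y, hy, Or.inr h⟩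
    · exact ⟨h1, y, hy, Or.inl h⟩

theorem attackersIn_introduce {t : RTree (Finset V)} {X A A' B : Finset V}
    (hA : ∀ x ∈ t.verts, x ∈ A → x ∈ A') (hA' : A' ⊆ A) :
    attackersIn ((one X t).edges R) A B =
      attackersIn (t.edges R) A' (B ∩ t.verts) ∪ attackersIn (R ∩ X ×ˢ X) A (B ∩ X) := by
  ext x
  simp only [mem_attackersIn, mem_edges_one, Finset.mem_union, Finset.mem_inter,
    Finset.mem_product]
  constructor
  · rintro ⟨h1, y, hy, ⟨h, h3, h4⟩ | h⟩
    · exact Or.inr ⟨h1, y, ⟨hy, h4⟩, h, h3, h4⟩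
    · obtain ⟨h3, h4⟩ := mem_verts_of_mem_edges h
      exact Or.inl ⟨hA x h3 h1, y, ⟨hy, h4⟩, h⟩
  · rintro (⟨h1, y, ⟨hy, _⟩, h⟩ | ⟨h1, y, ⟨hy, _⟩, h⟩)
    · exact ⟨hA' h1, y, hy, Or.inr h⟩
    · exact ⟨h1, y, hy, Or.inl h⟩

theorem attackedIn_join {t₁ t₂ : RTree (Finset V)} {A A₁ A₂ B : Finset V}
    (h₁ : ∀ x ∈ t₁.verts, x ∈ A ↔ x ∈ A₁) (h₂ : ∀ x ∈ t₂.verts, x ∈ A ↔ x ∈ A₂) :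
    attackedIn ((two t₁.root t₁ t₂).edges R) A B =
      attackedIn (t₁.edges R) A₁ (B ∩ t₁.verts) ∪ attackedIn (t₂.edges R) A₂ (B ∩ t₂.verts) := by
  ext x
  simp only [mem_attackedIn, edges_join, Finset.mem_union, Finset.mem_inter]
  constructor
  · rintro ⟨hx, y, hy, h | h⟩
    · obtain ⟨h3, h4⟩ := mem_verts_of_mem_edges h
      exact Or.inl ⟨(h₁ x h4).1 hx, y, ⟨hy, h3⟩, h⟩
    · obtain ⟨h3, h4⟩ := mem_verts_of_mem_edges h
      exact Or.inr ⟨(h₂ x h4).1 hx, y, ⟨hy, h3⟩, h⟩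
  · rintro (⟨hx, y, ⟨hy, _⟩, h⟩ | ⟨hx, y, ⟨hy, _⟩, h⟩)
    · exact ⟨(h₁ x (mem_verts_of_mem_edges h).2).2 hx, y, hy, Or.inl h⟩
    · exact ⟨(h₂ x (mem_verts_of_mem_edges h).2).2 hx, y, hy, Or.inr h⟩

theorem attackersIn_join {t₁ t₂ : RTree (Finset V)} {A A₁ A₂ B : Finset V}
    (h₁ : ∀ x ∈ t₁.verts, x ∈ A ↔ x ∈ A₁) (h₂ : ∀ x ∈ t₂.verts, x ∈ A ↔ x ∈ A₂) :
    attackersIn ((two t₁.root t₁ t₂).edges R) A B =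
      attackersIn (t₁.edges R) A₁ (B ∩ t₁.verts) ∪
        attackersIn (t₂.edges R) A₂ (B ∩ t₂.verts) := by
  ext x
  simp only [mem_attackersIn, edges_join, Finset.mem_union, Finset.mem_inter]
  constructor
  · rintro ⟨hx, y, hy, h | h⟩
    · obtain ⟨h3, h4⟩ := mem_verts_of_mem_edges h
      exact Or.inl ⟨(h₁ x h3).1 hx, y, ⟨hy, h4⟩, h⟩
    · obtain ⟨h3, h4⟩ := mem_verts_of_mem_edges h
      exact Or.inr ⟨(h₂ x h3).1 hx, y, ⟨hy, h4⟩, h⟩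
  · rintro (⟨hx, y, ⟨hy, _⟩, h⟩ | ⟨hx, y, ⟨hy, _⟩, h⟩)
    · exact ⟨(h₁ x (mem_verts_of_mem_edges h).1).2 hx, y, hy, Or.inl h⟩
    · exact ⟨(h₂ x (mem_verts_of_mem_edges h).1).2 hx, y, hy, Or.inr h⟩

end RTree

end AttackSets

/-! ### Locally checkable colourings -/

/-- A property of families of sets of vertices that can be checked locally. The colour of a vertex
tells in which of the sets it lies; `node` and `edge` restrict the colours of vertices and
attacks, and `goal` restricts a vertex by its colour, and by which sets it is attacked and which
sets it attacks. -/
structure ColorSpec (ι : Type) where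
  node : (ι → Prop) → Prop
  edge : (ι → Prop) → (ι → Prop) → Prop
  goal : (ι → Prop) → (ι → Prop) → (ι → Prop) → Prop

namespace ColorSpec

variable {V : Type u} {ι : Type}

def color (b : ι → Finset V) (x : V) : ι → Prop := fun i => x ∈ b i

def attackedBy (E : Finset (V × V)) (b : ι → Finset V) (x : V) : ι → Prop :=
  fun i => ∃ y ∈ b i, (y, x) ∈ E

def attacks (E : Finset (V × V)) (b : ι → Finset V) (x : V) : ι → Prop :=
  fun i => ∃ y ∈ b i, (x, y) ∈ E

variable [DecidableEq V]

def restrict (b : ι → Finset V) (X : Finset V) : ι → Finset V := fun i => b i ∩ X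

/-- The family `b` satisfies the constraints in the part of the graph covered by `T`, except that
the goals of the vertices in the root bag need not be reached yet. -/
structure Valid (C : ColorSpec ι) (R : Finset (V × V)) (T : RTree (Finset V))
    (b : ι → Finset V) : Prop where
  subset : ∀ i, b i ⊆ T.verts
  node : ∀ x ∈ T.verts, C.node (color b x)
  edge : ∀ x y, (x, y) ∈ T.edges R → C.edge (color b x) (color b y)
  goal : ∀ x ∈ T.verts, x ∉ T.root →
    C.goal (color b x) (attackedBy (T.edges R) b x) (attacks (T.edges R) b x)

theorem color_restrict {b : ι → Finset V} {X : Finset V} {x : V} (hx : x ∈ X) :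
    color (restrict b X) x = color b x := by
  funext i
  simp [color, restrict, hx]

theorem attackedBy_restrict {E E' : Finset (V × V)} {b : ι → Finset V} {X : Finset V} {x : V}
    (h : ∀ y, (y, x) ∈ E' ↔ (y, x) ∈ E ∧ y ∈ X) (h' : ∀ y, (y, x) ∈ E → y ∈ X) :
    attackedBy E' (restrict b X) x = attackedBy E b x := by
  funext i
  simp only [attackedBy, restrict, h, Finset.mem_inter, eq_iff_iff]
  exact exists_congr fun y => ⟨fun h => ⟨h.1.1, h.2.1⟩, fun h => ⟨⟨h.1, h' y h.2⟩, h.2, h' y h.2⟩⟩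

theorem attacks_restrict {E E' : Finset (V × V)} {b : ι → Finset V} {X : Finset V} {x : V}
    (h : ∀ y, (x, y) ∈ E' ↔ (x, y) ∈ E ∧ y ∈ X) (h' : ∀ y, (x, y) ∈ E → y ∈ X) :
    attacks E' (restrict b X) x = attacks E b x := by
  funext i
  simp only [attacks, restrict, h, Finset.mem_inter, eq_iff_iff]
  exact exists_congr fun y => ⟨fun h => ⟨h.1.1, h.2.1⟩, fun h => ⟨⟨h.1, h' y h.2⟩, h.2, h' y h.2⟩⟩

/-- If all edges of `E` at `x` belong to the part covered by `t`, then the goal for `x` can be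
checked there. -/
theorem goal_restrict (C : ColorSpec ι) {R E : Finset (V × V)} {t : RTree (Finset V)}
    {b : ι → Finset V} {x : V} (hx : x ∈ t.verts) (hE : t.edges R ⊆ E)
    (h₁ : ∀ y, (x, y) ∈ E → (x, y) ∈ t.edges R) (h₂ : ∀ y, (y, x) ∈ E → (y, x) ∈ t.edges R) :
    C.goal (color (restrict b t.verts) x) (attackedBy (t.edges R) (restrict b t.verts) x)
      (attacks (t.edges R) (restrict b t.verts) x) ↔
    C.goal (color b x) (attackedBy E b x) (attacks E b x) := by
  rw [color_restrict hx, attackedBy_restrict (E := E), attacks_restrict (E := E)]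
  · exact fun y => ⟨fun h => ⟨hE h, (RTree.mem_verts_of_mem_edges h).2⟩, fun h => h₁ y h.1⟩
  · exact fun y h => (RTree.mem_verts_of_mem_edges (h₁ y h)).2
  · exact fun y => ⟨fun h => ⟨hE h, (RTree.mem_verts_of_mem_edges h).1⟩, fun h => h₂ y h.1⟩
  · exact fun y h => (RTree.mem_verts_of_mem_edges (h₂ y h)).1

/-- A vertex that left the bag earlier cannot be in the new bag, so it gets no new attacks and its
goal is unaffected. Only the constraints inside the new bag have to be checked. -/
theorem valid_introduce (C : ColorSpec ι) {R : Finset (V × V)} {t : RTree (Finset V)} {a : V}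
    {b : ι → Finset V} (ha : a ∉ t.verts)
    (hb : ∀ i, b i ⊆ (RTree.one (insert a t.root) t).verts) :
    C.Valid R (.one (insert a t.root) t) b ↔ C.Valid R t (restrict b t.verts) ∧
      (∀ x ∈ insert a t.root, C.node (color b x)) ∧
      ∀ x ∈ insert a t.root, ∀ y ∈ insert a t.root, (x, y) ∈ R →
        C.edge (color b x) (color b y) := by
  have hinner : ∀ x ∈ t.verts, x ∉ t.root → x ∉ insert a t.root := by
    intro x hx hxr h
    rcases Finset.mem_insert.1 h with rfl | h
    · exact ha hx
    · exact hxr h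
  have hgoal : ∀ x ∈ t.verts, x ∉ t.root → _ := fun x hx hxr =>
    C.goal_restrict (b := b) (R := R) (E := (RTree.one (insert a t.root) t).edges R) hx
      (fun e he => Finset.mem_union_right _ he)
      (fun y h => (RTree.mem_edges_one.1 h).resolve_left fun h' => hinner x hx hxr h'.2.1)
      (fun y h => (RTree.mem_edges_one.1 h).resolve_left fun h' => hinner x hx hxr h'.2.2)
  constructor
  · intro h
    refine ⟨⟨fun i => Finset.inter_subset_right, fun x hx => ?_, fun x y hxy => ?_,
      fun x hx hxr => ?_⟩, fun x hx => ?_, fun x hx y hy hxy => ?_⟩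
    · rw [color_restrict hx]
      exact h.node x (Finset.mem_union_right _ hx)
    · obtain ⟨hx, hy⟩ := RTree.mem_verts_of_mem_edges hxy
      rw [color_restrict hx, color_restrict hy]
      exact h.edge x y (RTree.mem_edges_one.2 (Or.inr hxy))
    · exact (hgoal x hx hxr).2 (h.goal x (Finset.mem_union_right _ hx) (hinner x hx hxr))
    · exact h.node x (Finset.mem_union_left _ hx)
    · exact h.edge x y (RTree.mem_edges_one.2 (Or.inl ⟨hxy, hx, hy⟩))
  · rintro ⟨h, hn, he⟩
    refine ⟨hb, fun x hx => ?_, fun x y hxy => ?_, fun x hx hxr => ?_⟩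
    · rcases Finset.mem_union.1 hx with hx | hx
      · exact hn x hx
      · have := h.node x hx
        rwa [color_restrict hx] at this
    · rcases RTree.mem_edges_one.1 hxy with ⟨hxy, hx, hy⟩ | hxy
      · exact he x hx y hy hxy
      · obtain ⟨hx, hy⟩ := RTree.mem_verts_of_mem_edges hxy
        have := h.edge x y hxy
        rwa [color_restrict hx, color_restrict hy] at this
    · have hx : x ∈ t.verts := (Finset.mem_union.1 hx).resolve_left hxr
      have hxr : x ∉ t.root := fun h => hxr (Finset.mem_insert_of_mem h)
      exact (hgoal x hx hxr).1 (h.goal x hx hxr)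

theorem verts_remove (t : RTree (Finset V)) (a : V) :
    (RTree.one (t.root.erase a) t).verts = t.verts :=
  Finset.union_eq_right.2 ((Finset.erase_subset _ _).trans t.root_subset_verts)

theorem verts_join (t₁ t₂ : RTree (Finset V)) :
    (RTree.two t₁.root t₁ t₂).verts = t₁.verts ∪ t₂.verts :=
  Finset.union_eq_right.2 (t₁.root_subset_verts.trans Finset.subset_union_left)

/-- Vertices and covered attacks stay the same; the goal of `a`, no longer in the bag, is the only
additional demand. -/
theorem valid_remove (C : ColorSpec ι) {R : Finset (V × V)} {t : RTree (Finset V)} {a : V}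
    {b : ι → Finset V} (ha : a ∈ t.root) :
    C.Valid R (.one (t.root.erase a) t) b ↔ C.Valid R t b ∧
      C.goal (color b a) (attackedBy (t.edges R) b a) (attacks (t.edges R) b a) := by
  constructor
  · rintro ⟨h1, h2, h3, h4⟩
    rw [verts_remove] at *
    rw [RTree.edges_remove] at *
    exact ⟨⟨h1, h2, h3, fun x hx hxr => h4 x hx fun h => hxr (Finset.mem_of_mem_erase h)⟩,
      h4 a (t.root_subset_verts ha) (Finset.notMem_erase _ _)⟩
  · rintro ⟨⟨h1, h2, h3, h4⟩, h⟩
    refine ⟨?_, ?_, ?_, ?_⟩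
    · rwa [verts_remove]
    · rwa [verts_remove]
    · rwa [RTree.edges_remove]
    · rw [verts_remove, RTree.edges_remove]
      intro x hx hxr
      by_cases hxa : x = a
      · rwa [hxa]
      · exact h4 x hx fun h => hxr (Finset.mem_erase.2 ⟨hxa, h⟩)

/-- A vertex forgotten in one branch does not occur in the other, as it would then lie in the join
bag. All its covered attacks are on its own side, where its goal was checked. -/
theorem valid_join (C : ColorSpec ι) {R : Finset (V × V)} {t₁ t₂ : RTree (Finset V)}
    {b : ι → Finset V} (hr : t₂.root = t₁.root) (hi : t₁.verts ∩ t₂.verts ⊆ t₁.root)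
    (hb : ∀ i, b i ⊆ (RTree.two t₁.root t₁ t₂).verts) :
    C.Valid R (.two t₁.root t₁ t₂) b ↔
      C.Valid R t₁ (restrict b t₁.verts) ∧ C.Valid R t₂ (restrict b t₂.verts) := by
  have hgoal₁ : ∀ x ∈ t₁.verts, x ∉ t₁.root → _ := fun x hx hxr =>
    C.goal_restrict (b := b) (R := R) (E := t₁.edges R ∪ t₂.edges R) hx
      Finset.subset_union_left
      (fun y h => (Finset.mem_union.1 h).resolve_right fun h' => hxr
        (hi (Finset.mem_inter.2 ⟨hx, (RTree.mem_verts_of_mem_edges h').1⟩)))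
      (fun y h => (Finset.mem_union.1 h).resolve_right fun h' => hxr
        (hi (Finset.mem_inter.2 ⟨hx, (RTree.mem_verts_of_mem_edges h').2⟩)))
  have hgoal₂ : ∀ x ∈ t₂.verts, x ∉ t₁.root → _ := fun x hx hxr =>
    C.goal_restrict (b := b) (R := R) (E := t₁.edges R ∪ t₂.edges R) hx
      Finset.subset_union_right
      (fun y h => (Finset.mem_union.1 h).resolve_left fun h' => hxr
        (hi (Finset.mem_inter.2 ⟨(RTree.mem_verts_of_mem_edges h').1, hx⟩)))
      (fun y h => (Finset.mem_union.1 h).resolve_left fun h' => hxr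
        (hi (Finset.mem_inter.2 ⟨(RTree.mem_verts_of_mem_edges h').2, hx⟩)))
  constructor
  · rintro ⟨h1, h2, h3, h4⟩
    rw [verts_join, RTree.root_two, RTree.edges_join] at *
    refine ⟨⟨fun i => Finset.inter_subset_right, fun x hx => ?_, fun x y hxy => ?_,
      fun x hx hxr => ?_⟩, fun i => Finset.inter_subset_right, fun x hx => ?_,
      fun x y hxy => ?_, fun x hx hxr => ?_⟩
    · rw [color_restrict hx]
      exact h2 x (Finset.mem_union_left _ hx)
    · obtain ⟨hx, hy⟩ := RTree.mem_verts_of_mem_edges hxy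
      rw [color_restrict hx, color_restrict hy]
      exact h3 x y (Finset.mem_union_left _ hxy)
    · exact (hgoal₁ x hx hxr).2 (h4 x (Finset.mem_union_left _ hx) hxr)
    · rw [color_restrict hx]
      exact h2 x (Finset.mem_union_right _ hx)
    · obtain ⟨hx, hy⟩ := RTree.mem_verts_of_mem_edges hxy
      rw [color_restrict hx, color_restrict hy]
      exact h3 x y (Finset.mem_union_right _ hxy)
    · rw [hr] at hxr
      exact (hgoal₂ x hx hxr).2 (h4 x (Finset.mem_union_right _ hx) hxr)
  · rintro ⟨h, h'⟩
    refine ⟨hb, ?_, ?_, ?_⟩ <;> rw [verts_join] at * <;> (try rw [RTree.edges_join])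
    · intro x hx
      rcases Finset.mem_union.1 hx with hx | hx
      · have := h.node x hx
        rwa [color_restrict hx] at this
      · have := h'.node x hx
        rwa [color_restrict hx] at this
    · intro x y hxy
      rcases Finset.mem_union.1 hxy with hxy | hxy
      · obtain ⟨hx, hy⟩ := RTree.mem_verts_of_mem_edges hxy
        have := h.edge x y hxy
        rwa [color_restrict hx, color_restrict hy] at this
      · obtain ⟨hx, hy⟩ := RTree.mem_verts_of_mem_edges hxy
        have := h'.edge x y hxy
        rwa [color_restrict hx, color_restrict hy] at this
    · intro x hx hxr
      rw [RTree.root_two] at hxr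
      rcases Finset.mem_union.1 hx with hx | hx
      · exact (hgoal₁ x hx hxr).1 (h.goal x hx hxr)
      · exact (hgoal₂ x hx hxr).1 (h'.goal x hx (hr ▸ hxr))

/-- The local algorithm `L` constructs the valid families of `C`: the component `f` of a row is
the part of the family in the bag, and `row T b` is the row at the root of `T` that belongs to
the family `b`. -/
structure Implements (L : LocalAlg V) (C : ColorSpec ι) (R : Finset (V × V))
    (f : L.Row → ι → Finset V) (row : RTree (Finset V) → (ι → Finset V) → L.Row) : Prop where
  tracks : ∀ i, L.Tracks fun u => f u i
  map_row : ∀ T b, f (row T b) = restrict b T.root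
  leaf : row (.leaf ∅) (fun _ => ∅) = L.leafRow
  introduce : ∀ t a b, a ∉ t.verts → (∀ i, b i ⊆ (RTree.one (insert a t.root) t).verts) →
    ∀ u, (u ∈ L.introduce (insert a t.root) a (row t (restrict b t.verts)) ∧
      f u = restrict b (insert a t.root)) ↔
      (∀ x ∈ insert a t.root, C.node (color b x)) ∧
      (∀ x ∈ insert a t.root, ∀ y ∈ insert a t.root, (x, y) ∈ R →
        C.edge (color b x) (color b y)) ∧
      u = row (.one (insert a t.root) t) b
  remove : ∀ t a b, a ∈ t.root → ∀ u, u ∈ L.remove a (row t b) ↔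
    C.goal (color b a) (attackedBy (t.edges R) b a) (attacks (t.edges R) b a) ∧
      u = row (.one (t.root.erase a) t) b
  join : ∀ t₁ t₂ b, t₂.root = t₁.root → t₁.verts ∩ t₂.verts ⊆ t₁.root →
    ∀ u, u ∈ L.join (row t₁ (restrict b t₁.verts)) (row t₂ (restrict b t₂.verts)) ↔
      u = row (.two t₁.root t₁ t₂) b

/-- A derivation can be recovered from the family it collects: restricting the family to the
vertices of each subtree determines all rows. Introducing is the only step with several outcomes,
and the trace on the bag selects the one belonging to `b`. -/
theorem Implements.derives_iff {L : LocalAlg V} {C : ColorSpec ι} {R : Finset (V × V)}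
    {f : L.Row → ι → Finset V} {row : RTree (Finset V) → (ι → Finset V) → L.Row}
    (h : Implements L C R f row) {T : RTree (Finset V)} (hT : T.NiceDecomp R) {u : L.Row}
    {b : ι → Finset V} : L.Derives f T u b ↔ C.Valid R T b ∧ u = row T b := by
  have htr : ∀ {T : RTree (Finset V)}, T.NiceDecomp R → ∀ {u b}, L.Derives f T u b →
      ∀ i, b i ⊆ T.verts ∧ f u i = b i ∩ T.root := fun hT _ _ hd i =>
    (h.tracks i).subset_and_inter hT (hd.map (fun b => b i) fun _ _ => rfl)
  induction hT generalizing u b with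
  | leaf =>
    have hf : f L.leafRow = fun _ => ∅ := funext fun i => (h.tracks i).leafRow
    constructor
    · rintro ⟨rfl, rfl⟩
      rw [hf]
      exact ⟨⟨fun _ => subset_rfl, by simp [RTree.verts], by simp [RTree.edges],
        by simp [RTree.verts]⟩, h.leaf.symm⟩
    · rintro ⟨hv, rfl⟩
      obtain rfl : b = fun _ => ∅ := funext fun i => Finset.subset_empty.1 (hv.subset i)
      exact ⟨h.leaf, hf.symm⟩
  | @introduce t a ht ha ih =>
    have har : a ∉ t.root := fun h => ha (t.root_subset_verts h)
    constructor
    · intro hd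
      have hsub := fun i => (htr (.introduce ht ha) hd i).1
      have hfu : f u = restrict b (insert a t.root) :=
        funext fun i => (htr (.introduce ht ha) hd i).2
      obtain ⟨s, b', hs, hu, rfl⟩ := (derives_introduce har).1 hd
      obtain ⟨hv, rfl⟩ := ih.1 hs
      -- The new row can add only `a` to the collected sets, and `a` is not in `t.verts`.
      have hb' : restrict (b' ⊔ f u) t.verts = b' := by
        funext i
        have h1 := hv.subset i
        have h2 := (h.tracks i).introduce _ _ _ _ hu
        simp only [h.map_row, restrict] at h2
        change (b' i ∪ f u i) ∩ t.verts = b' i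
        ext x
        have h3 := @h1 x
        have h4 : x = a → x ∉ t.verts := fun h => h ▸ ha
        simp only [Finset.mem_inter, Finset.mem_union]
        rcases h2 with h2 | h2 <;> rw [h2] <;>
          simp only [Finset.mem_inter, Finset.mem_insert] <;> tauto
      have hb := (h.introduce t a _ ha hsub u).1 ⟨by rwa [hb'], hfu⟩
      exact ⟨(C.valid_introduce ha hsub).2 ⟨by rwa [hb'], hb.1, hb.2.1⟩, hb.2.2⟩
    · rintro ⟨hv, rfl⟩
      obtain ⟨hv', hn, he⟩ := (C.valid_introduce ha hv.subset).1 hv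
      obtain ⟨hu, hf⟩ := (h.introduce t a b ha hv.subset _).2 ⟨hn, he, rfl⟩
      refine (derives_introduce har).2 ⟨_, _, ih.2 ⟨hv', rfl⟩, hu, ?_⟩
      rw [hf]
      funext i
      change b i = b i ∩ t.verts ∪ b i ∩ insert a t.root
      rw [← Finset.inter_union_distrib_left, Finset.union_comm]
      exact (Finset.inter_eq_left.2 (hv.subset i)).symm
  | @remove t a ht ha _ ih =>
    have hsup : ∀ b, C.Valid R t b → b ⊔ f (row (.one (t.root.erase a) t) b) = b := by
      intro b _
      rw [h.map_row]
      funext i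
      exact Finset.union_eq_left.2 Finset.inter_subset_left
    constructor
    · intro hd
      obtain ⟨s, b', hs, hu, rfl⟩ := (derives_remove ha).1 hd
      obtain ⟨hv, rfl⟩ := ih.1 hs
      obtain ⟨hg, rfl⟩ := (h.remove t a b' ha u).1 hu
      rw [hsup b' hv]
      exact ⟨(C.valid_remove ha).2 ⟨hv, hg⟩, rfl⟩
    · rintro ⟨hv, rfl⟩
      obtain ⟨hv', hg⟩ := (C.valid_remove ha).1 hv
      exact (derives_remove ha).2 ⟨_, b, ih.2 ⟨hv', rfl⟩,
        (h.remove t a b ha _).2 ⟨hg, rfl⟩, (hsup b hv').symm⟩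
  | @join t₁ t₂ ht₁ ht₂ hr h0 hi ih₁ ih₂ =>
    constructor
    · intro hd
      have hsub := fun i => (htr (.join ht₁ ht₂ hr h0 hi) hd i).1
      obtain ⟨s₁, s₂, b₁, b₂, h₁, h₂, hu, rfl⟩ := hd
      have hf : ∀ i, b₂ i ∩ t₁.root = b₁ i ∩ t₁.root := by
        intro i
        obtain ⟨h3, h4⟩ := (h.tracks i).join _ _ _ hu
        rw [← (htr ht₁ h₁ i).2, ← h3, h4, (htr ht₂ h₂ i).2, hr]
      -- Both families have the same trace on the join bag, so each is the restriction of the glued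
      -- family.
      have hb₁ : restrict (b₁ ⊔ b₂) t₁.verts = b₁ := funext fun i =>
        union_inter_eq_left (htr ht₁ h₁ i).1 (htr ht₂ h₂ i).1 hi (hf i)
      have hb₂ : restrict (b₁ ⊔ b₂) t₂.verts = b₂ := funext fun i => by
        change (b₁ i ∪ b₂ i) ∩ t₂.verts = b₂ i
        rw [Finset.union_comm]
        exact union_inter_eq_left (htr ht₂ h₂ i).1 (htr ht₁ h₁ i).1
          (by rwa [Finset.inter_comm]) (hf i).symm
      obtain ⟨hv₁, rfl⟩ := ih₁.1 h₁
      obtain ⟨hv₂, rfl⟩ := ih₂.1 h₂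
      refine ⟨(C.valid_join hr hi hsub).2 ⟨by rwa [hb₁], by rwa [hb₂]⟩,
        (h.join t₁ t₂ _ hr hi u).1 ?_⟩
      rwa [hb₁, hb₂]
    · rintro ⟨hv, rfl⟩
      obtain ⟨hv₁, hv₂⟩ := (C.valid_join hr hi hv.subset).1 hv
      refine ⟨_, _, _, _, ih₁.2 ⟨hv₁, rfl⟩, ih₂.2 ⟨hv₂, rfl⟩,
        (h.join t₁ t₂ b hr hi _).2 rfl, ?_⟩
      funext i
      change b i = b i ∩ t₁.verts ∪ b i ∩ t₂.verts
      rw [← Finset.inter_union_distrib_left, ← verts_join]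
      exact (Finset.inter_eq_left.2 (hv.subset i)).symm

end ColorSpec

open ColorSpec

/-! ### Translating set conditions in a bag into conditions on vertices and attacks. -/

section BagSets

variable {V : Type u} [DecidableEq V] {R : Finset (V × V)}

theorem attackersIn_bag_eq_empty {X A B : Finset V} :
    attackersIn (R ∩ X ×ˢ X) (A ∩ X) (B ∩ X) = ∅ ↔
      ∀ x ∈ X, ∀ y ∈ X, (x, y) ∈ R → ¬(x ∈ A ∧ y ∈ B) := by
  simp only [attackersIn_eq_empty, Finset.mem_inter, Finset.mem_product]
  exact ⟨fun h x hx y hy hxy hAB => h x ⟨hAB.1, hx⟩ y ⟨hAB.2, hy⟩ ⟨hxy, hx, hy⟩,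
    fun h x hx y hy hxy => h x hx.2 y hy.2 hxy.1 ⟨hx.1, hy.1⟩⟩

theorem attackedIn_bag_subset {X A B : Finset V} :
    attackedIn (R ∩ X ×ˢ X) X (B ∩ X) ⊆ A ∩ X ↔
      ∀ x ∈ X, ∀ y ∈ X, (x, y) ∈ R → x ∈ B → y ∈ A := by
  simp only [Finset.subset_iff, mem_attackedIn, Finset.mem_inter, Finset.mem_product]
  exact ⟨fun h x hx y hy hxy hB => (h ⟨hy, x, ⟨hB, hx⟩, hxy, hx, hy⟩).1,
    fun h y ⟨hy, x, hx, hxy⟩ => ⟨h x hx.2 y hy hxy.1 hx.1, hy⟩⟩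

theorem bag_inter_eq_empty {X A B : Finset V} :
    (A ∩ X) ∩ (B ∩ X) = ∅ ↔ ∀ x ∈ X, ¬(x ∈ A ∧ x ∈ B) := by
  simp only [Finset.eq_empty_iff_forall_notMem, Finset.mem_inter]
  exact ⟨fun h x hx hAB => h x ⟨⟨hAB.1, hx⟩, hAB.2, hx⟩,
    fun h x hx => h x hx.1.2 ⟨hx.1.1, hx.2.1⟩⟩

theorem mem_ite_singleton {α : Type u} {p : Prop} [Decidable p] {x y : α} :
    x ∈ (if p then {y} else ∅ : Finset α) ↔ p ∧ x = y := by
  split_ifs with h <;> simp [h]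

namespace RTree

variable {t t₁ t₂ : RTree (Finset V)} {a : V}

theorem inter_insert_root_mem (t : RTree (Finset V)) (a : V) (B : Finset V) :
    B ∩ insert a t.root ∈
      ({B ∩ t.verts ∩ t.root, insert a (B ∩ t.verts ∩ t.root)} : Finset (Finset V)) := by
  rw [Finset.inter_assoc, Finset.inter_eq_right.2 t.root_subset_verts, Finset.mem_insert,
    Finset.mem_singleton]
  by_cases h : a ∈ B
  · exact Or.inr (by rw [Finset.inter_insert_of_mem h])
  · exact Or.inl (by rw [Finset.inter_insert_of_notMem h])

theorem mem_root_of_mem_insert (ha : a ∉ t.verts) :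
    ∀ x ∈ t.verts, x ∈ insert a t.root → x ∈ t.root := by
  intro x hx h
  rcases Finset.mem_insert.1 h with rfl | h
  · exact absurd hx ha
  · exact h

theorem mem_inter_root_of_mem_insert (ha : a ∉ t.verts) (B : Finset V) :
    ∀ x ∈ t.verts, x ∈ B ∩ insert a t.root → x ∈ B ∩ t.verts ∩ t.root := by
  intro x hx h
  simp only [Finset.mem_inter] at h ⊢
  exact ⟨⟨h.1, hx⟩, mem_root_of_mem_insert ha x hx h.2⟩

theorem inter_root_subset_insert (B : Finset V) :
    B ∩ t.verts ∩ t.root ⊆ B ∩ insert a t.root :=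
  Finset.inter_subset_inter Finset.inter_subset_left (Finset.subset_insert _ _)

theorem inter_verts_inter_root (t : RTree (Finset V)) (B : Finset V) :
    B ∩ t.verts ∩ t.root = B ∩ t.root := by
  rw [Finset.inter_assoc, Finset.inter_eq_right.2 t.root_subset_verts]

theorem inter_verts_inter_root_of_eq (hr : t₂.root = t₁.root) (B : Finset V) :
    B ∩ t₂.verts ∩ t₁.root = B ∩ t₁.root := by
  rw [← hr, inter_verts_inter_root]

theorem inter_verts_iff (t : RTree (Finset V)) (B X : Finset V) :
    ∀ x ∈ t.verts, x ∈ B ∩ X ↔ x ∈ B ∩ t.verts ∩ X := by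
  intro x hx
  simp [hx]

theorem inter_erase_root (B X : Finset V) (a : V) : B ∩ X.erase a = (B ∩ X).erase a :=
  Finset.inter_erase _ _ _

end RTree

end BagSets

namespace AF

variable {V : Type u} [DecidableEq V] (F : AF V)

theorem tracks_extend {L : LocalAlg V} (f : L.Row → Finset V) (h₁ : f L.leafRow = ∅)
    (h₂ : ∀ X a u, ∀ v ∈ L.introduce X a u, f v ∈ ({f u, insert a (f u)} : Finset (Finset V)))
    (h₃ : ∀ a u, ∀ v ∈ L.remove a u, f v = (f u).erase a)
    (h₄ : ∀ u₁ u₂, ∀ v ∈ L.join u₁ u₂, f v = f u₁ ∧ f v = f u₂) : L.Tracks f :=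
  ⟨h₁, fun X a u v hv => by simpa using h₂ X a u v hv, h₃, h₄⟩

/-! ### Admissible sets -/

theorem mem_admBase_introduce {X : Finset V} {a : V} {u v : AdmRow V} :
    v ∈ F.admBase.introduce X a u ↔ v.I ∈ ({u.I, insert a u.I} : Finset (Finset V)) ∧
      attackersIn (F.bagAttacks X) v.I v.I = ∅ ∧
      v.O = u.O ∪ attackersIn (F.bagAttacks X) X v.I ∧
      v.D = u.D ∪ attackedIn (F.bagAttacks X) X v.I := by
  refine Finset.mem_image.trans ⟨?_, ?_⟩
  · rintro ⟨J, hJ, rfl⟩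
    exact ⟨(Finset.mem_filter.1 hJ).1, (Finset.mem_filter.1 hJ).2, rfl, rfl⟩
  · rintro ⟨h1, h2, h3, h4⟩
    exact ⟨v.I, Finset.mem_filter.2 ⟨h1, h2⟩, AdmRow.ext rfl h3.symm h4.symm⟩

theorem mem_admBase_remove {a : V} {u v : AdmRow V} :
    v ∈ F.admBase.remove a u ↔
      a ∉ u.O \ u.D ∧ v = ⟨u.I.erase a, u.O.erase a, u.D.erase a⟩ :=
  mem_ite_singleton

theorem mem_admBase_join {u₁ u₂ v : AdmRow V} :
    v ∈ F.admBase.join u₁ u₂ ↔ u₁.I = u₂.I ∧ v = ⟨u₁.I, u₁.O ∪ u₂.O, u₁.D ∪ u₂.D⟩ :=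
  mem_ite_singleton

/-- Defence is read off at the attacker: a vertex that attacks the set must be attacked by it. -/
def admSpec : ColorSpec Unit where
  node _ := True
  edge c d := ¬(c () ∧ d ())
  goal _ p q := q () → p ()

def admRow (T : RTree (Finset V)) (b : Unit → Finset V) : AdmRow V :=
  ⟨b () ∩ T.root, attackersIn (T.edges F.R) T.root (b ()), attackedIn (T.edges F.R) T.root (b ())⟩

theorem tracks_admBase : F.admBase.Tracks F.admBase.ext :=
  tracks_extend _ rfl (fun _ _ _ _ hv => (F.mem_admBase_introduce.1 hv).1)
    (fun a u v hv => by rw [(F.mem_admBase_remove.1 hv).2]; rfl)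
    (fun u₁ u₂ v hv => by
      obtain ⟨h, rfl⟩ := F.mem_admBase_join.1 hv
      exact ⟨rfl, h⟩)

/-- `O` and `D` accumulate the bag vertices that attack, or are attacked by, the whole collected
set. The removal test `a ∉ O \ D` is therefore the goal of `a`. -/
theorem implements_admBase :
    Implements F.admBase admSpec F.R (fun u _ => u.I) F.admRow where
  tracks _ := F.tracks_admBase
  map_row _ _ := rfl
  leaf := rfl
  introduce t a b ha hb u := by
    have h1 : attackersIn ((RTree.one (insert a t.root) t).edges F.R) (insert a t.root) (b ()) = _ :=
      RTree.attackersIn_introduce (RTree.mem_root_of_mem_insert ha) (Finset.subset_insert _ _)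
    have h2 : attackedIn ((RTree.one (insert a t.root) t).edges F.R) (insert a t.root) (b ()) = _ :=
      RTree.attackedIn_introduce (RTree.mem_root_of_mem_insert ha) (Finset.subset_insert _ _)
    refine (and_congr_left' F.mem_admBase_introduce).trans ?_
    simp only [admRow, RTree.root_one, h1, h2, restrict, bagAttacks]
    constructor
    · rintro ⟨⟨_, h3, h4, h5⟩, h6⟩
      have h6 : u.I = b () ∩ insert a t.root := congrFun h6 ()
      rw [h6] at h3 h4 h5
      exact ⟨fun _ _ => trivial, attackersIn_bag_eq_empty.1 h3, AdmRow.ext h6 h4 h5⟩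
    · rintro ⟨_, h3, rfl⟩
      exact ⟨⟨RTree.inter_insert_root_mem t a _, attackersIn_bag_eq_empty.2 h3, rfl, rfl⟩, rfl⟩
  remove t a b ha u := by
    refine F.mem_admBase_remove.trans ?_
    simp only [admRow, RTree.root_one, RTree.edges_remove, RTree.inter_erase_root,
      attackersIn_erase, attackedIn_erase]
    refine and_congr_left fun _ => ?_
    simp only [admSpec, attackedBy, attacks, Finset.mem_sdiff, mem_attackersIn, mem_attackedIn, ha,
      true_and, not_and, not_not]
  join t₁ t₂ b hr hi u := by
    have h1 : attackersIn ((RTree.two t₁.root t₁ t₂).edges F.R) t₁.root (b ()) = _ :=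
      RTree.attackersIn_join (fun _ _ => Iff.rfl) (fun _ _ => Iff.rfl)
    have h2 : attackedIn ((RTree.two t₁.root t₁ t₂).edges F.R) t₁.root (b ()) = _ :=
      RTree.attackedIn_join (fun _ _ => Iff.rfl) (fun _ _ => Iff.rfl)
    refine F.mem_admBase_join.trans ?_
    simp only [admRow, RTree.root_two, h1, h2, restrict, RTree.inter_verts_inter_root, hr,
      RTree.inter_verts_inter_root_of_eq hr, true_and]
    exact Iff.rfl

/-! ### Stable extensions -/

theorem mem_stabBase_introduce {X : Finset V} {a : V} {u v : StabRow V} :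
    v ∈ F.stabBase.introduce X a u ↔ v.I ∈ ({u.I, insert a u.I} : Finset (Finset V)) ∧
      attackersIn (F.bagAttacks X) v.I v.I = ∅ ∧
      v.D = u.D ∪ attackedIn (F.bagAttacks X) X v.I := by
  refine Finset.mem_image.trans ⟨?_, ?_⟩
  · rintro ⟨J, hJ, rfl⟩
    exact ⟨(Finset.mem_filter.1 hJ).1, (Finset.mem_filter.1 hJ).2, rfl⟩
  · rintro ⟨h1, h2, h3⟩
    exact ⟨v.I, Finset.mem_filter.2 ⟨h1, h2⟩, StabRow.ext rfl h3.symm⟩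

theorem mem_stabBase_remove {a : V} {u v : StabRow V} :
    v ∈ F.stabBase.remove a u ↔ a ∈ u.I ∪ u.D ∧ v = ⟨u.I.erase a, u.D.erase a⟩ :=
  mem_ite_singleton

theorem mem_stabBase_join {u₁ u₂ v : StabRow V} :
    v ∈ F.stabBase.join u₁ u₂ ↔ u₁.I = u₂.I ∧ v = ⟨u₁.I, u₁.D ∪ u₂.D⟩ :=
  mem_ite_singleton

/-- Defence is not demanded: it follows from conflict-freeness once every outside vertex is
attacked. -/
def stabSpec : ColorSpec Unit where
  node _ := True
  edge c d := ¬(c () ∧ d ())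
  goal c p _ := c () ∨ p ()

def stabRow (T : RTree (Finset V)) (b : Unit → Finset V) : StabRow V :=
  ⟨b () ∩ T.root, attackedIn (T.edges F.R) T.root (b ())⟩

theorem tracks_stabBase : F.stabBase.Tracks F.stabBase.ext :=
  tracks_extend _ rfl (fun _ _ _ _ hv => (F.mem_stabBase_introduce.1 hv).1)
    (fun a u v hv => by rw [(F.mem_stabBase_remove.1 hv).2]; rfl)
    (fun u₁ u₂ v hv => by
      obtain ⟨h, rfl⟩ := F.mem_stabBase_join.1 hv
      exact ⟨rfl, h⟩)

theorem implements_stabBase :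
    Implements F.stabBase stabSpec F.R (fun u _ => u.I) F.stabRow where
  tracks _ := F.tracks_stabBase
  map_row _ _ := rfl
  leaf := rfl
  introduce t a b ha hb u := by
    have h2 : attackedIn ((RTree.one (insert a t.root) t).edges F.R) (insert a t.root) (b ()) = _ :=
      RTree.attackedIn_introduce (RTree.mem_root_of_mem_insert ha) (Finset.subset_insert _ _)
    refine (and_congr_left' F.mem_stabBase_introduce).trans ?_
    simp only [stabRow, RTree.root_one, h2, restrict, bagAttacks]
    constructor
    · rintro ⟨⟨_, h3, h5⟩, h6⟩
      have h6 : u.I = b () ∩ insert a t.root := congrFun h6 ()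
      rw [h6] at h3 h5
      exact ⟨fun _ _ => trivial, attackersIn_bag_eq_empty.1 h3, StabRow.ext h6 h5⟩
    · rintro ⟨_, h3, rfl⟩
      exact ⟨⟨RTree.inter_insert_root_mem t a _, attackersIn_bag_eq_empty.2 h3, rfl⟩, rfl⟩
  remove t a b ha u := by
    refine F.mem_stabBase_remove.trans ?_
    simp only [stabRow, RTree.root_one, RTree.edges_remove, RTree.inter_erase_root,
      attackedIn_erase]
    refine and_congr_left fun _ => ?_
    simp only [stabSpec, color, attackedBy, Finset.mem_union, Finset.mem_inter, mem_attackedIn, ha,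
      true_and, and_true]
  join t₁ t₂ b hr hi u := by
    have h2 : attackedIn ((RTree.two t₁.root t₁ t₂).edges F.R) t₁.root (b ()) = _ :=
      RTree.attackedIn_join (fun _ _ => Iff.rfl) (fun _ _ => Iff.rfl)
    refine F.mem_stabBase_join.trans ?_
    simp only [stabRow, RTree.root_two, h2, restrict, RTree.inter_verts_inter_root, hr,
      RTree.inter_verts_inter_root_of_eq hr, true_and]
    exact Iff.rfl

/-! ### Conflict-free sets with their range -/

theorem mem_guess {X : Finset V} {a : V} {I AC : Finset V} {p : Finset V × Finset V} :
    p ∈ F.guess X a I AC ↔ (p.1 ∈ ({I, insert a I} : Finset (Finset V)) ∧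
      p.2 ∈ ({AC, insert a AC} : Finset (Finset V))) ∧ p.1 ∩ p.2 = ∅ ∧
      attackersIn (F.bagAttacks X) p.1 p.1 = ∅ ∧ attackedIn (F.bagAttacks X) X p.1 ⊆ p.2 :=
  Finset.mem_filter.trans (and_congr_left' Finset.mem_product)

theorem mem_stagBase_introduce {X : Finset V} {a : V} {u v : StagRow V} :
    v ∈ F.stagBase.introduce X a u ↔ (v.I, v.AC) ∈ F.guess X a u.I u.AC ∧
      v.A = u.A ∪ attackedIn (F.bagAttacks X) X v.I := by
  refine Finset.mem_image.trans ⟨?_, ?_⟩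
  · rintro ⟨J, hJ, rfl⟩
    exact ⟨hJ, rfl⟩
  · rintro ⟨h1, h2⟩
    exact ⟨_, h1, StagRow.ext rfl h2.symm rfl⟩

theorem mem_stagBase_remove {a : V} {u v : StagRow V} :
    v ∈ F.stagBase.remove a u ↔
      a ∉ u.AC \ u.A ∧ v = ⟨u.I.erase a, u.A.erase a, u.AC.erase a⟩ :=
  mem_ite_singleton

theorem mem_stagBase_join {u₁ u₂ v : StagRow V} :
    v ∈ F.stagBase.join u₁ u₂ ↔
      (u₁.I = u₂.I ∧ u₁.AC = u₂.AC) ∧ v = ⟨u₁.I, u₁.A ∪ u₂.A, u₁.AC⟩ :=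
  mem_ite_singleton

/-- Colour 1 is the guess of the attacked set. The edge condition forces every attacked vertex into
the guess, and the goal forces every guessed vertex to be attacked. -/
def stagSpec : ColorSpec (Fin 2) where
  node c := ¬(c 0 ∧ c 1)
  edge c d := ¬(c 0 ∧ d 0) ∧ (c 0 → d 1)
  goal c p _ := c 1 → p 0

def stagRow (T : RTree (Finset V)) (b : Fin 2 → Finset V) : StagRow V :=
  ⟨b 0 ∩ T.root, attackedIn (T.edges F.R) T.root (b 0), b 1 ∩ T.root⟩

theorem tracks_stagBase : F.stagBase.Tracks F.stagBase.ext :=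
  tracks_extend _ rfl
    (fun _ _ _ _ hv => (F.mem_guess.1 (F.mem_stagBase_introduce.1 hv).1).1.1)
    (fun a u v hv => by rw [(F.mem_stagBase_remove.1 hv).2]; rfl)
    (fun u₁ u₂ v hv => by
      obtain ⟨h, rfl⟩ := F.mem_stagBase_join.1 hv
      exact ⟨rfl, h.1⟩)

theorem tracks_stagBase_AC : F.stagBase.Tracks fun u : StagRow V => u.AC :=
  tracks_extend _ rfl
    (fun _ _ _ _ hv => (F.mem_guess.1 (F.mem_stagBase_introduce.1 hv).1).1.2)
    (fun a u v hv => by rw [(F.mem_stagBase_remove.1 hv).2])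
    (fun u₁ u₂ v hv => by
      obtain ⟨h, rfl⟩ := F.mem_stagBase_join.1 hv
      exact ⟨rfl, h.2⟩)

/-- Shared by STAG and SEMI, whose specifications differ only in the goal. -/
theorem mem_guess_restrict {t : RTree (Finset V)} {a : V} (b : Fin 2 → Finset V) :
    (b 0 ∩ insert a t.root, b 1 ∩ insert a t.root) ∈ F.guess (insert a t.root) a
      (b 0 ∩ t.verts ∩ t.root) (b 1 ∩ t.verts ∩ t.root) ↔
    (∀ x ∈ insert a t.root, stagSpec.node (color b x)) ∧
      ∀ x ∈ insert a t.root, ∀ y ∈ insert a t.root, (x, y) ∈ F.R →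
        stagSpec.edge (color b x) (color b y) := by
  rw [mem_guess]
  simp only [RTree.inter_insert_root_mem, bagAttacks, true_and, bag_inter_eq_empty,
    attackersIn_bag_eq_empty, attackedIn_bag_subset, stagSpec, color]
  refine and_congr_right fun _ => ⟨fun h x hx y hy hxy => ⟨h.1 x hx y hy hxy, h.2 x hx y hy hxy⟩,
    fun h => ⟨fun x hx y hy hxy => (h x hx y hy hxy).1, fun x hx y hy hxy => (h x hx y hy hxy).2⟩⟩

theorem implements_stagBase :
    Implements F.stagBase stagSpec F.R (fun u => ![u.I, u.AC]) F.stagRow where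
  tracks := Fin.forall_fin_two.2 ⟨F.tracks_stagBase, F.tracks_stagBase_AC⟩
  map_row _ _ := funext (Fin.forall_fin_two.2 ⟨rfl, rfl⟩)
  leaf := rfl
  introduce t a b ha hb u := by
    have h2 : attackedIn ((RTree.one (insert a t.root) t).edges F.R) (insert a t.root) (b 0) = _ :=
      RTree.attackedIn_introduce (RTree.mem_root_of_mem_insert ha) (Finset.subset_insert _ _)
    refine (and_congr_left' F.mem_stagBase_introduce).trans
      (Iff.trans ?_ ((and_congr_left' (F.mem_guess_restrict b)).trans and_assoc))
    simp only [stagRow, RTree.root_one, h2, restrict]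
    constructor
    · rintro ⟨⟨h3, h4⟩, h5⟩
      have h6 : u.I = b 0 ∩ insert a t.root := congrFun h5 0
      have h7 : u.AC = b 1 ∩ insert a t.root := congrFun h5 1
      rw [h6] at h3 h4
      rw [h7] at h3
      exact ⟨h3, StagRow.ext h6 h4 h7⟩
    · rintro ⟨h3, rfl⟩
      exact ⟨⟨h3, rfl⟩, funext (Fin.forall_fin_two.2 ⟨rfl, rfl⟩)⟩
  remove t a b ha u := by
    refine F.mem_stagBase_remove.trans ?_
    simp only [stagRow, RTree.root_one, RTree.edges_remove, RTree.inter_erase_root,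
      attackedIn_erase]
    refine and_congr_left fun _ => ?_
    simp only [stagSpec, color, attackedBy, Finset.mem_sdiff, Finset.mem_inter, mem_attackedIn, ha,
      true_and, and_true, not_and, not_not]
  join t₁ t₂ b hr hi u := by
    have h2 : attackedIn ((RTree.two t₁.root t₁ t₂).edges F.R) t₁.root (b 0) = _ :=
      RTree.attackedIn_join (fun _ _ => Iff.rfl) (fun _ _ => Iff.rfl)
    refine F.mem_stagBase_join.trans ?_
    simp only [stagRow, RTree.root_two, h2, restrict, RTree.inter_verts_inter_root, hr,
      RTree.inter_verts_inter_root_of_eq hr, true_and]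
    exact Iff.rfl

/-! ### Admissible sets with their range -/

theorem mem_semiBase_introduce {X : Finset V} {a : V} {u v : SemiRow V} :
    v ∈ F.semiBase.introduce X a u ↔ (v.I, v.AC) ∈ F.guess X a u.I u.AC ∧
      v.O = u.O ∪ attackersIn (F.bagAttacks X) X v.I ∧
      v.D = u.D ∪ attackedIn (F.bagAttacks X) X v.I := by
  refine Finset.mem_image.trans ⟨?_, ?_⟩
  · rintro ⟨J, hJ, rfl⟩
    exact ⟨hJ, rfl, rfl⟩
  · rintro ⟨h1, h2, h3⟩
    exact ⟨_, h1, SemiRow.ext rfl h2.symm h3.symm rfl⟩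

theorem mem_semiBase_remove {a : V} {u v : SemiRow V} :
    v ∈ F.semiBase.remove a u ↔ (a ∉ u.O \ u.D ∧ a ∉ u.AC \ u.D) ∧
      v = ⟨u.I.erase a, u.O.erase a, u.D.erase a, u.AC.erase a⟩ :=
  mem_ite_singleton

theorem mem_semiBase_join {u₁ u₂ v : SemiRow V} :
    v ∈ F.semiBase.join u₁ u₂ ↔
      (u₁.I = u₂.I ∧ u₁.AC = u₂.AC) ∧ v = ⟨u₁.I, u₁.O ∪ u₂.O, u₁.D ∪ u₂.D, u₁.AC⟩ :=
  mem_ite_singleton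

def semiSpec : ColorSpec (Fin 2) where
  node := stagSpec.node
  edge := stagSpec.edge
  goal c p q := (q 0 → p 0) ∧ (c 1 → p 0)

def semiRow (T : RTree (Finset V)) (b : Fin 2 → Finset V) : SemiRow V :=
  ⟨b 0 ∩ T.root, attackersIn (T.edges F.R) T.root (b 0), attackedIn (T.edges F.R) T.root (b 0),
    b 1 ∩ T.root⟩

theorem tracks_semiBase : F.semiBase.Tracks F.semiBase.ext :=
  tracks_extend _ rfl
    (fun _ _ _ _ hv => (F.mem_guess.1 (F.mem_semiBase_introduce.1 hv).1).1.1)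
    (fun a u v hv => by rw [(F.mem_semiBase_remove.1 hv).2]; rfl)
    (fun u₁ u₂ v hv => by
      obtain ⟨h, rfl⟩ := F.mem_semiBase_join.1 hv
      exact ⟨rfl, h.1⟩)

theorem tracks_semiBase_AC : F.semiBase.Tracks fun u : SemiRow V => u.AC :=
  tracks_extend _ rfl
    (fun _ _ _ _ hv => (F.mem_guess.1 (F.mem_semiBase_introduce.1 hv).1).1.2)
    (fun a u v hv => by rw [(F.mem_semiBase_remove.1 hv).2])
    (fun u₁ u₂ v hv => by
      obtain ⟨h, rfl⟩ := F.mem_semiBase_join.1 hv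
      exact ⟨rfl, h.2⟩)

theorem implements_semiBase :
    Implements F.semiBase semiSpec F.R (fun u => ![u.I, u.AC]) F.semiRow where
  tracks := Fin.forall_fin_two.2 ⟨F.tracks_semiBase, F.tracks_semiBase_AC⟩
  map_row _ _ := funext (Fin.forall_fin_two.2 ⟨rfl, rfl⟩)
  leaf := rfl
  introduce t a b ha hb u := by
    have h1 : attackersIn ((RTree.one (insert a t.root) t).edges F.R) (insert a t.root) (b 0) = _ :=
      RTree.attackersIn_introduce (RTree.mem_root_of_mem_insert ha) (Finset.subset_insert _ _)
    have h2 : attackedIn ((RTree.one (insert a t.root) t).edges F.R) (insert a t.root) (b 0) = _ :=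
      RTree.attackedIn_introduce (RTree.mem_root_of_mem_insert ha) (Finset.subset_insert _ _)
    refine (and_congr_left' F.mem_semiBase_introduce).trans
      (Iff.trans ?_ ((and_congr_left' (F.mem_guess_restrict b)).trans and_assoc))
    simp only [semiRow, RTree.root_one, h1, h2, restrict]
    constructor
    · rintro ⟨⟨h3, h4, h8⟩, h5⟩
      have h6 : u.I = b 0 ∩ insert a t.root := congrFun h5 0
      have h7 : u.AC = b 1 ∩ insert a t.root := congrFun h5 1
      rw [h6] at h3 h4 h8
      rw [h7] at h3
      exact ⟨h3, SemiRow.ext h6 h4 h8 h7⟩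
    · rintro ⟨h3, rfl⟩
      exact ⟨⟨h3, rfl, rfl⟩, funext (Fin.forall_fin_two.2 ⟨rfl, rfl⟩)⟩
  remove t a b ha u := by
    refine F.mem_semiBase_remove.trans ?_
    simp only [semiRow, RTree.root_one, RTree.edges_remove, RTree.inter_erase_root,
      attackersIn_erase, attackedIn_erase]
    refine and_congr_left fun _ => ?_
    simp only [semiSpec, color, attackedBy, attacks, Finset.mem_sdiff, Finset.mem_inter,
      mem_attackersIn, mem_attackedIn, ha, true_and, and_true, not_and, not_not]
  join t₁ t₂ b hr hi u := by
    have h1 : attackersIn ((RTree.two t₁.root t₁ t₂).edges F.R) t₁.root (b 0) = _ :=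
      RTree.attackersIn_join (fun _ _ => Iff.rfl) (fun _ _ => Iff.rfl)
    have h2 : attackedIn ((RTree.two t₁.root t₁ t₂).edges F.R) t₁.root (b 0) = _ :=
      RTree.attackedIn_join (fun _ _ => Iff.rfl) (fun _ _ => Iff.rfl)
    refine F.mem_semiBase_join.trans ?_
    simp only [semiRow, RTree.root_two, h1, h2, restrict, RTree.inter_verts_inter_root, hr,
      RTree.inter_verts_inter_root_of_eq hr, true_and]
    exact Iff.rfl

/-! ### Complete extensions -/

theorem mem_compBase_introduce {X : Finset V} {a : V} {u v : CompRow V} :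
    v ∈ F.compBase.introduce X a u ↔ (v.I ∈ ({u.I, insert a u.I} : Finset (Finset V)) ∧
      v.DC ∈ ({u.DC, insert a u.DC} : Finset (Finset V)) ∧
      v.OC ∈ ({u.OC, insert a u.OC} : Finset (Finset V))) ∧
      (v.I ∩ v.DC = ∅ ∧ v.I ∩ v.OC = ∅ ∧ v.DC ∩ v.OC = ∅ ∧
        attackersIn (F.bagAttacks X) v.I v.I = ∅ ∧ attackersIn (F.bagAttacks X) v.I v.OC = ∅ ∧
        attackersIn (F.bagAttacks X) v.OC v.I = ∅) ∧
      v.D = u.D ∪ attackedIn (F.bagAttacks X) v.DC v.I ∧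
      v.O = u.O ∪ attackedIn (F.bagAttacks X) v.OC v.OC := by
  refine Finset.mem_image.trans ⟨?_, ?_⟩
  · rintro ⟨⟨J, D, O⟩, hJ, rfl⟩
    obtain ⟨h1, h2⟩ := Finset.mem_filter.1 hJ
    obtain ⟨h3, h4⟩ := Finset.mem_product.1 h1
    exact ⟨⟨h3, Finset.mem_product.1 h4⟩, h2, rfl, rfl⟩
  · rintro ⟨⟨h1, h2, h3⟩, h4, h5, h6⟩
    exact ⟨(v.I, v.DC, v.OC), Finset.mem_filter.2 ⟨Finset.mem_product.2
      ⟨h1, Finset.mem_product.2 ⟨h2, h3⟩⟩, h4⟩, CompRow.ext rfl h5.symm rfl h6.symm rfl⟩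

theorem mem_compBase_remove {a : V} {u v : CompRow V} :
    v ∈ F.compBase.remove a u ↔ a ∈ u.I ∪ u.D ∪ u.O ∧
      v = ⟨u.I.erase a, u.D.erase a, u.DC.erase a, u.O.erase a, u.OC.erase a⟩ :=
  mem_ite_singleton

theorem mem_compBase_join {u₁ u₂ v : CompRow V} :
    v ∈ F.compBase.join u₁ u₂ ↔ (u₁.I = u₂.I ∧ u₁.DC = u₂.DC ∧ u₁.OC = u₂.OC) ∧
      v = ⟨u₁.I, u₁.D ∪ u₂.D, u₁.DC, u₁.O ∪ u₂.O, u₁.OC⟩ :=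
  mem_ite_singleton

/-- The three colours are those of complete labellings: in, defeated, unrelated. The goal gives each
vertex a colour together with its justification; an unrelated vertex needs an unrelated attacker. -/
def compSpec : ColorSpec (Fin 3) where
  node c := ¬(c 0 ∧ c 1) ∧ ¬(c 0 ∧ c 2) ∧ ¬(c 1 ∧ c 2)
  edge c d := ¬(c 0 ∧ d 0) ∧ ¬(c 0 ∧ d 2) ∧ ¬(c 2 ∧ d 0)
  goal c p _ := c 0 ∨ (c 1 ∧ p 0) ∨ (c 2 ∧ p 2)

def compRow (T : RTree (Finset V)) (b : Fin 3 → Finset V) : CompRow V :=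
  ⟨b 0 ∩ T.root, attackedIn (T.edges F.R) (b 1 ∩ T.root) (b 0), b 1 ∩ T.root,
    attackedIn (T.edges F.R) (b 2 ∩ T.root) (b 2), b 2 ∩ T.root⟩

theorem tracks_compBase : F.compBase.Tracks F.compBase.ext :=
  tracks_extend _ rfl (fun _ _ _ _ hv => (F.mem_compBase_introduce.1 hv).1.1)
    (fun a u v hv => by rw [(F.mem_compBase_remove.1 hv).2]; rfl)
    (fun u₁ u₂ v hv => by
      obtain ⟨h, rfl⟩ := F.mem_compBase_join.1 hv
      exact ⟨rfl, h.1⟩)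

theorem tracks_compBase_DC : F.compBase.Tracks fun u : CompRow V => u.DC :=
  tracks_extend _ rfl (fun _ _ _ _ hv => (F.mem_compBase_introduce.1 hv).1.2.1)
    (fun a u v hv => by rw [(F.mem_compBase_remove.1 hv).2])
    (fun u₁ u₂ v hv => by
      obtain ⟨h, rfl⟩ := F.mem_compBase_join.1 hv
      exact ⟨rfl, h.2.1⟩)

theorem tracks_compBase_OC : F.compBase.Tracks fun u : CompRow V => u.OC :=
  tracks_extend _ rfl (fun _ _ _ _ hv => (F.mem_compBase_introduce.1 hv).1.2.2)
    (fun a u v hv => by rw [(F.mem_compBase_remove.1 hv).2])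
    (fun u₁ u₂ v hv => by
      obtain ⟨h, rfl⟩ := F.mem_compBase_join.1 hv
      exact ⟨rfl, h.2.2⟩)

theorem forall_fin_three {p : Fin 3 → Prop} (h₀ : p 0) (h₁ : p 1) (h₂ : p 2) : ∀ i, p i := by
  intro i
  fin_cases i
  exacts [h₀, h₁, h₂]

theorem implements_compBase :
    Implements F.compBase compSpec F.R (fun u => ![u.I, u.DC, u.OC]) F.compRow where
  tracks := forall_fin_three F.tracks_compBase F.tracks_compBase_DC F.tracks_compBase_OC
  map_row _ _ := funext (forall_fin_three rfl rfl rfl)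
  leaf := by
    simp [compRow, RTree.root, attackedIn, compBase]
  introduce t a b ha hb u := by
    have h1 : attackedIn ((RTree.one (insert a t.root) t).edges F.R)
        (b 1 ∩ insert a t.root) (b 0) = _ :=
      RTree.attackedIn_introduce (RTree.mem_inter_root_of_mem_insert ha _)
        (RTree.inter_root_subset_insert _)
    have h2 : attackedIn ((RTree.one (insert a t.root) t).edges F.R)
        (b 2 ∩ insert a t.root) (b 2) = _ :=
      RTree.attackedIn_introduce (RTree.mem_inter_root_of_mem_insert ha _)
        (RTree.inter_root_subset_insert _)
    refine (and_congr_left' F.mem_compBase_introduce).trans ?_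
    simp only [compRow, RTree.root_one, h1, h2, restrict, bagAttacks]
    constructor
    · rintro ⟨⟨_, ⟨n1, n2, n3, e1, e2, e3⟩, h3, h4⟩, h5⟩
      have h6 : u.I = b 0 ∩ insert a t.root := congrFun h5 0
      have h7 : u.DC = b 1 ∩ insert a t.root := congrFun h5 1
      have h8 : u.OC = b 2 ∩ insert a t.root := congrFun h5 2
      rw [h6, h7] at n1 h3
      rw [h6, h8] at n2 e2 e3
      rw [h7, h8] at n3
      rw [h6] at e1
      rw [h8] at h4
      rw [bag_inter_eq_empty] at n1 n2 n3
      rw [attackersIn_bag_eq_empty] at e1 e2 e3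
      exact ⟨fun x hx => ⟨n1 x hx, n2 x hx, n3 x hx⟩,
        fun x hx y hy h => ⟨e1 x hx y hy h, e2 x hx y hy h, e3 x hx y hy h⟩,
        CompRow.ext h6 h3 h7 h4 h8⟩
    · rintro ⟨hn, he, rfl⟩
      refine ⟨⟨⟨RTree.inter_insert_root_mem t a _, RTree.inter_insert_root_mem t a _,
        RTree.inter_insert_root_mem t a _⟩,
        ⟨bag_inter_eq_empty.2 fun x hx => (hn x hx).1,
          bag_inter_eq_empty.2 fun x hx => (hn x hx).2.1,
          bag_inter_eq_empty.2 fun x hx => (hn x hx).2.2,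
          attackersIn_bag_eq_empty.2 fun x hx y hy h => (he x hx y hy h).1,
          attackersIn_bag_eq_empty.2 fun x hx y hy h => (he x hx y hy h).2.1,
          attackersIn_bag_eq_empty.2 fun x hx y hy h => (he x hx y hy h).2.2⟩,
        rfl, rfl⟩, funext (forall_fin_three rfl rfl rfl)⟩
  remove t a b ha u := by
    refine F.mem_compBase_remove.trans ?_
    simp only [compRow, RTree.root_one, RTree.edges_remove, RTree.inter_erase_root,
      attackedIn_erase]
    refine and_congr_left fun _ => ?_
    simp only [compSpec, color, attackedBy, Finset.mem_union, Finset.mem_inter, mem_attackedIn, ha,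
      and_true, or_assoc]
  join t₁ t₂ b hr hi u := by
    have h1 : attackedIn ((RTree.two t₁.root t₁ t₂).edges F.R) (b 1 ∩ t₁.root) (b 0) = _ :=
      RTree.attackedIn_join (RTree.inter_verts_iff t₁ _ _) (RTree.inter_verts_iff t₂ _ _)
    have h2 : attackedIn ((RTree.two t₁.root t₁ t₂).edges F.R) (b 2 ∩ t₁.root) (b 2) = _ :=
      RTree.attackedIn_join (RTree.inter_verts_iff t₁ _ _) (RTree.inter_verts_iff t₂ _ _)
    refine F.mem_compBase_join.trans ?_
    simp only [compRow, RTree.root_two, h1, h2, restrict, RTree.inter_verts_inter_root, hr,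
      RTree.inter_verts_inter_root_of_eq hr, true_and]
    exact Iff.rfl

end AF

/-! ### From implemented colourings to the output of the algorithm. -/

namespace ColorSpec

variable {V : Type u} [DecidableEq V] {ι : Type} {L : LocalAlg V} {C : ColorSpec ι}
  {R : Finset (V × V)} {f : L.Row → ι → Finset V}
  {row : RTree (Finset V) → (ι → Finset V) → L.Row} {T : RTree (Finset V)}

theorem Implements.derives_map_iff {β : Type u} [Max β] (h : Implements L C R f row)
    (hT : T.NiceDecomp R) (g : (ι → Finset V) → β) (hg : ∀ b c, g (b ⊔ c) = g b ⊔ g c)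
    {u : L.Row} {c : β} : L.Derives (fun v => g (f v)) T u c ↔
      ∃ b, C.Valid R T b ∧ u = row T b ∧ g b = c := by
  constructor
  · intro hd
    obtain ⟨b, hb, rfl⟩ := Derives.of_map g hg hd
    obtain ⟨hv, hu⟩ := (h.derives_iff hT).1 hb
    exact ⟨b, hv, hu, rfl⟩
  · rintro ⟨b, hv, hu, rfl⟩
    exact ((h.derives_iff hT).2 ⟨hv, hu⟩).map g hg

variable [Fintype V]

/-- The hypothesis `hrow` expresses that the row at the root does not depend on the family, as is
the case for an empty root bag. Different families with the same component `i` do no harm, because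
sets are counted and not families. -/
theorem Implements.mdpa_eq (h : Implements L C R f row) (hT : T.NiceDecomp R)
    (hverts : T.verts = Finset.univ) {i : ι} (hext : L.ext = fun u => f u i)
    (hacc : ∀ u, L.accept u = true) (hrow : ∀ b b', row T b = row T b') (c : V) (P : Finset V) :
    (L.credulous c).mdpa P T =
      Set.ncard {X | ∃ S, (∃ b, C.Valid R T b ∧ b i = S) ∧ c ∈ S ∧ X = S ∩ P} := by
  have hL : L.Tracks L.ext := hext ▸ h.tracks i
  have hd : ∀ u S, L.Derives L.ext T u S ↔ ∃ b, C.Valid R T b ∧ u = row T b ∧ b i = S := by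
    intro u S
    rw [hext]
    exact h.derives_map_iff hT (fun b => b i) fun _ _ => rfl
  rw [mdpa_credulous hL c P hT hverts]
  · congr 1
    ext X
    refine exists_congr fun S => and_congr_left fun _ => ?_
    simp only [hd, hacc, and_true]
    exact ⟨fun ⟨_, b, h1, _, h2⟩ => ⟨b, h1, h2⟩, fun ⟨b, h1, h2⟩ => ⟨_, b, h1, rfl, h2⟩⟩
  · intro u v S S' hu hv _ _
    obtain ⟨b, _, rfl, _⟩ := (hd _ _).1 hu
    obtain ⟨b', _, rfl, _⟩ := (hd _ _).1 hv
    exact hrow b b'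

theorem Implements.mdpa_maximize_eq (h : Implements L C R f row) (hT : T.NiceDecomp R)
    (hverts : T.verts = Finset.univ) {i : ι} (hext : L.ext = fun u => f u i)
    (hacc : ∀ u, L.accept u = true) (hrow : ∀ b b', row T b = row T b')
    (g : (ι → Finset V) → Finset V) (hg : ∀ b c, g (b ⊔ c) = g b ⊔ g c)
    (hk : L.Tracks fun u => g (f u)) (c : V) (P : Finset V) :
    ((L.maximize fun u => g (f u)).credulous c).mdpa P T =
      Set.ncard {X | ∃ S, (∃ b, C.Valid R T b ∧ b i = S ∧ ∀ b', C.Valid R T b' → ¬ g b ⊂ g b') ∧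
        c ∈ S ∧ X = S ∩ P} := by
  have hL : L.Tracks L.ext := hext ▸ h.tracks i
  have hd : ∀ u K, L.Derives (fun u => g (f u)) T u K ↔
      ∃ b, C.Valid R T b ∧ u = row T b ∧ g b = K := fun u K => h.derives_map_iff hT g hg
  have hd' : ∀ u S K, L.Derives (fun u => (L.ext u, g (f u))) T u (S, K) ↔
      ∃ b, C.Valid R T b ∧ u = row T b ∧ (b i, g b) = (S, K) := by
    intro u S K
    rw [hext]
    exact h.derives_map_iff hT (fun b => (b i, g b)) fun b c => Prod.ext rfl (hg b c)
  rw [mdpa_maximize hL hk c P hT hverts hacc]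
  · congr 1
    ext X
    refine exists_congr fun S => and_congr_left fun _ => ?_
    simp only [hd, hd', Prod.mk.injEq]
    constructor
    · rintro ⟨u, K, ⟨b, h1, rfl, rfl, rfl⟩, hmax⟩
      exact ⟨b, h1, rfl, fun b' hb' => hmax _ _ ⟨b', hb', rfl, rfl⟩⟩
    · rintro ⟨b, h1, rfl, hmax⟩
      refine ⟨_, _, ⟨b, h1, rfl, rfl, rfl⟩, ?_⟩
      rintro _ _ ⟨b', hb', rfl, rfl⟩
      exact hmax b' hb'
  · intro u v K K' hu hv
    obtain ⟨b, _, rfl, _⟩ := (hd _ _).1 hu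
    obtain ⟨b', _, rfl, _⟩ := (hd _ _).1 hv
    exact hrow b b'

/-- With an empty root bag no goal is pending, so validity is a condition on the whole graph. -/
theorem valid_iff_of_root_eq_empty (hverts : T.verts = Finset.univ) (hedges : T.edges R = R)
    (hroot : T.root = ∅) {b : ι → Finset V} : C.Valid R T b ↔ (∀ x, C.node (color b x)) ∧
      (∀ x y, (x, y) ∈ R → C.edge (color b x) (color b y)) ∧
      ∀ x, C.goal (color b x) (attackedBy R b x) (attacks R b x) := by
  constructor
  · rintro ⟨_, h2, h3, h4⟩
    rw [hedges] at h3 h4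
    exact ⟨fun x => h2 x (hverts ▸ Finset.mem_univ x), h3,
      fun x => h4 x (hverts ▸ Finset.mem_univ x) (by simp [hroot])⟩
  · rintro ⟨h2, h3, h4⟩
    refine ⟨fun _ => hverts ▸ Finset.subset_univ _, fun x _ => h2 x, ?_, fun x _ _ => ?_⟩
    · rwa [hedges]
    · rw [hedges]
      exact h4 x

end ColorSpec

/-! ### Valid colourings and the six semantics. -/

namespace AF

variable {V : Type u} [DecidableEq V] (F : AF V)

theorem tracks_union {L : LocalAlg V} {f g : L.Row → Finset V} (hf : L.Tracks f)
    (hg : L.Tracks g) : L.Tracks fun u => f u ∪ g u where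
  leafRow := by rw [hf.leafRow, hg.leafRow, Finset.empty_union]
  introduce X a u v hv := by
    rcases hf.introduce X a u v hv with h1 | h1 <;>
      rcases hg.introduce X a u v hv with h2 | h2 <;> rw [h1, h2]
    · exact Or.inl rfl
    · exact Or.inr (Finset.union_insert _ _ _)
    · exact Or.inr (Finset.insert_union _ _ _)
    · exact Or.inr (Finset.insert_union_distrib _ _ _).symm
  remove a u v hv := by rw [hf.remove a u v hv, hg.remove a u v hv, Finset.erase_union_distrib]
  join u₁ u₂ v hv := by
    obtain ⟨h1, h2⟩ := hf.join u₁ u₂ v hv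
    obtain ⟨h3, h4⟩ := hg.join u₁ u₂ v hv
    exact ⟨by rw [h1, h3], by rw [h2, h4]⟩

theorem attackersIn_empty (R : Finset (V × V)) (S : Finset V) : attackersIn R ∅ S = ∅ := rfl

theorem attackedIn_empty (R : Finset (V × V)) (S : Finset V) : attackedIn R ∅ S = ∅ := rfl

variable {F} [Fintype V] {T : RTree (Finset V)}

theorem valid_admSpec_iff (hverts : T.verts = Finset.univ) (hedges : T.edges F.R = F.R)
    (hroot : T.root = ∅) {b : Unit → Finset V} :
    admSpec.Valid F.R T b ↔ F.Admissible (b ()) := by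
  rw [valid_iff_of_root_eq_empty hverts hedges hroot]
  simp only [admSpec, color, attackedBy, attacks, Admissible, ConflictFree, Defends]
  constructor
  · rintro ⟨_, h1, h2⟩
    exact ⟨fun s hs s' hs' h => h1 s s' h ⟨hs, hs'⟩, fun s hs s' h => h2 s' ⟨s, hs, h⟩⟩
  · rintro ⟨h1, h2⟩
    exact ⟨fun _ => trivial, fun x y h hxy => h1 x hxy.1 y hxy.2 h,
      fun x ⟨y, hy, hxy⟩ => h2 y hy x hxy⟩

theorem valid_stabSpec_iff (hverts : T.verts = Finset.univ) (hedges : T.edges F.R = F.R)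
    (hroot : T.root = ∅) {b : Unit → Finset V} :
    stabSpec.Valid F.R T b ↔ F.IsExtension .stable (b ()) := by
  rw [valid_iff_of_root_eq_empty hverts hedges hroot]
  simp only [stabSpec, color, attackedBy, IsExtension, Admissible, ConflictFree, Defends]
  constructor
  · rintro ⟨_, h1, h2⟩
    have hcf : ∀ s ∈ b (), ∀ s' ∈ b (), (s, s') ∉ F.R := fun s hs s' hs' h => h1 s s' h ⟨hs, hs'⟩
    -- An attacker of the set lies outside it by conflict-freeness, so its goal says that the set
    -- attacks it.
    exact ⟨⟨hcf, fun s hs s' h => (h2 s').resolve_left fun hs' => hcf s' hs' s hs h⟩,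
      fun s hs => (h2 s).resolve_left hs⟩
  · rintro ⟨⟨h1, _⟩, h2⟩
    exact ⟨fun _ => trivial, fun x y h hxy => h1 x hxy.1 y hxy.2 h,
      fun x => or_iff_not_imp_left.2 (h2 x)⟩

/-- An attacker of an in-vertex can be neither in nor unrelated, hence is defeated; this is defence.
A vertex that is not in has an attacker that is in or unrelated; no in-vertex may attack either
kind, so the vertex is not defended. -/
theorem exists_valid_compSpec_iff (hverts : T.verts = Finset.univ) (hedges : T.edges F.R = F.R)
    (hroot : T.root = ∅) {S : Finset V} :
    (∃ b, compSpec.Valid F.R T b ∧ b 0 = S) ↔ F.IsExtension .complete S := by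
  simp only [valid_iff_of_root_eq_empty hverts hedges hroot]
  simp only [compSpec, color, attackedBy, IsExtension, Admissible, ConflictFree, Defends]
  constructor
  · rintro ⟨b, ⟨hn, he, hg⟩, rfl⟩
    have hdef : ∀ s ∈ b 0, ∀ s', (s', s) ∈ F.R → ∃ y ∈ b 0, (y, s') ∈ F.R := by
      intro s hs s' h
      rcases hg s' with h' | h' | h'
      · exact absurd ⟨h', hs⟩ (he s' s h).1
      · exact h'.2
      · exact absurd ⟨h'.1, hs⟩ (he s' s h).2.2
    refine ⟨⟨fun s hs s' hs' h => (he s s' h).1 ⟨hs, hs'⟩, hdef⟩, fun s => ⟨hdef s, fun h => ?_⟩⟩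
    rcases hg s with h' | ⟨_, y, hy, hys⟩ | ⟨_, y, hy, hys⟩
    · exact h'
    · obtain ⟨z, hz, hzy⟩ := h y hys
      exact absurd ⟨hz, hy⟩ (he z y hzy).1
    · obtain ⟨z, hz, hzy⟩ := h y hys
      exact absurd ⟨hz, hy⟩ (he z y hzy).2.1
  · rintro ⟨⟨hcf, hdef⟩, hcomp⟩
    classical
    -- Given `S`, the defeated vertices are those attacked by `S`, and all others outside `S` are
    -- unrelated.
    refine ⟨![S, Finset.univ.filter fun x => ∃ y ∈ S, (y, x) ∈ F.R,
      Finset.univ.filter fun x => x ∉ S ∧ ¬∃ y ∈ S, (y, x) ∈ F.R], ⟨fun x => ?_, fun x y hxy => ?_,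
      fun x => ?_⟩, rfl⟩
    · simp only [Matrix.cons_val, Finset.mem_filter, Finset.mem_univ, true_and]
      refine ⟨?_, fun h => h.2.1 h.1, fun h => h.2.2 h.1⟩
      rintro ⟨hx, y, hy, hyx⟩
      exact hcf y hy x hx hyx
    · simp only [Matrix.cons_val, Finset.mem_filter, Finset.mem_univ, true_and]
      exact ⟨fun h => hcf x h.1 y h.2 hxy, fun h => h.2.2 ⟨x, h.1, hxy⟩,
        fun h => h.1.2 (hdef y h.2 x hxy)⟩
    · simp only [Matrix.cons_val, Finset.mem_filter, Finset.mem_univ, true_and]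
      by_cases hx : x ∈ S
      · exact Or.inl hx
      by_cases ha : ∃ y ∈ S, (y, x) ∈ F.R
      · exact Or.inr (Or.inl ⟨ha, ha⟩)
      -- Completeness shows that `x` is not defended, so some attacker `y` is not attacked by `S`.
      -- As `S` does not attack `x`, `y` is not in `S`; thus `y` is the unrelated attacker required.
      · have hnd := mt (hcomp x).2 hx
        push Not at hnd
        obtain ⟨y, hyx, hy⟩ := hnd
        refine Or.inr (Or.inr ⟨⟨hx, ha⟩, y, ⟨fun hyS => ha ⟨y, hyS, hyx⟩, ?_⟩, hyx⟩)
        rintro ⟨z, hz, hzy⟩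
        exact hy z hz hzy

/-- `b 1` is the set of arguments attacked by `b 0`. -/
def IsAttackedSet (F : AF V) (b : Fin 2 → Finset V) : Prop :=
  ∀ x, x ∈ b 1 ↔ ∃ y ∈ b 0, (y, x) ∈ F.R

theorem IsAttackedSet.coe_union {b : Fin 2 → Finset V} (h : F.IsAttackedSet b) :
    ((b 0 ∪ b 1 : Finset V) : Set V) = F.range (b 0) := by
  ext x
  simp [range, h x]

theorem exists_isAttackedSet (F : AF V) (S : Finset V) : ∃ b, F.IsAttackedSet b ∧ b 0 = S := by
  classical
  exact ⟨![S, Finset.univ.filter fun x => ∃ y ∈ S, (y, x) ∈ F.R],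
    fun x => Finset.mem_filter_univ x, rfl⟩

theorem valid_stagSpec_iff (hverts : T.verts = Finset.univ) (hedges : T.edges F.R = F.R)
    (hroot : T.root = ∅) {b : Fin 2 → Finset V} :
    stagSpec.Valid F.R T b ↔ F.ConflictFree (b 0) ∧ F.IsAttackedSet b := by
  rw [valid_iff_of_root_eq_empty hverts hedges hroot]
  simp only [stagSpec, color, attackedBy, ConflictFree, IsAttackedSet]
  constructor
  · rintro ⟨_, h1, h2⟩
    exact ⟨fun s hs s' hs' h => (h1 s s' h).1 ⟨hs, hs'⟩,
      fun x => ⟨h2 x, fun ⟨y, hy, h⟩ => (h1 y x h).2 hy⟩⟩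
  · rintro ⟨h1, h2⟩
    refine ⟨fun x hx => ?_, fun x y h => ⟨fun hxy => h1 x hxy.1 y hxy.2 h, fun hx => ?_⟩,
      fun x => (h2 x).1⟩
    · obtain ⟨y, hy, h⟩ := (h2 x).1 hx.2
      exact h1 y hy x hx.1 h
    · exact (h2 y).2 ⟨x, hx, h⟩

/-- Only the defence goal is added to the specification of STAG, so the equivalence for
conflict-free sets can be reused. -/
theorem valid_semiSpec_iff (hverts : T.verts = Finset.univ) (hedges : T.edges F.R = F.R)
    (hroot : T.root = ∅) {b : Fin 2 → Finset V} :
    semiSpec.Valid F.R T b ↔ F.Admissible (b 0) ∧ F.IsAttackedSet b := by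
  have h := valid_stagSpec_iff hverts hedges hroot (b := b)
  rw [valid_iff_of_root_eq_empty hverts hedges hroot] at h ⊢
  have hadm : F.Admissible (b 0) ↔ F.ConflictFree (b 0) ∧
      ∀ x, attacks F.R b x 0 → attackedBy F.R b x 0 := by
    refine and_congr_right fun _ => ⟨fun h x => ?_, fun h s hs s' hss' => h s' ⟨s, hs, hss'⟩⟩
    rintro ⟨y, hy, hxy⟩
    exact h y hy x hxy
  rw [hadm, and_right_comm, ← h]
  simp only [semiSpec, stagSpec, forall_and]
  tauto

/-- Since the guess is pinned down to the attacked set, the key is the range. Comparing keys of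
valid families therefore amounts to comparing ranges of arbitrary competitors `S'`. -/
theorem range_maximal_iff (P : Finset V → Prop) (Q : (Fin 2 → Finset V) → Prop)
    (hQ : ∀ b, Q b ↔ P (b 0) ∧ F.IsAttackedSet b) (S : Finset V) :
    (∃ b, Q b ∧ b 0 = S ∧ ∀ b', Q b' → ¬ b 0 ∪ b 1 ⊂ b' 0 ∪ b' 1) ↔
      P S ∧ ¬ ∃ S', P S' ∧ F.range S ⊂ F.range S' := by
  constructor
  · rintro ⟨b, hb, rfl, hmax⟩
    obtain ⟨h1, h2⟩ := (hQ b).1 hb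
    refine ⟨h1, ?_⟩
    rintro ⟨S', hS', hlt⟩
    obtain ⟨b', hb', rfl⟩ := exists_isAttackedSet F S'
    refine hmax b' ((hQ b').2 ⟨hS', hb'⟩) (Finset.coe_ssubset.1 ?_)
    rwa [h2.coe_union, hb'.coe_union]
  · rintro ⟨h1, h2⟩
    obtain ⟨b, hb, rfl⟩ := exists_isAttackedSet F S
    refine ⟨b, (hQ b).2 ⟨h1, hb⟩, rfl, fun b' hb' hlt => h2 ⟨b' 0, ((hQ b').1 hb').1, ?_⟩⟩
    rw [← hb.coe_union, ← ((hQ b').1 hb').2.coe_union]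
    exact Finset.coe_ssubset.2 hlt

theorem union_sup (b c : Fin 2 → Finset V) :
    (b ⊔ c) 0 ∪ (b ⊔ c) 1 = (b 0 ∪ b 1) ⊔ (c 0 ∪ c 1) :=
  sup_sup_sup_comm (b 0) (c 0) (b 1) (c 1)

end AF

end

/-! ### The six algorithms together. -/

theorem mainTheorem3 {V : Type*} [Fintype V] [DecidableEq V] (F : AF V) (sem : Semantics)
    (c : V) (P : Finset V) (T : RTree (Finset V))
    (hT : T.IsTreeDecomposition F.underlyingGraph) (hnice : T.IsNice) :
    (F.localAlg c sem).mdpa P T = F.projectedCredulousCount sem c P := by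
  have hT' := hT.niceDecomp hnice.1
  have hv := hT.verts_eq
  have he := hT.edges_eq
  have hr := hnice.2
  have hcount : ∀ Q : Finset V → Prop, (∀ S, Q S ↔ F.IsExtension sem S) →
      Set.ncard {X | ∃ S, Q S ∧ c ∈ S ∧ X = S ∩ P} = F.projectedCredulousCount sem c P :=
    fun Q hQ => by simp only [hQ]; rfl
  cases sem with
  | admissible =>
    refine (F.implements_admBase.mdpa_eq (i := ()) hT' hv rfl (fun _ => rfl) ?_ c P).trans
      (hcount _ fun S => ?_)
    · intro b b'
      simp only [AF.admRow, hr, AF.attackersIn_empty, AF.attackedIn_empty, Finset.inter_empty]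
      rfl
    · simp only [AF.valid_admSpec_iff hv he hr]
      exact ⟨fun ⟨b, h, hb⟩ => hb ▸ h, fun h => ⟨fun _ => S, h, rfl⟩⟩
  | complete =>
    refine (F.implements_compBase.mdpa_eq (i := 0) hT' hv rfl (fun _ => rfl) ?_ c P).trans
      (hcount _ fun S => AF.exists_valid_compSpec_iff hv he hr)
    intro b b'
    simp only [AF.compRow, hr, AF.attackedIn_empty, Finset.inter_empty]
    rfl
  | stable =>
    refine (F.implements_stabBase.mdpa_eq (i := ()) hT' hv rfl (fun _ => rfl) ?_ c P).trans
      (hcount _ fun S => ?_)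
    · intro b b'
      simp only [AF.stabRow, hr, AF.attackedIn_empty, Finset.inter_empty]
      rfl
    · simp only [AF.valid_stabSpec_iff hv he hr]
      exact ⟨fun ⟨b, h, hb⟩ => hb ▸ h, fun h => ⟨fun _ => S, h, rfl⟩⟩
  | preferred =>
    refine (F.implements_admBase.mdpa_maximize_eq (i := ()) hT' hv rfl (fun _ => rfl) ?_
      (fun b => b ()) (fun _ _ => rfl) F.tracks_admBase c P).trans (hcount _ fun S => ?_)
    · intro b b'
      simp only [AF.admRow, hr, AF.attackersIn_empty, AF.attackedIn_empty, Finset.inter_empty]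
      rfl
    · simp only [AF.valid_admSpec_iff hv he hr]
      constructor
      · rintro ⟨b, h, rfl, hmax⟩
        exact ⟨h, fun ⟨S', hlt, hS'⟩ => hmax (fun _ => S') hS' hlt⟩
      · rintro ⟨h, hmax⟩
        exact ⟨fun _ => S, h, rfl, fun b' hb' hlt => hmax ⟨b' (), hlt, hb'⟩⟩
  | stage =>
    refine (F.implements_stagBase.mdpa_maximize_eq (i := 0) hT' hv rfl (fun _ => rfl) ?_
      (fun b => b 0 ∪ b 1) AF.union_sup (AF.tracks_union F.tracks_stagBase F.tracks_stagBase_AC)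
      c P).trans (hcount _ fun S => ?_)
    · intro b b'
      simp only [AF.stagRow, hr, AF.attackedIn_empty, Finset.inter_empty]
      rfl
    · exact AF.range_maximal_iff _ _ (fun b => AF.valid_stagSpec_iff hv he hr) S
  | semistable =>
    refine (F.implements_semiBase.mdpa_maximize_eq (i := 0) hT' hv rfl (fun _ => rfl) ?_
      (fun b => b 0 ∪ b 1) AF.union_sup (AF.tracks_union F.tracks_semiBase F.tracks_semiBase_AC)
      c P).trans (hcount _ fun S => ?_)
    · intro b b'
      simp only [AF.semiRow, hr, AF.attackersIn_empty, AF.attackedIn_empty, Finset.inter_empty]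
      rfl
    · exact AF.range_maximal_iff _ _ (fun b => AF.valid_semiSpec_iff hv he hr) S
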